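/- Let $\lambda\ge -\frac1\pi$ be real and $\mu>0$. Put $\alpha_\lambda=\frac{\arcsin(\lambda\pi)}{\pi}$ if $|\lambda|\le\frac1\pi$ and $\alpha_\lambda=\frac12+\mathrm i\,\frac{\operatorname{arcosh}(\lambda\pi)}{\pi}$ if $\lambda\ge\frac1\pi$, and let ${}_2F_1(a,b;c;\cdot)$ be the Gauss hypergeometric function, analytically continued to $\mathbb C\setminus[1,\infty)$. Define $$\varrho_\lambda(x)=x\;{}_2F_1\Big(\alpha_\lambda,\,1-\alpha_\lambda;\,2;\,-\frac{x}{\mu^2}\Big)\qquad(x\ge 0).$$ 1. The function $\varrho_\lambda$ is real-valued on $[0,\infty)$ and solves the Fredholm equation for the deformed measure of the quartic matrix field theory on the $4$-dimensional Moyal space: for all $x\ge0$ the following integral converges absolutely and $$\varrho_\lambda(x)=x-\lambda x^2\int_0^\infty\frac{\varrho_\lambda(t)\,dt}{(t+\mu^2)^2\,(t+\mu^2+x)}.$$ 2. Let moreover $\lambda\ne0$. Then $\frac{\alpha_\lambda(1-\alpha_\lambda)}{\lambda}>0$, so that the choice $\mu^2=\frac{\alpha_\lambda(1-\alpha_\lambda)}{\lambda}$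 is possible. For $z\in\mathbb C\setminus(-\infty,-\mu^2)$ put $$R_4(z)=z-\lambda z^2\int_0^\infty\frac{\varrho_\lambda(t)\,dt}{(t+\mu^2)^2(t+\mu^2+z)}.$$ This choice is the natural one for the boundary condition in the following sense: for every $\mu>0$, the integral in $R_4(-\mu^2)$ and the integral $\int_0^\infty\frac{\varrho_\lambda(t)\,dt}{(t+\mu^2)^3}$ converge absolutely, and each of the two conditions $$R_4(-\mu^2)=-1,\qquad \int_0^\infty\frac{\varrho_\lambda(t)\,dt}{(t+\mu^2)^3}=\frac12$$ holds if and only if $\mu^2=\frac{\alpha_\lambda(1-\alpha_\lambda)}{\lambda}$. 3. This choice differs from the boundary condition $\frac{\partial}{\partial a}G(a,0)|_{a=0}=-1$ induced by Zimmermann's forest formula. Here $G$ is the planar two-point function $$G(a,b)=\frac{\mu^2\,e^{N(a,b)}}{\mu^2+a+b},\qquad N(a,b)=\frac1{2\pi\mathrm i}\int_{-\infty}^\infty\!\big\{L_{R_4}(a,b;t)-L_{\mathrm{id}}(a,b;t)-L_{R_4}(0,0;t)+L_{\mathrm{id}}(0,0;t)\big\}\,dt,$$ $$L_f(a,b;t)=\log\!\big(a-f(-\tfrac{\mu^2}{2}-\mathrm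 it)\big)\,\frac{d}{dt}\log\!\big(b-f(-\tfrac{\mu^2}{2}+\mathrm it)\big),$$ with principal logarithms. That is, for all sufficiently small $|\lambda|\neq0$ and $\mu^2=\frac{\alpha_\lambda(1-\alpha_\lambda)}{\lambda}$, the integral $N(a,0)$ converges absolutely for all $a\ge0$, and the one-sided derivative $\frac{\partial}{\partial a}G(a,0)|_{a=0}$ exists and is different from $-1$. -/

import Mathlib

open MeasureTheory Set Filter Topology

noncomputable section

namespace MoyalFour

/-- The cut plane `ℂ ∖ [1, ∞)`. -/
def cutPlane : Set ℂ := {z : ℂ | 1 - z ∈ Complex.slitPlane}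

/-- `F` is the principal branch of the Gauss hypergeometric function: it is holomorphic on
`ℂ ∖ [1, ∞)` and is given by the hypergeometric series on the open unit disc. -/
def IsHyp2F1 (a b c : ℂ) (F : ℂ → ℂ) : Prop :=
  DifferentiableOn ℂ F cutPlane ∧ ∀ z : ℂ, ‖z‖ < 1 → F z = ordinaryHypergeometric a b c z

open Classical in
/-- The Gauss hypergeometric function `₂F₁(a, b; c; z)` on `ℂ ∖ [1, ∞)`, i.e. the analytic
continuation of the hypergeometric series (which by itself has radius of convergence one). -/
def hyp2F1 (a b c z : ℂ) : ℂ :=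
  if h : ∃ F : ℂ → ℂ, IsHyp2F1 a b c F then h.choose z else 0

theorem isOpen_cutPlane : IsOpen cutPlane :=
  Complex.isOpen_slitPlane.preimage (continuous_const.sub continuous_id)

theorem zero_mem_cutPlane : (0 : ℂ) ∈ cutPlane := by
  simp [cutPlane]

theorem isPreconnected_cutPlane : IsPreconnected cutPlane := by
  have h : cutPlane = (fun w : ℂ => 1 - w) '' Complex.slitPlane := by
    ext z
    constructor
    · intro hz
      exact ⟨1 - z, hz, by ring⟩
    · rintro ⟨w, hw, rfl⟩
      simpa [cutPlane] using hw
  rw [h]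
  exact (Complex.starConvex_one_slitPlane.isPathConnected
    Complex.one_mem_slitPlane).isConnected.isPreconnected.image _ (by fun_prop)

/-- The continuation is unique, so `hyp2F1` does not depend on the choice made. -/
theorem hyp2F1_eq {a b c : ℂ} {F : ℂ → ℂ} (hF : IsHyp2F1 a b c F) {z : ℂ}
    (hz : z ∈ cutPlane) : hyp2F1 a b c z = F z := by
  have hex : ∃ F : ℂ → ℂ, IsHyp2F1 a b c F := ⟨F, hF⟩
  have hG := hex.choose_spec
  have h1 : hyp2F1 a b c z = hex.choose z := by simp only [hyp2F1, dif_pos hex]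
  rw [h1]
  refine AnalyticOnNhd.eqOn_of_preconnected_of_eventuallyEq
    (hG.1.analyticOnNhd isOpen_cutPlane) (hF.1.analyticOnNhd isOpen_cutPlane)
    isPreconnected_cutPlane zero_mem_cutPlane ?_ hz
  filter_upwards [Metric.ball_mem_nhds (0 : ℂ) one_pos] with w hw
  have hw' : ‖w‖ < 1 := by simpa using hw
  rw [hG.2 w hw', hF.2 w hw']

/-- The exponent `α_λ`, for `λ ≥ -1/π`: it is `arcsin(λπ)/π` if `|λ| ≤ 1/π` and
`1/2 + i arcosh(λπ)/π` if `λ ≥ 1/π` (both give `1/2` at `λ = 1/π`). -/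
def alpha (lam : ℝ) : ℂ :=
  if lam ≤ 1 / Real.pi then ((Real.arcsin (lam * Real.pi) / Real.pi : ℝ) : ℂ)
  else 1 / 2 + Complex.I * ((Real.arcosh (lam * Real.pi) / Real.pi : ℝ) : ℂ)

/-- The complex number `x · ₂F₁(α_λ, 1 - α_λ; 2; -x/μ²)`. -/
def hypDensity (lam μ x : ℝ) : ℂ :=
  (x : ℂ) * hyp2F1 (alpha lam) (1 - alpha lam) 2 (-(x : ℂ) / (μ : ℂ) ^ 2)

/-- The real function given by the real part of `hypDensity` (the imaginary part vanishes). -/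
def rho (lam μ x : ℝ) : ℝ := (hypDensity lam μ x).re

/-- `ρ` solves, on `[0, ∞)`, the linear integral equation
`ρ(x) = x - λ x² ∫₀^∞ ρ(t) dt / ((t + μ²)² (t + μ² + x))`, with convergent integrals. -/
def SolvesFredholm (lam μ : ℝ) (ρ : ℝ → ℝ) : Prop :=
  ∀ x : ℝ, 0 ≤ x →
    IntegrableOn (fun t : ℝ => ρ t / ((t + μ ^ 2) ^ 2 * (t + μ ^ 2 + x))) (Ioi 0) ∧
    ρ x = x - lam * x ^ 2 * ∫ t in Ioi (0 : ℝ), ρ t / ((t + μ ^ 2) ^ 2 * (t + μ ^ 2 + x))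

/-- `R₄(z) = z - λ z² ∫₀^∞ ρ(t) dt / ((t + μ²)² (t + μ² + z))`. -/
def R4 (lam μ : ℝ) (ρ : ℝ → ℝ) (z : ℂ) : ℂ :=
  z - (lam : ℂ) * z ^ 2 *
    ∫ t in Ioi (0 : ℝ), (ρ t : ℂ) / (((t : ℂ) + (μ : ℂ) ^ 2) ^ 2 * ((t : ℂ) + (μ : ℂ) ^ 2 + z))

/-- `μ² = α_λ (1 - α_λ) / λ` (for `λ ≠ 0`). -/
def IsNaturalMass (lam μ : ℝ) : Prop :=
  (μ : ℂ) ^ 2 = alpha lam * (1 - alpha lam) / (lam : ℂ)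

/-- The point `-μ²/2 + i t`. -/
def linePoint (μ t : ℝ) : ℂ := -(μ : ℂ) ^ 2 / 2 + Complex.I * (t : ℂ)

/-- `log (a - f(-μ²/2 - i t)) · d/dt log (b - f(-μ²/2 + i t))`. -/
def logTerm (μ : ℝ) (f : ℂ → ℂ) (a b t : ℝ) : ℂ :=
  Complex.log ((a : ℂ) - f (linePoint μ (-t))) *
    deriv (fun s : ℝ => Complex.log ((b : ℂ) - f (linePoint μ s))) t

/-- The integrand of the exponent `N₄(a, b)` of the planar two-point function. -/
def exponentIntegrand (lam μ : ℝ) (ρ : ℝ → ℝ) (a b t : ℝ) : ℂ :=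
  logTerm μ (R4 lam μ ρ) a b t - logTerm μ id a b t
    - logTerm μ (R4 lam μ ρ) 0 0 t + logTerm μ id 0 0 t

/-- The planar two-point function `G(a, b) = μ² exp (N₄(a, b)) / (μ² + a + b)`, where
`N₄(a, b) = (2 π i)⁻¹ ∫_ℝ exponentIntegrand dt`; it is normalised to `G(0, 0) = 1`. -/
def twoPoint (lam μ : ℝ) (ρ : ℝ → ℝ) (a b : ℝ) : ℂ :=
  (μ : ℂ) ^ 2 *
    Complex.exp ((1 / (2 * (Real.pi : ℂ) * Complex.I)) *
      ∫ t : ℝ, exponentIntegrand lam μ ρ a b t) /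
    ((μ : ℂ) ^ 2 + (a : ℂ) + (b : ℂ))

end MoyalFour

end

open scoped ComplexConjugate

namespace MoyalFour

/-! ### Power series with polynomially bounded coefficients -/

/-! Everything reduces to one real initial value problem. With κ = α(1-α), let ψ solve t(t+1)ψ'' =
-κψ, ψ(0) = 0, ψ'(0) = 1 on [0,∞); the density is μ²ψ(x/μ²). Since κ ≥ -3/4, ψ' is O(√t), so Green's
identity ∫ψ(κf/(t(t+1)) + f'') = f(0) (`Profile.integral_by_parts`) holds for f decaying like 1/t,
with matching decay of f' and f''. The explicit evaluations come from suitable choices of f.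

Powers of 1/(t+1) give a recursion for the moments M_k = ∫ψ(t+1)^(-k-3) and the limit (k+1)(k+2)M_k
→ 1. Iterating the recursion produces Euler's sine product, so 2M_0 sin(πα) = πκ, and sin(πα) = λπ
turns this into 2λM_0 = κ (`Profile.moment_zero`). A combination of 1/(t+1) and 1/(t+1+z) then shows
that the right side of the Fredholm equation, `ext`, solves the equation of ψ on the cut plane.
Equal initial data force `ext` = ψ on the half line. The Taylor coefficients of `ext` are moments up
to sign and the factor λ, and they obey Gauss's recursion, which identifies the hypergeometric
function. At the tip of the cut `ext` equals -λ/κ, and the cubic integral is M_0/μ²; both boundary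
conditions therefore say μ² = κ/λ = 2M_0.

On the line Re z = -1/2 the product z(z+1) is real, so the real and imaginary parts X, Y of `ext`
solve y'' = -κy/(t²+1/4) separately. For small κ, comparison with powers gives |Z'| = O(t^(1/4)) and
|Z| ≥ c t^(7/8) for Z = X + iY, which permits differentiation under the integral in the exponent.
The outcome is Re ∂G/∂a = -L/(πμ²) with L = ∫ Y'/(X²+Y²) over (0,∞), so the claim is L ≠ 2πM_0.

Were X frozen at X(0) = -x, an arctangent would give L = π/(2x), while 4xM_0 = 1-κδ with δ ≥ M_0/2 >
0 (`Profile.two_mul_center`). For κ < 0, X² only grows, hence L ≤ π/(2x) < 2πM_0. For κ > 0, X² ≤ x²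
up to times of order κ^(-1/2); the tail beyond a large T costs at most 768κ/√T, less than the gain
of order κ, hence L > 2πM_0. -/

theorem summable_of_poly_bound {a : ℕ → ℝ} {K : ℕ} (ha : ∀ n, |a n| ≤ ((n : ℝ) + 1) ^ K)
    {r : ℝ} (hr : |r| < 1) : Summable fun n => a n * r ^ n := by
  have h1 : Summable fun n : ℕ => ((n : ℝ) ^ K * |r| ^ n) :=
    summable_pow_mul_geometric_of_norm_lt_one K (by simpa using hr)
  have h2 : Summable fun n : ℕ => ((n : ℝ) + 1) ^ K * |r| ^ n := by
    by_cases h0 : r = 0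
    · subst h0
      refine summable_of_ne_finset_zero (s := {0}) fun n hn => ?_
      have : n ≠ 0 := by simpa using hn
      simp [this]
    · have h3 := ((summable_nat_add_iff 1).2 h1).mul_right (|r|⁻¹)
      refine h3.congr fun n => ?_
      have : |r| ≠ 0 := abs_ne_zero.2 h0
      push_cast
      field_simp
      ring
  refine Summable.of_norm_bounded h2 fun n => ?_
  rw [Real.norm_eq_abs, abs_mul, abs_pow]
  exact mul_le_mul_of_nonneg_right (ha n) (by positivity)

theorem hasDerivAt_tsum_pow {a : ℕ → ℝ} {K : ℕ} (ha : ∀ n, |a n| ≤ ((n : ℝ) + 1) ^ K)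
    {y : ℝ} (hy : |y| < 1) :
    HasDerivAt (fun x => ∑' n, a n * x ^ n) (∑' n : ℕ, ((n : ℝ) + 1) * a (n + 1) * y ^ n) y := by
  obtain ⟨r, hyr, hr1⟩ := exists_between hy
  have hr0 : 0 < r := lt_of_le_of_lt (abs_nonneg y) hyr
  have hu : Summable fun n : ℕ => (n : ℝ) * |a n| * r ^ (n - 1) := by
    rw [← summable_nat_add_iff 1]
    -- The factor 2^K absorbs the index shift: (n+2)^K ≤ 2^K (n+1)^K.
    have h1 : ∀ n : ℕ, abs (((n : ℝ) + 1) * |a (n + 1)| / 2 ^ K) ≤ ((n : ℝ) + 1) ^ (K + 1) := by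
      intro n
      rw [abs_of_nonneg (by positivity), pow_succ', div_le_iff₀ (by positivity), mul_assoc]
      refine mul_le_mul_of_nonneg_left ((ha (n + 1)).trans ?_) (by positivity)
      rw [← mul_pow]
      refine pow_le_pow_left₀ (by positivity) ?_ K
      push_cast
      have : (0 : ℝ) ≤ n := n.cast_nonneg
      linarith
    refine ((summable_of_poly_bound (a := fun n => ((n : ℝ) + 1) * |a (n + 1)| / 2 ^ K) h1 (r := r)
      (by rwa [abs_of_pos hr0])).mul_left ((2 : ℝ) ^ K)).congr fun n => ?_
    rw [Nat.add_sub_cancel]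
    push_cast
    field_simp
  have hmem : ∀ x ∈ Ioo (-r) r, |x| < r := fun x hx => abs_lt.2 hx
  have key := hasDerivAt_tsum_of_isPreconnected (g := fun n x => a n * x ^ n)
    (g' := fun n x => a n * (n * x ^ (n - 1))) hu isOpen_Ioo isPreconnected_Ioo
    (fun n x _ => (hasDerivAt_pow n x).const_mul (a n))
    (fun n x hx => by
      rw [Real.norm_eq_abs, abs_mul, abs_mul, abs_pow, Nat.abs_cast, mul_comm (n : ℝ) |a n|,
        mul_assoc]
      gcongr
      · exact (hmem x hx).le) (y₀ := 0) (by constructor <;> linarith)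
    (summable_of_poly_bound ha (by simp)) (abs_lt.1 hyr)
  refine key.congr_deriv ?_
  have hsum : Summable fun n : ℕ => a n * (n * y ^ (n - 1)) := by
    refine Summable.of_norm_bounded hu fun n => ?_
    rw [Real.norm_eq_abs, abs_mul, abs_mul, abs_pow, Nat.abs_cast]
    rw [mul_comm (n : ℝ) |a n|, mul_assoc]
    gcongr
  rw [hsum.tsum_eq_zero_add (f := fun n : ℕ => a n * (n * y ^ (n - 1)))]
  simp only [CharP.cast_eq_zero, zero_mul, mul_zero, zero_add, Nat.add_sub_cancel]
  refine tsum_congr fun n => ?_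
  push_cast
  ring

/-- Multiplication by 1 - y takes first differences of the coefficients. -/
theorem one_sub_mul_tsum {a b : ℕ → ℝ} {y : ℝ} (h0 : b 0 = a 0)
    (h1 : ∀ n, b (n + 1) = a (n + 1) - a n) (ha : Summable fun n => a n * y ^ n) :
    (1 - y) * ∑' n, a n * y ^ n = ∑' n, b n * y ^ n := by
  have h2 : Summable fun n => a (n + 1) * y ^ (n + 1) :=
    (summable_nat_add_iff 1 (f := fun n => a n * y ^ n)).2 ha
  have h3 : Summable fun n => b (n + 1) * y ^ (n + 1) := by
    refine (h2.sub (ha.mul_left y)).congr fun n => ?_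
    rw [h1]; ring
  have hb : Summable fun n => b n * y ^ n :=
    (summable_nat_add_iff 1 (f := fun n => b n * y ^ n)).1 h3
  rw [hb.tsum_eq_zero_add, sub_mul, one_mul, ← tsum_mul_left]
  nth_rewrite 1 [ha.tsum_eq_zero_add]
  rw [add_sub_assoc, ← h2.tsum_sub (ha.mul_left y), h0]
  congr 1
  refine tsum_congr fun n => ?_
  rw [h1]; ring

/-! ### Linear second order equations on the half line -/

/-- `y'' = -q y` on `(0, ∞)`, with `y` and `y'` regular at the origin. -/
structure SecondOrder (q y y' : ℝ → ℝ) : Prop where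
  deriv : ∀ t, 0 ≤ t → HasDerivAt y (y' t) t
  deriv2 : ∀ t, 0 < t → HasDerivAt y' (-(q t) * y t) t
  cont : ContinuousAt y' 0

/-- The coefficients `((n + 1) u_n, q_n)` of the solution in the variable `x / (1 + x)`. -/
noncomputable def solCoeff (κ : ℝ) : ℕ → ℝ × ℝ
  | 0 => (1, 1)
  | n + 1 => ((solCoeff κ n).1 + ((solCoeff κ n).2 - κ * (solCoeff κ n).1 / ((n : ℝ) + 1) ^ 2),
      (solCoeff κ n).2 - κ * (solCoeff κ n).1 / ((n : ℝ) + 1) ^ 2)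

/-- One step of the recursion enlarges the bound by at most 1 + K/(n+1), which Bernoulli's
inequality bounds by ((n+2)/(n+1))^K; so growth is polynomial of degree governed by |κ|. -/
theorem solCoeff_bound {κ : ℝ} {K : ℕ} (hK : |κ| ≤ K) (n : ℕ) :
    |(solCoeff κ n).1| ≤ ((n : ℝ) + 1) * ((n : ℝ) + 1) ^ K ∧
      |(solCoeff κ n).2| ≤ ((n : ℝ) + 1) ^ K := by
  induction n with
  | zero => simp [solCoeff]
  | succ n ih =>
    obtain ⟨h1, h2⟩ := ih
    have hn : (0 : ℝ) < (n : ℝ) + 1 := by positivity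
    have hb : 1 + (K : ℝ) * (1 / ((n : ℝ) + 1)) ≤ (1 + 1 / ((n : ℝ) + 1)) ^ K :=
      one_add_mul_le_pow (le_trans (by norm_num) (by positivity : (0 : ℝ) ≤ 1 / ((n : ℝ) + 1))) K
    have hY : ((n : ℝ) + 1) ^ K * (1 + (K : ℝ) * (1 / ((n : ℝ) + 1))) ≤ ((n : ℝ) + 1 + 1) ^ K := by
      calc _ ≤ ((n : ℝ) + 1) ^ K * (1 + 1 / ((n : ℝ) + 1)) ^ K := by gcongr
        _ = _ := by rw [← mul_pow]; congr 1; field_simp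
    have hq : |(solCoeff κ (n + 1)).2| ≤
        ((n : ℝ) + 1) ^ K * (1 + (K : ℝ) * (1 / ((n : ℝ) + 1))) := by
      simp only [solCoeff]
      calc _ ≤ |(solCoeff κ n).2| + |κ * (solCoeff κ n).1 / ((n : ℝ) + 1) ^ 2| := abs_sub _ _
        _ ≤ ((n : ℝ) + 1) ^ K + K * (((n : ℝ) + 1) * ((n : ℝ) + 1) ^ K) / ((n : ℝ) + 1) ^ 2 := by
          rw [abs_div, abs_mul, abs_of_pos (by positivity : 0 < ((n : ℝ) + 1) ^ 2)]
          gcongr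
        _ = _ := by field_simp
    have hq' := hq.trans hY
    refine ⟨?_, by push_cast; exact hq'⟩
    have hp : (solCoeff κ (n + 1)).1 = (solCoeff κ n).1 + (solCoeff κ (n + 1)).2 := rfl
    rw [hp]
    push_cast
    have h3 : ((n : ℝ) + 1) ^ K ≤ ((n : ℝ) + 1 + 1) ^ K := by gcongr; linarith
    calc _ ≤ |(solCoeff κ n).1| + |(solCoeff κ (n + 1)).2| := abs_add_le _ _
      _ ≤ ((n : ℝ) + 1) * ((n : ℝ) + 1 + 1) ^ K + ((n : ℝ) + 1 + 1) ^ K := by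
        refine add_le_add (h1.trans ?_) hq'
        gcongr
      _ = _ := by ring

/-- A series in x would only converge for x < 1. The substitution y = x/(1+x) maps the half line
onto [0,1), and since x(x+1) = y/(1-y)² and d/dx = (1-y)² d/dy, the equation becomes the system V =
(1-y)²H', V' = -κH/y. Dividing V by (1-y)² corresponds to summing coefficients twice. -/
theorem exists_solution (κ : ℝ) : ∃ ψ ψ' : ℝ → ℝ,
    SecondOrder (fun t => κ / (t * (t + 1))) ψ ψ' ∧ ψ 0 = 0 ∧ ψ' 0 = 1 := by
  obtain ⟨K, hK⟩ := exists_nat_ge |κ|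
  have hb := solCoeff_bound hK
  set P : ℕ → ℝ := fun n => (solCoeff κ n).1 with hP
  set Q : ℕ → ℝ := fun n => (solCoeff κ n).2 with hQ
  have hrecP : ∀ n, Q (n + 1) = P (n + 1) - P n := fun n => by simp [P, Q, solCoeff]
  have hrecQ : ∀ n : ℕ, Q (n + 1) - Q n = -κ * P n / ((n : ℝ) + 1) ^ 2 := fun n => by
    simp only [P, Q, solCoeff]; ring
  have hPb : ∀ n, |P n| ≤ ((n : ℝ) + 1) ^ (K + 1) := fun n => by
    rw [pow_succ']; exact (hb n).1
  have hQb : ∀ n, |Q n| ≤ ((n : ℝ) + 1) ^ K := fun n => (hb n).2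
  let u : ℕ → ℝ := fun n => P n / ((n : ℝ) + 1)
  have hub : ∀ n, |u n| ≤ ((n : ℝ) + 1) ^ K := fun n => by
    have hn : (0 : ℝ) < (n : ℝ) + 1 := by positivity
    simp only [u]
    rw [abs_div, abs_of_pos hn, div_le_iff₀ hn, mul_comm]
    exact (hb n).1
  -- Coefficients of H = yφ and of V; the entries 0 and 1 at index zero are the initial data ψ(0) =
  -- 0 and ψ'(0) = 1.
  let hc : ℕ → ℝ := fun n => Nat.casesOn n 0 u
  let vc : ℕ → ℝ := fun n => Nat.casesOn n 1 fun k => -κ * u k / ((k : ℝ) + 1)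
  have hhcb : ∀ n, |hc n| ≤ ((n : ℝ) + 1) ^ K := fun n => by
    cases n with
    | zero => simp [hc]
    | succ n =>
      refine (hub n).trans ?_
      push_cast
      gcongr
      linarith
  have hvc1 : ∀ n, vc (n + 1) = Q (n + 1) - Q n := fun n => by
    rw [hrecQ]
    simp only [vc, u]
    field_simp
  have hvcb : ∀ n, |vc n| ≤ ((n : ℝ) + 1) ^ (K + 1) := fun n => by
    cases n with
    | zero => simp [vc]
    | succ n =>
      rw [hvc1]
      push_cast
      have h0 : ((n : ℝ) + 1) ^ K ≤ ((n : ℝ) + 1 + 1) ^ K := by gcongr; linarith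
      have h1 := hQb (n + 1)
      push_cast at h1
      calc _ ≤ |Q (n + 1)| + |Q n| := abs_sub _ _
        _ ≤ ((n : ℝ) + 1 + 1) ^ K + ((n : ℝ) + 1 + 1) ^ K := by
          refine add_le_add h1 ((hQb n).trans h0)
        _ ≤ ((n : ℝ) + 1 + 1) * ((n : ℝ) + 1 + 1) ^ K := by
          have : (0 : ℝ) ≤ n := n.cast_nonneg
          have : (0 : ℝ) ≤ ((n : ℝ) + 1 + 1) ^ K := by positivity
          nlinarith
        _ = _ := by rw [pow_succ']
  let H : ℝ → ℝ := fun y => ∑' n, hc n * y ^ n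
  let V : ℝ → ℝ := fun y => ∑' n, vc n * y ^ n
  let φ : ℝ → ℝ := fun y => ∑' n, u n * y ^ n
  have hHφ : ∀ y, |y| < 1 → H y = y * φ y := fun y hy => by
    simp only [H, φ]
    rw [(summable_of_poly_bound hhcb hy).tsum_eq_zero_add, ← tsum_mul_left]
    have h0 : hc 0 = 0 := rfl
    rw [h0, zero_mul, zero_add]
    refine tsum_congr fun n => ?_
    change u n * y ^ (n + 1) = _
    ring
  have hH' : ∀ y, |y| < 1 → HasDerivAt H (V y / (1 - y) ^ 2) y := fun y hy => by
    have h1 := hasDerivAt_tsum_pow hhcb hy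
    have h2 : ∑' n : ℕ, ((n : ℝ) + 1) * hc (n + 1) * y ^ n = ∑' n, P n * y ^ n :=
      tsum_congr fun n => by
        simp only [hc, u]
        field_simp
    have h3 : (1 - y) * ∑' n, P n * y ^ n = ∑' n, Q n * y ^ n :=
      one_sub_mul_tsum (by simp [P, Q, solCoeff]) hrecP (summable_of_poly_bound hPb hy)
    have h4 : (1 - y) * ∑' n, Q n * y ^ n = V y :=
      one_sub_mul_tsum (by simp [vc, Q, solCoeff]) hvc1 (summable_of_poly_bound hQb hy)
    have h5 : (1 - y) ≠ 0 := by
      have := (abs_lt.1 hy).2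
      linarith
    refine h1.congr_deriv ?_
    rw [h2, ← h4, ← h3]
    field_simp
  have hV' : ∀ y, |y| < 1 → HasDerivAt V (-κ * φ y) y := fun y hy => by
    have h1 := hasDerivAt_tsum_pow hvcb hy
    refine h1.congr_deriv ?_
    simp only [φ]
    rw [← tsum_mul_left]
    refine tsum_congr fun n => ?_
    simp only [vc]
    field_simp
  have hsub : ∀ x : ℝ, 0 ≤ x → |x / (1 + x)| < 1 := fun x hx => by
    rw [abs_of_nonneg (by positivity), div_lt_one (by positivity)]
    linarith
  have hsd : ∀ x : ℝ, 0 ≤ x → HasDerivAt (fun x : ℝ => x / (1 + x)) (1 / (1 + x) ^ 2) x :=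
    fun x hx => by
      have h := (hasDerivAt_id x).div ((hasDerivAt_id x).const_add 1)
        (by simp only [id]; positivity)
      refine h.congr_deriv ?_
      simp only [id]
      ring
  have hcomp1 : ∀ x : ℝ, 0 ≤ x →
      HasDerivAt (fun x => H (x / (1 + x))) (V (x / (1 + x))) x := fun x hx => by
    have h := HasDerivAt.comp x (hH' _ (hsub x hx)) (hsd x hx)
    refine h.congr_deriv ?_
    have h1 : 1 + x ≠ 0 := by positivity
    have h2 : 1 - x / (1 + x) = 1 / (1 + x) := by field_simp; ring
    rw [h2]
    field_simp
  have hcomp2 : ∀ x : ℝ, 0 ≤ x →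
      HasDerivAt (fun x => V (x / (1 + x))) (-κ * φ (x / (1 + x)) * (1 / (1 + x) ^ 2)) x :=
    fun x hx => HasDerivAt.comp x (hV' _ (hsub x hx)) (hsd x hx)
  refine ⟨fun x => H (x / (1 + x)), fun x => V (x / (1 + x)), ⟨hcomp1, fun x hx => ?_,
    (hcomp2 0 le_rfl).continuousAt⟩, ?_, ?_⟩
  · refine (hcomp2 x hx.le).congr_deriv ?_
    rw [hHφ _ (hsub x hx.le)]
    field_simp
    ring
  · simp only [zero_div]
    rw [hHφ 0 (by simp)]
    simp
  · simp only [zero_div, V]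
    rw [tsum_eq_single 0]
    · simp [vc]
    · intro n hn
      simp [hn]

/-! ### Monotonicity on the half line -/

theorem monotoneOn_Ioi_of_hasDerivAt {f f' : ℝ → ℝ} (hd : ∀ t, 0 < t → HasDerivAt f (f' t) t)
    (hn : ∀ t, 0 < t → 0 ≤ f' t) : MonotoneOn f (Ioi 0) := by
  refine monotoneOn_of_deriv_nonneg (convex_Ioi 0)
    (fun t ht => (hd t ht).continuousAt.continuousWithinAt) ?_ ?_
  · intro t ht
    rw [interior_Ioi] at ht
    exact (hd t ht).differentiableAt.differentiableWithinAt
  · intro t ht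
    rw [interior_Ioi] at ht
    rw [(hd t ht).deriv]
    exact hn t ht

theorem antitoneOn_Ioi_of_hasDerivAt {f f' : ℝ → ℝ} (hd : ∀ t, 0 < t → HasDerivAt f (f' t) t)
    (hn : ∀ t, 0 < t → f' t ≤ 0) : AntitoneOn f (Ioi 0) := by
  have h := monotoneOn_Ioi_of_hasDerivAt (fun t ht => (hd t ht).neg)
    (fun t ht => neg_nonneg.2 (hn t ht))
  exact fun a ha b hb hab => neg_le_neg_iff.1 (h ha hb hab)

theorem le_of_monotoneOn_Ioi {f : ℝ → ℝ} {l : ℝ} (hm : MonotoneOn f (Ioi 0))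
    (hl : Tendsto f (𝓝[>] 0) (𝓝 l)) {t : ℝ} (ht : 0 < t) : l ≤ f t := by
  refine le_of_tendsto hl ?_
  filter_upwards [Ioo_mem_nhdsGT ht] with s hs
  exact hm hs.1 ht hs.2.le

theorem ge_of_antitoneOn_Ioi {f : ℝ → ℝ} {l : ℝ} (hm : AntitoneOn f (Ioi 0))
    (hl : Tendsto f (𝓝[>] 0) (𝓝 l)) {t : ℝ} (ht : 0 < t) : f t ≤ l := by
  refine ge_of_tendsto hl ?_
  filter_upwards [Ioo_mem_nhdsGT ht] with s hs
  exact hm hs.1 ht hs.2.le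

theorem abs_sub_le_of_hasDerivAt {f f' : ℝ → ℝ} {t B : ℝ} (ht : 0 ≤ t)
    (hc : ∀ s, 0 ≤ s → ContinuousAt f s) (hd : ∀ s, 0 < s → HasDerivAt f (f' s) s)
    (hb : ∀ s, 0 < s → s < t → |f' s| ≤ B) : |f t - f 0| ≤ B * t := by
  rcases ht.eq_or_lt with rfl | ht
  · simp
  obtain ⟨c, hc1, hc2⟩ := exists_hasDerivAt_eq_slope f f' ht
    (fun s hs => (hc s hs.1).continuousWithinAt) (fun s hs => hd s hs.1)
  have h := hb c hc1.1 hc1.2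
  rw [hc2, sub_zero, abs_div, abs_of_pos ht, div_le_iff₀ ht] at h
  exact h

/-! ### Comparison with powers, and uniqueness at a singular origin -/

namespace SecondOrder

variable {q y y' : ℝ → ℝ}

theorem continuousAt (S : SecondOrder q y y') {t : ℝ} (ht : 0 ≤ t) : ContinuousAt y t :=
  (S.deriv t ht).continuousAt

theorem continuousAt_deriv (S : SecondOrder q y y') {t : ℝ} (ht : 0 ≤ t) : ContinuousAt y' t := by
  rcases ht.eq_or_lt with rfl | ht
  · exact S.cont
  · exact (S.deriv2 t ht).continuousAt

theorem tendsto_zero (S : SecondOrder q y y') : Tendsto y (𝓝[>] 0) (𝓝 (y 0)) :=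
  (S.continuousAt le_rfl).tendsto.mono_left nhdsWithin_le_nhds

theorem tendsto_deriv_zero (S : SecondOrder q y y') : Tendsto y' (𝓝[>] 0) (𝓝 (y' 0)) :=
  S.cont.tendsto.mono_left nhdsWithin_le_nhds

theorem tendsto_div (S : SecondOrder q y y') (h0 : y 0 = 0) :
    Tendsto (fun t => y t / t) (𝓝[>] 0) (𝓝 (y' 0)) := by
  have h := (S.deriv 0 le_rfl).tendsto_slope_zero_right
  refine h.congr fun t => ?_
  simp [h0, div_eq_inv_mul]

theorem tendsto_sq_div (S : SecondOrder q y y') (h0 : y 0 = 0) :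
    Tendsto (fun t => y t ^ 2 / t) (𝓝[>] 0) (𝓝 0) := by
  have h := (S.tendsto_div h0).mul S.tendsto_zero
  rw [h0, mul_zero] at h
  refine h.congr fun t => ?_
  ring

theorem hasDerivAt_sq (S : SecondOrder q y y') {t : ℝ} (ht : 0 ≤ t) :
    HasDerivAt (fun t => y t ^ 2) (2 * y t * y' t) t := by
  refine ((S.deriv t ht).pow 2).congr_deriv ?_
  push_cast; ring

theorem hasDerivAt_deriv_sq (S : SecondOrder q y y') {t : ℝ} (ht : 0 < t) :
    HasDerivAt (fun t => y' t ^ 2) (2 * y' t * (-(q t) * y t)) t := by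
  refine ((S.deriv2 t ht).pow 2).congr_deriv ?_
  push_cast; ring

/-- If `q t² ≤ β (1 - β)` then the solution vanishing at the origin grows at least like `t ^ β`. -/
theorem mul_div_le_mul (S : SecondOrder q y y') (h0 : y 0 = 0) {β : ℝ}
    (hq : ∀ t, 0 < t → q t * t ^ 2 ≤ β * (1 - β)) {t : ℝ} (ht : 0 < t) :
    β * y t ^ 2 / t ≤ y t * y' t := by
  have hd : ∀ t, 0 < t → HasDerivAt (fun t => y t * y' t - β * (y t ^ 2 / t))
      (y' t * y' t + y t * (-(q t) * y t) - β * ((2 * y t * y' t * t - y t ^ 2 * 1) / t ^ 2)) t :=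
    fun t ht => ((S.deriv t ht.le).mul (S.deriv2 t ht)).sub
      (((S.hasDerivAt_sq ht.le).div (hasDerivAt_id t) ht.ne').const_mul β)
  have hm := monotoneOn_Ioi_of_hasDerivAt hd fun t ht => by
    -- The derivative of yy' - βy²/t is a perfect square plus the slack (β(1-β) - qt²)(y/t)².
    have h1 : 0 ≤ (y' t - β * y t / t) ^ 2 + (β * (1 - β) - q t * t ^ 2) * (y t / t) ^ 2 :=
      add_nonneg (sq_nonneg _) (mul_nonneg (sub_nonneg.2 (hq t ht)) (sq_nonneg _))
    refine h1.trans_eq ?_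
    field_simp
    ring
  have hl : Tendsto (fun t => y t * y' t - β * (y t ^ 2 / t)) (𝓝[>] 0) (𝓝 0) := by
    have h := (S.tendsto_zero.mul S.tendsto_deriv_zero).sub ((S.tendsto_sq_div h0).const_mul β)
    simpa [h0] using h
  have h := le_of_monotoneOn_Ioi hm hl ht
  have e : β * y t ^ 2 / t = β * (y t ^ 2 / t) := by ring
  rw [e]
  linarith

/-- Because yy' ≥ βy²/t ≥ 0, y² is nondecreasing, so y cannot return to zero after being positive
near the origin. -/
theorem pos (S : SecondOrder q y y') (h0 : y 0 = 0) (h1 : 0 < y' 0) {β : ℝ} (hβ : 0 ≤ β)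
    (hq : ∀ t, 0 < t → q t * t ^ 2 ≤ β * (1 - β)) {t : ℝ} (ht : 0 < t) : 0 < y t := by
  have hm : MonotoneOn (fun t => y t ^ 2) (Ioi 0) :=
    monotoneOn_Ioi_of_hasDerivAt (fun t ht => S.hasDerivAt_sq ht.le) fun t ht => by
      have h := S.mul_div_le_mul h0 hq ht
      have h2 : 0 ≤ β * y t ^ 2 / t := by positivity
      nlinarith
  have hev : ∀ᶠ s in 𝓝[>] (0 : ℝ), 0 < y s := by
    filter_upwards [(S.tendsto_div h0).eventually (lt_mem_nhds h1), self_mem_nhdsWithin]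
      with s hs hs0
    exact (div_pos_iff_of_pos_right hs0).1 hs
  have hne : ∀ t, 0 < t → y t ≠ 0 := fun t ht hyt => by
    obtain ⟨s, hs, hs'⟩ := (hev.and (Ioo_mem_nhdsGT ht)).exists
    have h := hm hs'.1 ht hs'.2.le
    simp only [hyt] at h
    nlinarith [pow_pos hs 2]
  obtain ⟨s, hs, hs'⟩ := (hev.and (Ioo_mem_nhdsGT ht)).exists
  by_contra hlt
  push Not at hlt
  have hiv := intermediate_value_Icc' hs'.2.le
    (f := y) (fun r hr => (S.continuousAt (hs'.1.le.trans hr.1)).continuousWithinAt)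
  obtain ⟨r, hr, hr0⟩ := hiv ⟨hlt, hs.le⟩
  exact hne r (lt_of_lt_of_le hs'.1 hr.1) hr0

theorem mul_div_le (S : SecondOrder q y y') (h0 : y 0 = 0) (h1 : 0 < y' 0) {β : ℝ} (hβ : 0 ≤ β)
    (hq : ∀ t, 0 < t → q t * t ^ 2 ≤ β * (1 - β)) {t : ℝ} (ht : 0 < t) :
    β * y t / t ≤ y' t := by
  have h := S.mul_div_le_mul h0 hq ht
  have hp := S.pos h0 h1 hβ hq ht
  have e : β * y t ^ 2 / t = y t * (β * y t / t) := by ring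
  rw [e] at h
  exact le_of_mul_le_mul_left h hp

theorem monotoneOn_mul_rpow (S : SecondOrder q y y') (h0 : y 0 = 0) (h1 : 0 < y' 0) {β : ℝ}
    (hβ : 0 ≤ β) (hq : ∀ t, 0 < t → q t * t ^ 2 ≤ β * (1 - β)) :
    MonotoneOn (fun t => y t * t ^ (-β)) (Ioi 0) := by
  refine monotoneOn_Ioi_of_hasDerivAt
    (fun t ht => (S.deriv t ht.le).mul (Real.hasDerivAt_rpow_const (Or.inl ht.ne')))
    fun t ht => ?_
  have h := S.mul_div_le h0 h1 hβ hq ht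
  have h2 : 0 ≤ t ^ (-β) * (y' t - β * y t / t) :=
    mul_nonneg (Real.rpow_nonneg ht.le _) (sub_nonneg.2 h)
  refine h2.trans_eq ?_
  rw [Real.rpow_sub_one ht.ne']
  ring

/-- Uniqueness for the initial value problem at the (possibly singular) origin. -/
theorem eq_zero (S : SecondOrder q y y') (h0 : y 0 = 0) (h1 : y' 0 = 0) {A : ℝ}
    (hq : ∀ t, 0 < t → |q t| ≤ A / t) {t : ℝ} (ht : 0 ≤ t) : y t = 0 := by
  rcases ht.eq_or_lt with rfl | ht
  · exact h0
  -- A Grönwall argument with energy y'² + y²/t. Differentiating 1/t produces -(y/t)², which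
  -- together with the exponential weight absorbs the cross term 2y'(y/t)(1 - qt), where |1 - qt| ≤
  -- 1 + A.
  have hd : ∀ t, 0 < t → HasDerivAt
      (fun t => Real.exp (-((1 + A) ^ 2 * t)) * (y' t ^ 2 + y t ^ 2 / t))
      (Real.exp (-((1 + A) ^ 2 * t)) * (-((1 + A) ^ 2 * 1)) * (y' t ^ 2 + y t ^ 2 / t) +
        Real.exp (-((1 + A) ^ 2 * t)) * (2 * y' t * (-(q t) * y t) +
          (2 * y t * y' t * t - y t ^ 2 * 1) / t ^ 2)) t :=
    fun t ht => (((hasDerivAt_id t).const_mul ((1 + A) ^ 2)).neg.exp).mul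
      ((S.hasDerivAt_deriv_sq ht).add ((S.hasDerivAt_sq ht.le).div (hasDerivAt_id t) ht.ne'))
  have hm := antitoneOn_Ioi_of_hasDerivAt hd fun t ht => by
    have hA : 0 ≤ A := by
      have := (abs_nonneg _).trans (hq t ht)
      by_contra hA
      push Not at hA
      exact absurd (div_neg_of_neg_of_pos hA ht) (not_lt.2 this)
    have hq1 : |1 - q t * t| ≤ 1 + A := by
      have h2 := hq t ht
      rw [le_div_iff₀ ht] at h2
      calc |1 - q t * t| ≤ |(1 : ℝ)| + |q t * t| := abs_sub _ _
        _ ≤ 1 + A := by rw [abs_one, abs_mul, abs_of_pos ht]; linarith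
    have h3 : 2 * y' t * (y t / t) * (1 - q t * t) ≤ (1 + A) ^ 2 * y' t ^ 2 + (y t / t) ^ 2 := by
      have h4 := le_abs_self (y' t * (y t / t) * (1 - q t * t))
      rw [abs_mul, abs_mul] at h4
      have h5 : |y' t| * |y t / t| * |1 - q t * t| ≤ |y' t| * |y t / t| * (1 + A) := by gcongr
      have h6 := sq_nonneg ((1 + A) * |y' t| - |y t / t|)
      have h7 := sq_abs (y' t)
      have h8 := sq_abs (y t / t)
      nlinarith
    have h9 : 0 ≤ (1 + A) ^ 2 * (y t ^ 2 / t) := by positivity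
    have e : Real.exp (-((1 + A) ^ 2 * t)) * (-((1 + A) ^ 2 * 1)) * (y' t ^ 2 + y t ^ 2 / t) +
        Real.exp (-((1 + A) ^ 2 * t)) * (2 * y' t * (-(q t) * y t) +
          (2 * y t * y' t * t - y t ^ 2 * 1) / t ^ 2) = Real.exp (-((1 + A) ^ 2 * t)) *
        (2 * y' t * (y t / t) * (1 - q t * t) - (1 + A) ^ 2 * y' t ^ 2 - (y t / t) ^ 2
          - (1 + A) ^ 2 * (y t ^ 2 / t)) := by
      field_simp
      ring
    rw [e]
    refine mul_nonpos_of_nonneg_of_nonpos (Real.exp_pos _).le ?_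
    linarith
  have hl : Tendsto (fun t => Real.exp (-((1 + A) ^ 2 * t)) * (y' t ^ 2 + y t ^ 2 / t))
      (𝓝[>] 0) (𝓝 0) := by
    have hexp : Tendsto (fun t : ℝ => Real.exp (-((1 + A) ^ 2 * t))) (𝓝[>] 0)
        (𝓝 (Real.exp (-((1 + A) ^ 2 * 0)))) :=
      (Continuous.tendsto (by fun_prop) 0).mono_left nhdsWithin_le_nhds
    have h := hexp.mul ((S.tendsto_deriv_zero.pow 2).add (S.tendsto_sq_div h0))
    simpa [h1] using h
  have h := ge_of_antitoneOn_Ioi hm hl ht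
  have h2 : y' t ^ 2 + y t ^ 2 / t ≤ 0 := by
    by_contra hc
    push Not at hc
    exact absurd (mul_pos (Real.exp_pos _) hc) (not_lt.2 h)
  have h3 : y t ^ 2 / t ≤ 0 := by nlinarith [sq_nonneg (y' t)]
  have h4 : y t ^ 2 ≤ 0 := by
    by_contra hc
    push Not at hc
    exact absurd (div_pos hc ht) (not_lt.2 h3)
  exact pow_eq_zero_iff (two_ne_zero) |>.1 (le_antisymm h4 (sq_nonneg _))

/-- A nonnegative solution with `-(3/4) ≤ q t²` grows at most like `t ^ (3/2)`. -/
theorem deriv_le_of_neg (S : SecondOrder q y y') (h0 : y 0 = 0) (hy : ∀ t, 0 < t → 0 < y t)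
    (hq : ∀ t, 0 < t → -(3 / 4) ≤ q t * t ^ 2) {t : ℝ} (ht : 0 < t) :
    y' t ≤ 3 / 2 * y t / t := by
  -- The exponent 3/2 satisfies (3/2)(1 - 3/2) = -3/4, and the derivative of √t(ty' - 3y/2)
  -- collapses to -(y/√t)(qt² + 3/4) ≤ 0.
  have hd : ∀ t, 0 < t → HasDerivAt (fun t => √t * (t * y' t - 3 / 2 * y t))
      (1 / (2 * √t) * (t * y' t - 3 / 2 * y t) +
        √t * (1 * y' t + t * (-(q t) * y t) - 3 / 2 * y' t)) t :=
    fun t ht => (Real.hasDerivAt_sqrt ht.ne').mul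
      (((hasDerivAt_id t).mul (S.deriv2 t ht)).sub ((S.deriv t ht.le).const_mul _))
  have hm := antitoneOn_Ioi_of_hasDerivAt hd fun t ht => by
    have hs : 0 < √t := Real.sqrt_pos.2 ht
    have e : 1 / (2 * √t) * (t * y' t - 3 / 2 * y t) +
        √t * (1 * y' t + t * (-(q t) * y t) - 3 / 2 * y' t) =
        -(1 / √t * y t * (q t * t ^ 2 + 3 / 4)) := by
      field_simp
      rw [Real.sq_sqrt ht.le]
      ring
    rw [e, neg_nonpos]
    have := hy t ht
    have := hq t ht
    exact mul_nonneg (by positivity) (by linarith)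
  have hl : Tendsto (fun t => √t * (t * y' t - 3 / 2 * y t)) (𝓝[>] 0) (𝓝 0) := by
    have hid : Tendsto (fun t : ℝ => t) (𝓝[>] 0) (𝓝 0) := nhdsWithin_le_nhds
    have h := (hid.sqrt).mul ((hid.mul S.tendsto_deriv_zero).sub (S.tendsto_zero.const_mul (3 / 2)))
    simpa [h0] using h
  have h := ge_of_antitoneOn_Ioi hm hl ht
  rw [le_div_iff₀ ht]
  have hs : 0 < √t := Real.sqrt_pos.2 ht
  by_contra hc
  push Not at hc
  have : 0 < √t * (t * y' t - 3 / 2 * y t) := mul_pos hs (by linarith)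
  linarith

end SecondOrder

/-! ### The solution of the hypergeometric equation on the half line -/

theorem kernel_mul_sq {κ t : ℝ} (ht : 0 < t) : κ / (t * (t + 1)) * t ^ 2 = κ * (t / (t + 1)) := by
  field_simp

theorem div_add_one_le_one {t : ℝ} (ht : 0 < t) : t / (t + 1) ≤ 1 := by
  rw [div_le_one (by positivity)]; linarith

theorem solution_pos {κ : ℝ} {ψ ψ' : ℝ → ℝ} (hκ : κ ≤ 1 / 4)
    (S : SecondOrder (fun t => κ / (t * (t + 1))) ψ ψ') (h0 : ψ 0 = 0) (h1 : ψ' 0 = 1)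
    {t : ℝ} (ht : 0 < t) : 0 < ψ t := by
  -- β = 1/2 maximises β(1-β), which is where the bound κ ≤ 1/4 comes from.
  refine S.pos h0 (by rw [h1]; norm_num) (β := 1 / 2) (by norm_num) (fun t ht => ?_) ht
  rw [kernel_mul_sq ht]
  have h1 := div_add_one_le_one ht
  have h2 : 0 ≤ t / (t + 1) := by positivity
  nlinarith

/-- For κ ≥ 0 the energy ψ'² + κψ²/(t(t+1)) decreases from its limit 1 at the origin, so |ψ'| ≤ 1.
For κ < 0, ψ is increasing and ψ/t^(3/2) is nonincreasing, so ψ' ≤ (3/2)ψ/t is O(√t); a compactness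
bound covers [0,1]. -/
theorem exists_deriv_bound {κ : ℝ} {ψ ψ' : ℝ → ℝ} (hκ : -(3 / 4) ≤ κ)
    (S : SecondOrder (fun t => κ / (t * (t + 1))) ψ ψ') (h0 : ψ 0 = 0) (h1 : ψ' 0 = 1) :
    ∃ C, 0 ≤ C ∧ ∀ t, 0 ≤ t → |ψ' t| ≤ C * √(1 + t) := by
  rcases le_total 0 κ with h | h
  · refine ⟨1, zero_le_one, fun t ht => ?_⟩
    have hs1 : 1 ≤ √(1 + t) := Real.one_le_sqrt.2 (by linarith)
    rw [one_mul]
    refine le_trans ?_ hs1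
    rcases ht.eq_or_lt with rfl | ht
    · simp [h1]
    have hd : ∀ t, 0 < t → HasDerivAt (fun t => ψ' t ^ 2 + κ * (ψ t ^ 2 / (t * (t + 1))))
        (2 * ψ' t * (-(κ / (t * (t + 1))) * ψ t) + κ * ((2 * ψ t * ψ' t * (t * (t + 1)) -
          ψ t ^ 2 * (1 * (t + 1) + t * 1)) / (t * (t + 1)) ^ 2)) t := fun t ht =>
      (S.hasDerivAt_deriv_sq ht).add (((S.hasDerivAt_sq ht.le).div
        ((hasDerivAt_id t).mul ((hasDerivAt_id t).add_const 1))
        (by simp only [id, Pi.mul_apply]; positivity)).const_mul κ)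
    have hm := antitoneOn_Ioi_of_hasDerivAt hd fun t ht => by
      have e : 2 * ψ' t * (-(κ / (t * (t + 1))) * ψ t) + κ * ((2 * ψ t * ψ' t * (t * (t + 1)) -
          ψ t ^ 2 * (1 * (t + 1) + t * 1)) / (t * (t + 1)) ^ 2) =
          -(κ * ψ t ^ 2 * (2 * t + 1) / (t * (t + 1)) ^ 2) := by
        field_simp
        ring
      rw [e, neg_nonpos]
      positivity
    have hl : Tendsto (fun t => ψ' t ^ 2 + κ * (ψ t ^ 2 / (t * (t + 1)))) (𝓝[>] 0) (𝓝 1) := by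
      have hid : Tendsto (fun t : ℝ => (t + 1)⁻¹) (𝓝[>] 0) (𝓝 (0 + 1)⁻¹) :=
        (ContinuousAt.tendsto (by
          refine ContinuousAt.inv₀ (by fun_prop) (by norm_num))).mono_left nhdsWithin_le_nhds
      have h := (S.tendsto_deriv_zero.pow 2).add
        (((S.tendsto_sq_div h0).mul hid).const_mul κ)
      rw [h1] at h
      norm_num at h
      refine h.congr fun t => ?_
      by_cases ht : t = 0
      · simp [ht]
      by_cases ht : t + 1 = 0
      · simp [ht]
      field_simp
    have hE := ge_of_antitoneOn_Ioi hm hl ht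
    have : 0 ≤ κ * (ψ t ^ 2 / (t * (t + 1))) := by positivity
    rw [← abs_one, ← sq_le_sq]
    linarith
  · have hp : ∀ t, 0 < t → 0 < ψ t := fun t ht => solution_pos (by linarith) S h0 h1 ht
    have hq : ∀ t, 0 < t → -(3 / 4) ≤ κ / (t * (t + 1)) * t ^ 2 := fun t ht => by
      rw [kernel_mul_sq ht]
      have h1 := div_add_one_le_one ht
      have h2 : 0 ≤ t / (t + 1) := by positivity
      nlinarith
    have hup := fun t ht => S.deriv_le_of_neg h0 hp hq (t := t) ht
    have hlow : ∀ t, 0 < t → 0 ≤ ψ' t := fun t ht => by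
      have := S.mul_div_le h0 (by rw [h1]; norm_num) (β := 0) le_rfl (fun t ht => by
        rw [kernel_mul_sq ht]
        have h2 : 0 ≤ t / (t + 1) := by positivity
        nlinarith) ht
      simpa using this
    have hd : ∀ t, 0 < t → HasDerivAt (fun t => ψ t / (t * √t))
        ((ψ' t * (t * √t) - ψ t * (1 * √t + t * (1 / (2 * √t)))) / (t * √t) ^ 2) t := fun t ht =>
      (S.deriv t ht.le).div ((hasDerivAt_id t).mul (Real.hasDerivAt_sqrt ht.ne')) (by
        have := Real.sqrt_pos.2 ht
        change t * √t ≠ 0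
        positivity)
    have hm := antitoneOn_Ioi_of_hasDerivAt hd fun t ht => by
      have hs := Real.sqrt_pos.2 ht
      have h3 := hup t ht
      rw [le_div_iff₀ ht] at h3
      refine div_nonpos_of_nonpos_of_nonneg ?_ (sq_nonneg _)
      have e : ψ' t * (t * √t) - ψ t * (1 * √t + t * (1 / (2 * √t))) =
          √t * (ψ' t * t - 3 / 2 * ψ t) := by
        have e2 : t * (1 / (2 * √t)) = √t / 2 := by
          field_simp
          rw [Real.sq_sqrt ht.le]
        rw [e2]
        ring
      rw [e]
      exact mul_nonpos_of_nonneg_of_nonpos hs.le (by linarith)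
    obtain ⟨B, hB⟩ := (isCompact_Icc (a := (0 : ℝ)) (b := 1)).exists_bound_of_continuousOn
      (f := ψ') (fun t ht => (S.continuousAt_deriv ht.1).continuousWithinAt)
    have hB0 : 0 ≤ B := (norm_nonneg _).trans (hB 0 (by simp))
    refine ⟨B + 3 / 2 * ψ 1, by have := hp 1 one_pos; positivity, fun t ht => ?_⟩
    have hs1 : 1 ≤ √(1 + t) := Real.one_le_sqrt.2 (by linarith)
    have hp1 := hp 1 one_pos
    rcases le_total t 1 with ht1 | ht1
    · have := hB t ⟨ht, ht1⟩
      rw [Real.norm_eq_abs] at this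
      nlinarith
    · have ht0 : 0 < t := by linarith
      have h3 := hm (mem_Ioi.2 one_pos) ht0 ht1
      simp only [Real.sqrt_one, mul_one, div_one] at h3
      have hs := Real.sqrt_pos.2 ht0
      rw [div_le_iff₀ (by positivity)] at h3
      rw [abs_of_nonneg (hlow t ht0)]
      have h4 : √t ≤ √(1 + t) := Real.sqrt_le_sqrt (by linarith)
      calc ψ' t ≤ 3 / 2 * ψ t / t := hup t ht0
        _ ≤ 3 / 2 * (ψ 1 * (t * √t)) / t := by gcongr
        _ = 3 / 2 * ψ 1 * √t := by field_simp
        _ ≤ (B + 3 / 2 * ψ 1) * √(1 + t) := by gcongr; linarith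

/-- `ψ` is the solution of `t (t + 1) ψ'' = -κ ψ` with `ψ(0) = 0` and `ψ'(0) = 1`, and its
derivative grows at most like `√t`. -/
structure Profile (κ C : ℝ) (ψ ψ' : ℝ → ℝ) : Prop where
  sol : SecondOrder (fun t => κ / (t * (t + 1))) ψ ψ'
  zero : ψ 0 = 0
  deriv_zero : ψ' 0 = 1
  nonneg : 0 ≤ C
  deriv_bound : ∀ t, 0 ≤ t → |ψ' t| ≤ C * √(1 + t)

theorem exists_profile {κ : ℝ} (hκ : -(3 / 4) ≤ κ) : ∃ C ψ ψ', Profile κ C ψ ψ' := by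
  obtain ⟨ψ, ψ', S, h0, h1⟩ := exists_solution κ
  obtain ⟨C, hC, hb⟩ := exists_deriv_bound hκ S h0 h1
  exact ⟨C, ψ, ψ', S, h0, h1, hC, hb⟩

theorem integrableOn_sqrt_div_sq :
    IntegrableOn (fun t : ℝ => √(1 + t) / (t + 1) ^ 2) (Ioi 0) := by
  have h := integrableOn_add_rpow_Ioi_of_lt (a := -(3 / 2)) (c := 0) (m := 1) (by norm_num)
    (by norm_num)
  refine h.congr_fun (fun t ht => ?_) measurableSet_Ioi
  have ht' : (0 : ℝ) < t + 1 := by have := mem_Ioi.1 ht; linarith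
  simp only
  rw [add_comm 1 t, Real.sqrt_eq_rpow, ← Real.rpow_natCast, ← Real.rpow_sub ht']
  norm_num

/-! ### Derivatives of shifted inverse powers -/

theorem hasDerivAt_inv_pow {𝕜 : Type*} [NontriviallyNormedField 𝕜] (n : ℕ) {x : 𝕜} (c : 𝕜)
    (hx : x + c ≠ 0) :
    HasDerivAt (fun x => ((x + c) ^ n)⁻¹) (-(n : 𝕜) * ((x + c) ^ (n + 1))⁻¹) x := by
  have h := (((hasDerivAt_id x).add_const c).pow n).inv (pow_ne_zero n hx)
  refine h.congr_deriv ?_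
  cases n with
  | zero => simp
  | succ n =>
    simp only [id, Nat.add_sub_cancel, Pi.pow_apply]
    field_simp
    ring

theorem inv_pow_le_inv_pow {t : ℝ} (ht : 0 < t) {m n : ℕ} (h : m ≤ n) :
    ((t + 1) ^ n)⁻¹ ≤ ((t + 1) ^ m)⁻¹ :=
  inv_anti₀ (by positivity) (pow_le_pow_right₀ (by linarith) h)

theorem continuousOn_inv_pow (n : ℕ) : ContinuousOn (fun t : ℝ => ((t + 1) ^ n)⁻¹) (Ioi 0) := by
  refine ContinuousOn.inv₀ (by fun_prop) fun t ht => ?_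
  have := mem_Ioi.1 ht
  positivity

namespace Profile

variable {κ C : ℝ} {ψ ψ' : ℝ → ℝ}

theorem bound (P : Profile κ C ψ ψ') {t : ℝ} (ht : 0 ≤ t) : |ψ t| ≤ C * √(1 + t) * t := by
  have h := abs_sub_le_of_hasDerivAt ht (fun s hs => P.sol.continuousAt hs)
    (fun s hs => P.sol.deriv s hs.le) (B := C * √(1 + t)) fun s hs hst =>
      (P.deriv_bound s hs.le).trans (mul_le_mul_of_nonneg_left
        (Real.sqrt_le_sqrt (by linarith)) P.nonneg)
  rwa [P.zero, sub_zero] at h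

theorem continuousOn (P : Profile κ C ψ ψ') : ContinuousOn ψ (Ioi 0) :=
  fun _ ht => (P.sol.continuousAt (le_of_lt ht)).continuousWithinAt

section integrals

variable {E : Type*} [NormedAddCommGroup E] [NormedSpace ℝ E]

/-- The linear vanishing of ψ at 0 absorbs the pole 1/t, and the √t growth of ψ/t leaves an
integrable t^(-3/2) at infinity. -/
theorem norm_smul_le (P : Profile κ C ψ ψ') {f : ℝ → E} {B : ℝ}
    (hB : ∀ t, 0 < t → ‖f t‖ ≤ B / (t * (t + 1) ^ 2)) {t : ℝ} (ht : 0 < t) :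
    ‖ψ t • f t‖ ≤ C * B * (√(1 + t) / (t + 1) ^ 2) := by
  rw [norm_smul, Real.norm_eq_abs]
  calc |ψ t| * ‖f t‖ ≤ (C * √(1 + t) * t) * (B / (t * (t + 1) ^ 2)) :=
        mul_le_mul (P.bound ht.le) (hB t ht) (norm_nonneg _)
          (by have := P.nonneg; positivity)
    _ = _ := by field_simp

theorem integrableOn_smul (P : Profile κ C ψ ψ') {f : ℝ → E} (hf : ContinuousOn f (Ioi 0))
    {B : ℝ} (hB : ∀ t, 0 < t → ‖f t‖ ≤ B / (t * (t + 1) ^ 2)) :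
    IntegrableOn (fun t => ψ t • f t) (Ioi 0) := by
  refine Integrable.mono' (integrableOn_sqrt_div_sq.const_mul (C * B))
    ((P.continuousOn.smul hf).aestronglyMeasurable measurableSet_Ioi) ?_
  filter_upwards [ae_restrict_mem measurableSet_Ioi] with t ht
  exact P.norm_smul_le hB ht

theorem integrableOn_smul_of_cube (P : Profile κ C ψ ψ') {f : ℝ → E} (hf : ContinuousOn f (Ioi 0))
    {B : ℝ} (hB : ∀ t, 0 < t → ‖f t‖ ≤ B / (t + 1) ^ 3) :
    IntegrableOn (fun t => ψ t • f t) (Ioi 0) := by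
  refine P.integrableOn_smul hf (B := B) fun t ht => (hB t ht).trans ?_
  have hB0 : 0 ≤ B := by
    have := (norm_nonneg _).trans (hB t ht)
    by_contra hc
    push Not at hc
    exact absurd (div_neg_of_neg_of_pos hc (by positivity)) (not_lt.2 this)
  refine div_le_div_of_nonneg_left hB0 (by positivity) ?_
  have : (t + 1) ^ 3 = (t + 1) * (t + 1) ^ 2 := by ring
  rw [this]
  gcongr
  linarith

/-- The integrand is minus the derivative of ψ'f - ψf'. This is O(t^(-1/2)) at infinity, and at the
origin the initial data of ψ leave exactly f(0). -/
theorem integral_by_parts [CompleteSpace E] (P : Profile κ C ψ ψ') {f f' f'' : ℝ → E} {B : ℝ}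
    (hd : ∀ t, 0 ≤ t → HasDerivAt f (f' t) t) (hd' : ∀ t, 0 ≤ t → HasDerivAt f' (f'' t) t)
    (hc : ContinuousOn f'' (Ioi 0)) (hB : ∀ t, 0 < t → ‖f t‖ ≤ B / (t + 1))
    (hB' : ∀ t, 0 < t → ‖f' t‖ ≤ B / (t + 1) ^ 2) (hB'' : ∀ t, 0 < t → ‖f'' t‖ ≤ B / (t + 1) ^ 3) :
    ∫ t in Ioi (0 : ℝ), ψ t • ((κ / (t * (t + 1))) • f t + f'' t) = f 0 := by
  have hcf : ContinuousOn f (Ioi 0) := fun t ht =>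
    (hd t (le_of_lt ht)).continuousAt.continuousWithinAt
  have hi1 : IntegrableOn (fun t => ψ t • ((κ / (t * (t + 1))) • f t)) (Ioi 0) := by
    refine P.integrableOn_smul (B := |κ| * B) (ContinuousOn.smul (ContinuousOn.div (by fun_prop)
      (by fun_prop) fun t ht => ?_) hcf) fun t ht => ?_
    · have := mem_Ioi.1 ht
      positivity
    · rw [norm_smul, Real.norm_eq_abs, abs_div, abs_of_pos (by positivity : 0 < t * (t + 1))]
      calc _ ≤ |κ| / (t * (t + 1)) * (B / (t + 1)) := by gcongr; exact hB t ht
        _ = _ := by field_simp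
  have hi2 : IntegrableOn (fun t => ψ t • f'' t) (Ioi 0) := P.integrableOn_smul_of_cube hc hB''
  have hi : IntegrableOn (fun t => ψ t • ((κ / (t * (t + 1))) • f t + f'' t)) (Ioi 0) := by
    refine (hi1.add hi2).congr_fun (fun t _ => ?_) measurableSet_Ioi
    simp only [Pi.add_apply, smul_add]
  have hder : ∀ t ∈ Ioi (0 : ℝ), HasDerivAt (fun t => ψ' t • f t - ψ t • f' t)
      (-(ψ t • ((κ / (t * (t + 1))) • f t + f'' t))) t := fun t ht => by
    have ht0 : 0 ≤ t := le_of_lt ht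
    refine (((P.sol.deriv2 t ht).smul (hd t ht0)).sub
      ((P.sol.deriv t ht0).smul (hd' t ht0))).congr_deriv ?_
    simp only [smul_add, smul_smul, neg_mul, neg_smul, mul_comm (ψ t)]
    abel
  have hs : ∀ t : ℝ, 0 < t → √(1 + t) / (t + 1) = 1 / √(1 + t) := fun t ht => by
    rw [add_comm t 1, Real.sqrt_div_self', one_div]
  have hlim : Tendsto (fun t => ψ' t • f t - ψ t • f' t) atTop (𝓝 0) := by
    have h0 : Tendsto (fun t : ℝ => (C * B + C * B) * (1 / √(1 + t))) atTop
        (𝓝 ((C * B + C * B) * 0)) := by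
      refine Tendsto.const_mul _ ?_
      simp only [one_div]
      exact tendsto_inv_atTop_zero.comp
        (Real.tendsto_sqrt_atTop.comp (tendsto_atTop_add_const_left _ 1 tendsto_id))
    rw [mul_zero] at h0
    refine squeeze_zero_norm' ?_ h0
    filter_upwards [eventually_gt_atTop (0 : ℝ)] with t ht
    refine (norm_sub_le _ _).trans ?_
    rw [norm_smul, norm_smul, Real.norm_eq_abs, Real.norm_eq_abs, add_mul]
    have hC := P.nonneg
    refine add_le_add ?_ ?_
    · calc _ ≤ (C * √(1 + t)) * (B / (t + 1)) :=
            mul_le_mul (P.deriv_bound t ht.le) (hB t ht) (norm_nonneg _) (by positivity)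
        _ = C * B * (√(1 + t) / (t + 1)) := by ring
        _ = _ := by rw [hs t ht]
    · have hB0 : 0 ≤ B := by
        have := (norm_nonneg _).trans (hB t ht)
        rwa [le_div_iff₀ (by positivity), zero_mul] at this
      calc _ ≤ (C * √(1 + t) * t) * (B / (t + 1) ^ 2) :=
            mul_le_mul (P.bound ht.le) (hB' t ht) (norm_nonneg _) (by positivity)
        _ = C * B * (√(1 + t) / (t + 1)) * (t / (t + 1)) := by field_simp
        _ ≤ C * B * (√(1 + t) / (t + 1)) * 1 :=
            mul_le_mul_of_nonneg_left (div_add_one_le_one ht) (by positivity)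
        _ = _ := by rw [hs t ht, mul_one]
  have hcont : ContinuousWithinAt (fun t => ψ' t • f t - ψ t • f' t) (Ici 0) 0 :=
    ((P.sol.cont.smul (hd 0 le_rfl).continuousAt).sub
      ((P.sol.continuousAt le_rfl).smul (hd' 0 le_rfl).continuousAt)).continuousWithinAt
  have h := integral_Ioi_of_hasDerivAt_of_tendsto hcont hder hi.neg hlim
  simp only [P.zero, P.deriv_zero, one_smul, zero_smul, sub_zero, zero_sub] at h
  rw [integral_neg] at h
  exact neg_injective h

end integrals

end Profile

/-! ### The moments of the solution -/

/-- `∫₀^∞ ψ(t) (t + 1)^{-(k + 3)} dt`. -/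
noncomputable def moment (ψ : ℝ → ℝ) (k : ℕ) : ℝ := ∫ t in Ioi (0 : ℝ), ψ t • ((t + 1) ^ (k + 3))⁻¹

namespace Profile

variable {κ C : ℝ} {ψ ψ' : ℝ → ℝ}

theorem integrableOn_moment (P : Profile κ C ψ ψ') (k : ℕ) :
    IntegrableOn (fun t => ψ t • ((t + 1) ^ (k + 3))⁻¹) (Ioi 0) := by
  refine P.integrableOn_smul_of_cube (B := 1) (continuousOn_inv_pow _) fun t ht => ?_
  rw [Real.norm_of_nonneg (by positivity), one_div]
  exact inv_pow_le_inv_pow ht (by omega)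

theorem integrableOn_div_moment (P : Profile κ C ψ ψ') (k : ℕ) :
    IntegrableOn (fun t => ψ t • (t * (t + 1) ^ (k + 2))⁻¹) (Ioi 0) := by
  refine P.integrableOn_smul (B := 1) (ContinuousOn.inv₀ (by fun_prop) fun t ht => ?_)
    fun t ht => ?_
  · have := mem_Ioi.1 ht
    positivity
  · rw [Real.norm_of_nonneg (by positivity), mul_inv, one_div, mul_inv]
    exact mul_le_mul_of_nonneg_left (inv_pow_le_inv_pow ht (by omega)) (by positivity)

/-- Green's identity for the test function (t+1)^(-k-1). -/
theorem moment_eq (P : Profile κ C ψ ψ') (k : ℕ) :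
    ((k : ℝ) + 1) * (k + 2) * moment ψ k =
      1 - κ * ∫ t in Ioi (0 : ℝ), ψ t • (t * (t + 1) ^ (k + 2))⁻¹ := by
  have hne : ∀ t : ℝ, 0 ≤ t → t + 1 ≠ 0 := fun t ht => by positivity
  have hk : (0 : ℝ) ≤ k := k.cast_nonneg
  have hB : (1 : ℝ) ≤ ((k : ℝ) + 1) * (k + 2) := by nlinarith
  have hB' : (k : ℝ) + 1 ≤ ((k : ℝ) + 1) * (k + 2) := by nlinarith
  have h := P.integral_by_parts (f := fun t => ((t + 1) ^ (k + 1))⁻¹)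
    (f' := fun t => -((k + 1 : ℕ) : ℝ) * ((t + 1) ^ (k + 2))⁻¹)
    (f'' := fun t => -((k + 1 : ℕ) : ℝ) * (-((k + 2 : ℕ) : ℝ) * ((t + 1) ^ (k + 3))⁻¹))
    (B := ((k : ℝ) + 1) * (k + 2))
    (fun t ht => hasDerivAt_inv_pow (k + 1) 1 (hne t ht))
    (fun t ht => (hasDerivAt_inv_pow (k + 2) 1 (hne t ht)).const_mul _)
    (((continuousOn_inv_pow _).const_mul _).const_mul _)
    (fun t ht => by
      rw [Real.norm_of_nonneg (by positivity), div_eq_mul_inv]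
      calc ((t + 1) ^ (k + 1))⁻¹ ≤ ((t + 1) ^ 1)⁻¹ := inv_pow_le_inv_pow ht (by omega)
        _ = 1 * (t + 1)⁻¹ := by rw [pow_one, one_mul]
        _ ≤ _ := by gcongr)
    (fun t ht => by
      rw [norm_mul, norm_neg, Real.norm_of_nonneg (by positivity),
        Real.norm_of_nonneg (by positivity), div_eq_mul_inv]
      push_cast
      exact mul_le_mul hB' (inv_pow_le_inv_pow ht (by omega)) (by positivity) (by positivity))
    (fun t ht => by
      rw [norm_mul, norm_mul, norm_neg, norm_neg, Real.norm_of_nonneg (by positivity),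
        Real.norm_of_nonneg (by positivity), Real.norm_of_nonneg (by positivity), div_eq_mul_inv,
        ← mul_assoc]
      push_cast
      exact mul_le_mul_of_nonneg_left (inv_pow_le_inv_pow ht (by omega)) (by positivity))
  rw [moment, ← integral_const_mul, eq_sub_iff_add_eq, ← integral_const_mul, ← integral_add
    ((P.integrableOn_moment k).const_mul _) ((P.integrableOn_div_moment k).const_mul _)]
  rw [zero_add, one_pow, inv_one] at h
  refine Eq.trans ?_ h
  refine setIntegral_congr_fun measurableSet_Ioi fun t ht => ?_
  have ht0 : 0 < t := ht
  simp only [smul_eq_mul]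
  push_cast
  field_simp
  ring

theorem moment_succ (P : Profile κ C ψ ψ') (k : ℕ) :
    ((k : ℝ) + 2) * (k + 3) * moment ψ (k + 1) = (κ + (k + 1) * (k + 2)) * moment ψ k := by
  have h1 := P.moment_eq k
  have h2 := P.moment_eq (k + 1)
  -- Partial fractions: the singular integrals for k and k+1 differ by the moment itself, so
  -- subtracting the two instances of `moment_eq` eliminates them.
  have h3 : (∫ t in Ioi (0 : ℝ), ψ t • (t * (t + 1) ^ (k + 2))⁻¹) -
      (∫ t in Ioi (0 : ℝ), ψ t • (t * (t + 1) ^ (k + 1 + 2))⁻¹) = moment ψ k := by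
    rw [moment, ← integral_sub (P.integrableOn_div_moment k) (P.integrableOn_div_moment (k + 1))]
    refine setIntegral_congr_fun measurableSet_Ioi fun t ht => ?_
    have ht0 : 0 < t := ht
    simp only [smul_eq_mul]
    field_simp
    ring
  push_cast at h2
  linear_combination h2 - h1 + κ * h3

/-- The singular integral in `moment_eq` tends to zero by dominated convergence; this fixes the
normalisation that the homogeneous recursion cannot see. -/
theorem tendsto_moment (P : Profile κ C ψ ψ') :
    Tendsto (fun k : ℕ => ((k : ℝ) + 1) * (k + 2) * moment ψ k) atTop (𝓝 1) := by
  simp only [P.moment_eq]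
  have h : Tendsto (fun k : ℕ => ∫ t in Ioi (0 : ℝ), ψ t • (t * (t + 1) ^ (k + 2))⁻¹) atTop
      (𝓝 (∫ t in Ioi (0 : ℝ), (0 : ℝ))) := by
    refine tendsto_integral_of_dominated_convergence
      (fun t => C * 1 * (√(1 + t) / (t + 1) ^ 2))
      (fun k => (P.integrableOn_div_moment k).aestronglyMeasurable)
      (integrableOn_sqrt_div_sq.const_mul _) (fun k => ?_) ?_
    · filter_upwards [ae_restrict_mem measurableSet_Ioi] with t ht
      refine P.norm_smul_le (f := fun t => (t * (t + 1) ^ (k + 2))⁻¹) (fun t ht => ?_) ht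
      rw [Real.norm_of_nonneg (by positivity), mul_inv, one_div, mul_inv]
      exact mul_le_mul_of_nonneg_left (inv_pow_le_inv_pow ht (by omega)) (by positivity)
    · filter_upwards [ae_restrict_mem measurableSet_Ioi] with t ht
      have ht0 : 0 < t := ht
      have h1 : Tendsto (fun k : ℕ => ψ t * (t * (t + 1) ^ 2)⁻¹ * ((t + 1)⁻¹) ^ k) atTop
          (𝓝 (ψ t * (t * (t + 1) ^ 2)⁻¹ * 0)) :=
        (tendsto_pow_atTop_nhds_zero_of_lt_one (by positivity)
          (inv_lt_one_of_one_lt₀ (by linarith))).const_mul _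
      rw [mul_zero] at h1
      refine h1.congr fun k => ?_
      simp only [smul_eq_mul]
      field_simp
      rw [pow_add, mul_comm, div_pow, one_pow]
      field_simp
  simpa using (h.const_mul κ).const_sub 1

/-- Euler's sine product evaluates the lowest moment. -/
theorem two_mul_moment_zero (P : Profile κ C ψ ψ') {a : ℂ} (ha : (κ : ℂ) = a * (1 - a)) :
    2 * (moment ψ 0 : ℂ) * Complex.sin (Real.pi * a) = Real.pi * κ := by
  -- As κ + (n+1)(n+2) = (n+1+a)(n+2-a), the recursion telescopes into the factors 1 - a²/j². The
  -- unpaired factor n+1+a stays on the left, where it is needed for the limit and no division is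
  -- required.
  have hid : ∀ n : ℕ, (κ : ℂ) * moment ψ n * (n + 1 + a) * (n + 2) =
      2 * moment ψ 0 * (a * ∏ j ∈ Finset.range (n + 1), (1 - a ^ 2 / ((j : ℂ) + 1) ^ 2)) := by
    intro n
    induction n with
    | zero => simp [ha]; ring
    | succ n ih =>
      have h1 := congrArg (fun x : ℝ => (x : ℂ)) (P.moment_succ n)
      push_cast at h1
      rw [Finset.prod_range_succ]
      have h2 : (n : ℂ) + 2 ≠ 0 := by exact_mod_cast (by positivity : (n : ℝ) + 2 ≠ 0)
      push_cast
      have h3 : (1 - a ^ 2 / ((n : ℂ) + 1 + 1) ^ 2) * ((n : ℂ) + 2) ^ 2 =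
          (n + 2 - a) * (n + 2 + a) := by
        have : (n : ℂ) + 1 + 1 = n + 2 := by ring
        rw [this]
        field_simp
        ring
      have h4 : ((n : ℂ) + 2) ^ 2 ≠ 0 := pow_ne_zero 2 h2
      refine mul_right_cancel₀ h4 ?_
      have h5 : (κ : ℂ) + (n + 1) * (n + 2) = (n + 1 + a) * (n + 2 - a) := by rw [ha]; ring
      rw [h5] at h1
      calc _ = (κ : ℂ) * (((n : ℂ) + 2) * (n + 3) * moment ψ (n + 1)) * (n + 2 + a) * (n + 2) := by
            ring
        _ = ((κ : ℂ) * moment ψ n * (n + 1 + a) * (n + 2)) * ((n + 2 - a) * (n + 2 + a)) := by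
            rw [h1]; ring
        _ = _ := by rw [ih, ← h3]; ring
  have hl1 : Tendsto (fun n : ℕ => (κ : ℂ) * moment ψ n * (n + 1 + a) * (n + 2)) atTop
      (𝓝 κ) := by
    have h1 : Tendsto (fun n : ℕ => ((((n : ℝ) + 1) * (n + 2) * moment ψ n : ℝ) : ℂ)) atTop
        (𝓝 ((1 : ℝ) : ℂ)) := (Complex.continuous_ofReal.tendsto _).comp P.tendsto_moment
    have h2 : Tendsto (fun n : ℕ => 1 + a * (((1 / ((n : ℝ) + 1) : ℝ)) : ℂ)) atTop
        (𝓝 (1 + a * ((0 : ℝ) : ℂ))) :=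
      (((Complex.continuous_ofReal.tendsto _).comp
        tendsto_one_div_add_atTop_nhds_zero_nat).const_mul a).const_add 1
    have h3 := (h1.mul h2).const_mul (κ : ℂ)
    simp only [Complex.ofReal_one, Complex.ofReal_zero, mul_zero, add_zero, mul_one] at h3
    refine h3.congr fun n => ?_
    have h2 : (n : ℂ) + 1 ≠ 0 := by exact_mod_cast (by positivity : (n : ℝ) + 1 ≠ 0)
    push_cast
    field_simp
  have hl2 := ((Complex.tendsto_euler_sin_prod a).comp (tendsto_add_atTop_nat 1)).const_mul
    (2 * (moment ψ 0 : ℂ))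
  have hl3 := hl1.const_mul (Real.pi : ℂ)
  refine tendsto_nhds_unique hl2 (hl3.congr fun n => ?_)
  rw [hid]
  simp only [Function.comp]
  ring

end Profile

/-! ### The exponent -/

/-- The real number `α_λ (1 - α_λ)`. -/
noncomputable def kappa (lam : ℝ) : ℝ :=
  if lam ≤ 1 / Real.pi then
    (Real.arcsin (lam * Real.pi) / Real.pi) * (1 - Real.arcsin (lam * Real.pi) / Real.pi)
  else 1 / 4 + (Real.arcosh (lam * Real.pi) / Real.pi) ^ 2

theorem kappa_eq (lam : ℝ) : (kappa lam : ℂ) = alpha lam * (1 - alpha lam) := by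
  unfold kappa alpha
  split_ifs
  · push_cast; ring
  · push_cast
    linear_combination ((((Real.arcosh (lam * Real.pi) : ℝ) : ℂ) / Real.pi) ^ 2) * Complex.I_sq

theorem arcsin_div_pi_bounds (x : ℝ) :
    -(1 / 2) ≤ Real.arcsin x / Real.pi ∧ Real.arcsin x / Real.pi ≤ 1 / 2 := by
  have hpi := Real.pi_pos
  constructor
  · rw [le_div_iff₀ hpi]
    linarith [Real.neg_pi_div_two_le_arcsin x]
  · rw [div_le_iff₀ hpi]
    linarith [Real.arcsin_le_pi_div_two x]

/-- The worst case α = -1/2 gives exactly the threshold of the growth bound for ψ. -/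
theorem neg_three_quarters_le_kappa (lam : ℝ) : -(3 / 4) ≤ kappa lam := by
  unfold kappa
  split_ifs
  · obtain ⟨h1, h2⟩ := arcsin_div_pi_bounds (lam * Real.pi)
    nlinarith
  · have := sq_nonneg (Real.arcosh (lam * Real.pi) / Real.pi)
    linarith

theorem kappa_pos {lam : ℝ} (h : 0 < lam) : 0 < kappa lam := by
  unfold kappa
  split_ifs
  · obtain ⟨h1, h2⟩ := arcsin_div_pi_bounds (lam * Real.pi)
    have h3 : 0 < Real.arcsin (lam * Real.pi) := Real.arcsin_pos.2 (mul_pos h Real.pi_pos)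
    have h4 : 0 < Real.arcsin (lam * Real.pi) / Real.pi := div_pos h3 Real.pi_pos
    exact mul_pos h4 (by linarith)
  · positivity

theorem kappa_neg {lam : ℝ} (h : lam < 0) : kappa lam < 0 := by
  unfold kappa
  rw [if_pos (h.le.trans (by have := Real.pi_pos; positivity))]
  obtain ⟨h1, h2⟩ := arcsin_div_pi_bounds (lam * Real.pi)
  have h3 : Real.arcsin (lam * Real.pi) < 0 :=
    Real.arcsin_lt_zero.2 (mul_neg_of_neg_of_pos h Real.pi_pos)
  have h4 : Real.arcsin (lam * Real.pi) / Real.pi < 0 := div_neg_of_neg_of_pos h3 Real.pi_pos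
  exact mul_neg_of_neg_of_pos h4 (by linarith)

theorem sin_pi_mul_alpha {lam : ℝ} (h : -(1 / Real.pi) ≤ lam) :
    Complex.sin (Real.pi * alpha lam) = lam * Real.pi := by
  have hpi := Real.pi_pos
  have hpi' : (Real.pi : ℂ) ≠ 0 := Complex.ofReal_ne_zero.2 hpi.ne'
  unfold alpha
  split_ifs with h1
  · have e : (Real.pi : ℂ) * ((Real.arcsin (lam * Real.pi) / Real.pi : ℝ) : ℂ) =
        ((Real.arcsin (lam * Real.pi) : ℝ) : ℂ) := by
      push_cast
      field_simp
    have h2 : lam * Real.pi ≤ 1 := by rwa [le_div_iff₀ hpi] at h1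
    have h3 : -1 ≤ lam * Real.pi := by
      rw [← neg_div, div_le_iff₀ hpi] at h
      exact h
    rw [e, ← Complex.ofReal_sin, Real.sin_arcsin h3 h2]
    push_cast
    ring
  · have e : (Real.pi : ℂ) * (1 / 2 + Complex.I * ((Real.arcosh (lam * Real.pi) / Real.pi : ℝ) : ℂ))
        = ((Real.arcosh (lam * Real.pi) : ℝ) : ℂ) * Complex.I + Real.pi / 2 := by
      push_cast
      field_simp
      ring
    have h2 : 1 ≤ lam * Real.pi := by
      push Not at h1
      rw [div_lt_iff₀ hpi] at h1
      exact h1.le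
    rw [e, Complex.sin_add_pi_div_two, Complex.cos_mul_I, ← Complex.ofReal_cosh,
      Real.cosh_arcosh h2]
    push_cast
    ring

/-- Up to here only κ mattered; this is the link with λ through sin(πα) = λπ, and the normalisation
on which the Fredholm equation, the hypergeometric coefficients and the natural mass all rest. -/
theorem Profile.moment_zero {lam C : ℝ} {ψ ψ' : ℝ → ℝ} (h : -(1 / Real.pi) ≤ lam)
    (P : Profile (kappa lam) C ψ ψ') : 2 * lam * moment ψ 0 = kappa lam := by
  have h1 := P.two_mul_moment_zero (kappa_eq lam)
  rw [sin_pi_mul_alpha h] at h1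
  have h2 : Real.pi * (2 * lam * moment ψ 0) = Real.pi * kappa lam := by
    apply Complex.ofReal_injective
    push_cast
    linear_combination h1
  exact mul_left_cancel₀ Real.pi_ne_zero h2

/-! ### Cauchy type integrals over the half line -/

/-- The plane cut along `(-∞, -1]`. -/
def region : Set ℂ := {z : ℂ | 1 + z ∈ Complex.slitPlane}

theorem isOpen_region : IsOpen region :=
  Complex.isOpen_slitPlane.preimage (continuous_const.add continuous_id)

theorem ofReal_mem_region {x : ℝ} (hx : -1 < x) : (x : ℂ) ∈ region := by
  refine Or.inl ?_
  simp
  linarith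

theorem one_add_mul_ne_zero {z : ℂ} (hz : z ∈ region) {r : ℝ} (h0 : 0 ≤ r) (h1 : r ≤ 1) :
    1 + (r : ℂ) * z ≠ 0 := by
  intro h
  have hr : r ≠ 0 := by
    rintro rfl
    simp at h
  have hr' : 0 < r := lt_of_le_of_ne h0 (Ne.symm hr)
  have hz' : z = ((-(1 / r) : ℝ) : ℂ) := by
    have : (r : ℂ) ≠ 0 := Complex.ofReal_ne_zero.2 hr
    push_cast
    field_simp
    linear_combination h
  have h2 : 1 ≤ 1 / r := by rw [le_div_iff₀ hr']; linarith
  rw [hz'] at hz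
  rcases hz with hz | hz
  · simp only [Complex.add_re, Complex.one_re, Complex.ofReal_re] at hz
    linarith
  · apply hz
    simp only [Complex.add_im, Complex.one_im, Complex.ofReal_im, add_zero]

/-- Write z + t + 1 = (t+1)(1 + rz) with r = 1/(t+1). Adding r = 0, the point t = ∞, makes the
parameter range compact, so |1 + rz| has a positive minimum, uniform near z₀. -/
theorem exists_kernel_bound {z₀ : ℂ} (hz₀ : z₀ ∈ region) : ∃ c : ℝ, 0 < c ∧
    ∀ᶠ z : ℂ in 𝓝 z₀, ∀ t : ℝ, 0 ≤ t → c * (t + 1) ≤ ‖z + (t + 1)‖ := by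
  obtain ⟨δ, hδ, hball⟩ := Metric.nhds_basis_closedBall.mem_iff.1 (isOpen_region.mem_nhds hz₀)
  obtain ⟨p, hp, hmin⟩ := ((isCompact_Icc (a := (0 : ℝ)) (b := 1)).prod
    (isCompact_closedBall z₀ δ)).exists_isMinOn
    (f := fun p : ℝ × ℂ => ‖1 + (p.1 : ℂ) * p.2‖)
    ⟨(0, z₀), by simp [hδ.le]⟩ (by fun_prop)
  refine ⟨‖1 + (p.1 : ℂ) * p.2‖, norm_pos_iff.2
    (one_add_mul_ne_zero (hball hp.2) hp.1.1 hp.1.2), ?_⟩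
  filter_upwards [Metric.closedBall_mem_nhds z₀ hδ] with z hz t ht
  have ht1 : (0 : ℝ) < t + 1 := by positivity
  have h := hmin (show ((1 / (t + 1), z) : ℝ × ℂ) ∈ Icc (0 : ℝ) 1 ×ˢ Metric.closedBall z₀ δ from
    ⟨⟨by positivity, by rw [div_le_one ht1]; linarith⟩, hz⟩)
  simp only [mem_ofPred_eq] at h
  have e : z + (t + 1) = (1 + ((1 / (t + 1) : ℝ) : ℂ) * z) * ((t + 1 : ℝ) : ℂ) := by
    have : (t : ℂ) + 1 ≠ 0 := by exact_mod_cast ht1.ne'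
    push_cast
    field_simp
    ring
  rw [e, norm_mul, Complex.norm_of_nonneg ht1.le]
  exact mul_le_mul_of_nonneg_right h ht1.le

theorem kernel_ne_zero {c : ℝ} (hc : 0 < c) {z : ℂ} {t : ℝ} (ht : 0 ≤ t)
    (h : c * (t + 1) ≤ ‖z + (t + 1)‖) : z + ((t : ℂ) + 1) ≠ 0 :=
  norm_pos_iff.1 (lt_of_lt_of_le (by positivity) h)

theorem norm_inv_kernel_pow_le {c : ℝ} (hc : 0 < c) {z : ℂ} {t : ℝ} (ht : 0 ≤ t)
    (h : c * (t + 1) ≤ ‖z + (t + 1)‖) (n : ℕ) :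
    ‖((z + (t + 1)) ^ n)⁻¹‖ ≤ (c ^ n)⁻¹ * ((t + 1) ^ n)⁻¹ := by
  rw [norm_inv, norm_pow, ← mul_inv, ← mul_pow]
  gcongr

theorem continuousOn_kernel {c : ℝ} (hc : 0 < c) {z : ℂ}
    (h : ∀ t : ℝ, 0 ≤ t → c * (t + 1) ≤ ‖z + (t + 1)‖) (n : ℕ) :
    ContinuousOn (fun t : ℝ => ((z + ((t : ℂ) + 1)) ^ n)⁻¹) (Ioi 0) :=
  ContinuousOn.inv₀ (by fun_prop) fun t ht =>
    pow_ne_zero _ (kernel_ne_zero hc (le_of_lt ht) (h t (le_of_lt ht)))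

theorem ofReal_add_one_ne_zero {t : ℝ} (ht : 0 ≤ t) : (t : ℂ) + 1 ≠ 0 := by
  exact_mod_cast (by positivity : t + 1 ≠ 0)

theorem norm_inv_ofReal_add_one_pow {t : ℝ} (ht : 0 ≤ t) (n : ℕ) :
    ‖(((t : ℂ) + 1) ^ n)⁻¹‖ = ((t + 1) ^ n)⁻¹ := by
  rw [norm_inv, norm_pow]
  congr 2
  rw [← Complex.ofReal_one, ← Complex.ofReal_add, Complex.norm_of_nonneg (by positivity)]

theorem continuousOn_inv_ofReal_add_one_pow (n : ℕ) :
    ContinuousOn (fun t : ℝ => (((t : ℂ) + 1) ^ n)⁻¹) (Ioi 0) :=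
  ContinuousOn.inv₀ (by fun_prop) fun _ ht => pow_ne_zero _ (ofReal_add_one_ne_zero (le_of_lt ht))

/-- `∫₀^∞ ψ(t) (t + 1)^{-2} (t + 1 + z)^{-n} dt`. -/
noncomputable def cauchy (ψ : ℝ → ℝ) (n : ℕ) (z : ℂ) : ℂ :=
  ∫ t in Ioi (0 : ℝ), ψ t • ((((t : ℂ) + 1) ^ 2)⁻¹ * ((z + (t + 1)) ^ n)⁻¹)

section

variable {κ C : ℝ} {ψ ψ' : ℝ → ℝ}

theorem Profile.integrableOn_kernel (P : Profile κ C ψ ψ') {z : ℂ} (hz : z ∈ region) {m n : ℕ}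
    (hmn : 3 ≤ m + n) :
    IntegrableOn (fun t : ℝ => ψ t • ((((t : ℂ) + 1) ^ m)⁻¹ * ((z + (t + 1)) ^ n)⁻¹)) (Ioi 0) := by
  obtain ⟨c, hc, hev⟩ := exists_kernel_bound hz
  have h := hev.self_of_nhds
  refine P.integrableOn_smul_of_cube (B := (c ^ n)⁻¹)
    ((continuousOn_inv_ofReal_add_one_pow m).mul (continuousOn_kernel hc h n)) fun t ht => ?_
  rw [norm_mul, norm_inv_ofReal_add_one_pow ht.le]
  calc _ ≤ ((t + 1) ^ m)⁻¹ * ((c ^ n)⁻¹ * ((t + 1) ^ n)⁻¹) := by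
        gcongr; exact norm_inv_kernel_pow_le hc ht.le (h t ht.le) n
    _ = (c ^ n)⁻¹ * ((t + 1) ^ (m + n))⁻¹ := by rw [pow_add, mul_inv]; ring
    _ ≤ (c ^ n)⁻¹ * ((t + 1) ^ 3)⁻¹ := by
        gcongr ?_ * ?_
        exact inv_pow_le_inv_pow ht hmn
    _ = _ := by rw [div_eq_mul_inv]

theorem Profile.hasDerivAt_cauchy (P : Profile κ C ψ ψ') {z₀ : ℂ} (hz₀ : z₀ ∈ region) {n : ℕ}
    (hn : 1 ≤ n) : HasDerivAt (cauchy ψ n) (-(n : ℂ) * cauchy ψ (n + 1) z₀) z₀ := by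
  obtain ⟨c, hc, hev⟩ := exists_kernel_bound hz₀
  have hbi : IntegrableOn (fun t : ℝ => ‖ψ t • ((n : ℝ) * (c ^ (n + 1))⁻¹ * ((t + 1) ^ 3)⁻¹)‖)
      (Ioi 0) := by
    refine (P.integrableOn_smul_of_cube (B := (n : ℝ) * (c ^ (n + 1))⁻¹)
      ((continuousOn_inv_pow 3).const_mul _) fun t ht => ?_).norm
    rw [Real.norm_of_nonneg (by positivity), div_eq_mul_inv]
  have hF : ∀ z ∈ region, AEStronglyMeasurable
      (fun t : ℝ => ψ t • ((((t : ℂ) + 1) ^ 2)⁻¹ * ((z + (t + 1)) ^ n)⁻¹))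
      (volume.restrict (Ioi 0)) := fun z hz =>
    (P.integrableOn_kernel hz (by omega)).aestronglyMeasurable
  have hint := P.integrableOn_kernel hz₀ (m := 2) (n := n + 1) (by omega)
  have key := hasDerivAt_integral_of_dominated_loc_of_deriv_le (μ := volume.restrict (Ioi (0 : ℝ)))
    (F := fun (z : ℂ) (t : ℝ) => ψ t • ((((t : ℂ) + 1) ^ 2)⁻¹ * ((z + (t + 1)) ^ n)⁻¹))
    (F' := fun (z : ℂ) (t : ℝ) => ψ t •
      ((((t : ℂ) + 1) ^ 2)⁻¹ * (-(n : ℂ) * ((z + (t + 1)) ^ (n + 1))⁻¹)))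
    (x₀ := z₀) hev
    (by filter_upwards [isOpen_region.mem_nhds hz₀] with z hz using hF z hz)
    (P.integrableOn_kernel hz₀ (by omega))
    (by
      refine (hint.const_mul (-(n : ℂ))).aestronglyMeasurable.congr
        (Eventually.of_forall fun t => ?_)
      simp only [Complex.real_smul]
      ring)
    (by
      filter_upwards [ae_restrict_mem measurableSet_Ioi] with t ht z hz
      have ht0 : (0 : ℝ) < t := ht
      rw [norm_smul, norm_smul]
      refine mul_le_mul_of_nonneg_left ?_ (norm_nonneg _)
      rw [norm_mul, norm_mul, norm_neg, norm_inv_ofReal_add_one_pow ht0.le, Complex.norm_natCast,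
        Real.norm_of_nonneg (by positivity)]
      calc _ ≤ ((t + 1) ^ 2)⁻¹ * (n * ((c ^ (n + 1))⁻¹ * ((t + 1) ^ (n + 1))⁻¹)) := by
            gcongr; exact norm_inv_kernel_pow_le hc ht0.le (hz t ht0.le) _
        _ ≤ ((t + 1) ^ 2)⁻¹ * (n * ((c ^ (n + 1))⁻¹ * ((t + 1) ^ 1)⁻¹)) := by
            gcongr ?_ * (?_ * (?_ * ?_))
            exact inv_pow_le_inv_pow ht0 (by omega)
        _ = _ := by field_simp)
    hbi
    (by
      filter_upwards [ae_restrict_mem measurableSet_Ioi] with t ht z hz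
      have ht0 : (0 : ℝ) ≤ t := le_of_lt ht
      exact ((hasDerivAt_inv_pow n ((t : ℂ) + 1) (kernel_ne_zero hc ht0 (hz t ht0))).const_mul
        _).const_smul (ψ t))
  refine key.2.congr_deriv ?_
  rw [cauchy, ← integral_const_mul]
  refine integral_congr_ae (Eventually.of_forall fun t => ?_)
  simp only [Complex.real_smul]
  ring

/-! ### The continuation of the solution to the cut plane -/

/-- `z - λ z² ∫₀^∞ ψ(t) dt / ((t + 1)² (t + 1 + z))`. -/
noncomputable def ext (lam : ℝ) (ψ : ℝ → ℝ) (z : ℂ) : ℂ := z - lam * z ^ 2 * cauchy ψ 1 z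

/-- The derivative of `ext`. -/
noncomputable def extDeriv (lam : ℝ) (ψ : ℝ → ℝ) (z : ℂ) : ℂ :=
  1 - lam * (2 * z * cauchy ψ 1 z - z ^ 2 * cauchy ψ 2 z)

theorem Profile.hasDerivAt_ext (P : Profile κ C ψ ψ') (lam : ℝ) {z : ℂ} (hz : z ∈ region) :
    HasDerivAt (ext lam ψ) (extDeriv lam ψ z) z := by
  have h := (hasDerivAt_id z).sub ((((hasDerivAt_id z).pow 2).const_mul (lam : ℂ)).mul
    (P.hasDerivAt_cauchy hz le_rfl))
  refine h.congr_deriv ?_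
  simp only [id, Pi.pow_apply, extDeriv]
  push_cast
  ring

/-- With w = z+t+1 one has w² - 2zw + z² = (t+1)², which cancels the weight (t+1)^(-2). The left
side is half the second derivative of z²·`cauchy ψ 1`, so `ext` has second derivative -2λ∫ψ/w³. -/
theorem Profile.cauchy_comb (P : Profile κ C ψ ψ') {z : ℂ} (hz : z ∈ region) :
    cauchy ψ 1 z - 2 * z * cauchy ψ 2 z + z ^ 2 * cauchy ψ 3 z =
      ∫ t in Ioi (0 : ℝ), ψ t • ((((t : ℂ) + 1) ^ 0)⁻¹ * ((z + (t + 1)) ^ 3)⁻¹) := by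
  have h1 := P.integrableOn_kernel hz (m := 2) (n := 1) (by omega)
  have h2 := P.integrableOn_kernel hz (m := 2) (n := 2) (by omega)
  have h3 := P.integrableOn_kernel hz (m := 2) (n := 3) (by omega)
  have h12 : IntegrableOn (fun t : ℝ => ψ t • ((((t : ℂ) + 1) ^ 2)⁻¹ * ((z + (t + 1)) ^ 1)⁻¹) -
    2 * z * ψ t • ((((t : ℂ) + 1) ^ 2)⁻¹ * ((z + (t + 1)) ^ 2)⁻¹)) (Ioi 0) :=
    h1.sub (h2.const_mul _)
  obtain ⟨c, hc, hev⟩ := exists_kernel_bound hz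
  have h := hev.self_of_nhds
  rw [cauchy, cauchy, cauchy, ← integral_const_mul, ← integral_const_mul,
    ← integral_sub h1 (h2.const_mul _), ← integral_add h12 (h3.const_mul _)]
  refine setIntegral_congr_fun measurableSet_Ioi fun t ht => ?_
  have ht0 : (0 : ℝ) ≤ t := le_of_lt ht
  have hn1 := kernel_ne_zero hc ht0 (h t ht0)
  have hn2 := ofReal_add_one_ne_zero ht0
  simp only [Complex.real_smul]
  field_simp
  ring

theorem Profile.hasDerivAt_extDeriv (P : Profile κ C ψ ψ') (lam : ℝ) {z : ℂ} (hz : z ∈ region) :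
    HasDerivAt (extDeriv lam ψ) (-(2 * lam) *
      ∫ t in Ioi (0 : ℝ), ψ t • ((((t : ℂ) + 1) ^ 0)⁻¹ * ((z + (t + 1)) ^ 3)⁻¹)) z := by
  have h := (((((hasDerivAt_id z).const_mul (2 : ℂ)).mul (P.hasDerivAt_cauchy hz le_rfl)).sub
    (((hasDerivAt_id z).pow 2).mul (P.hasDerivAt_cauchy hz one_le_two))).const_mul
    (lam : ℂ)).const_sub 1
  refine h.congr_deriv ?_
  rw [← P.cauchy_comb hz]
  simp only [id, Pi.pow_apply]
  push_cast
  ring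

/-- Green's identity for f = -z/(t+1) + z(1+z)/(t+1+z) = z²t/((t+1)(t+1+z)). It vanishes at 0, and
κf/(t(t+1)) is κz² times the Cauchy kernel; f'' supplies the moment and the cubic term. -/
theorem Profile.integral_cube (P : Profile κ C ψ ψ') {z : ℂ} (hz : z ∈ region) :
    κ * (z ^ 2 * cauchy ψ 1 z) - 2 * z * moment ψ 0 + 2 * (z * (1 + z)) *
      (∫ t in Ioi (0 : ℝ), ψ t • ((((t : ℂ) + 1) ^ 0)⁻¹ * ((z + (t + 1)) ^ 3)⁻¹)) = 0 := by
  obtain ⟨c, hc, hev⟩ := exists_kernel_bound hz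
  have h := hev.self_of_nhds
  have hd1 : ∀ (n : ℕ) (t : ℝ), 0 ≤ t → HasDerivAt (fun t : ℝ => (((t : ℂ) + 1) ^ n)⁻¹)
      (-(n : ℂ) * (((t : ℂ) + 1) ^ (n + 1))⁻¹) t := fun n t ht =>
    (hasDerivAt_inv_pow n (1 : ℂ) (ofReal_add_one_ne_zero ht)).comp_ofReal
  have hd2 : ∀ (n : ℕ) (t : ℝ), 0 ≤ t → HasDerivAt (fun t : ℝ => ((z + ((t : ℂ) + 1)) ^ n)⁻¹)
      (-(n : ℂ) * ((z + ((t : ℂ) + 1)) ^ (n + 1))⁻¹) t := fun n t ht => by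
    have e : ∀ w : ℂ, z + (w + 1) = w + (z + 1) := fun w => by ring
    have h0 := kernel_ne_zero hc ht (h t ht)
    simp only [e] at h0 ⊢
    exact (hasDerivAt_inv_pow n (z + 1) h0).comp_ofReal
  have hb : ∀ (n : ℕ) (u v : ℂ) (t : ℝ), 0 < t →
      ‖u * (((t : ℂ) + 1) ^ n)⁻¹ + v * ((z + ((t : ℂ) + 1)) ^ n)⁻¹‖ ≤
        (‖u‖ + ‖v‖ * (c ^ n)⁻¹) / (t + 1) ^ n := fun n u v t ht => by
    refine (norm_add_le _ _).trans ?_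
    rw [norm_mul, norm_mul, norm_inv_ofReal_add_one_pow ht.le, div_eq_mul_inv, add_mul]
    refine add_le_add le_rfl ?_
    rw [mul_assoc]
    exact mul_le_mul_of_nonneg_left (norm_inv_kernel_pow_le hc ht.le (h t ht.le) n) (norm_nonneg _)
  let B : ℝ := max (max (‖-z‖ + ‖z * (1 + z)‖ * (c ^ 1)⁻¹) (‖z‖ + ‖-(z * (1 + z))‖ * (c ^ 2)⁻¹))
    (‖-(2 * z)‖ + ‖2 * (z * (1 + z))‖ * (c ^ 3)⁻¹)
  have hP := P.integral_by_parts
    (f := fun t : ℝ => -z * (((t : ℂ) + 1) ^ 1)⁻¹ + z * (1 + z) * ((z + ((t : ℂ) + 1)) ^ 1)⁻¹)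
    (f' := fun t : ℝ => z * (((t : ℂ) + 1) ^ 2)⁻¹ + -(z * (1 + z)) * ((z + ((t : ℂ) + 1)) ^ 2)⁻¹)
    (f'' := fun t : ℝ =>
      -(2 * z) * (((t : ℂ) + 1) ^ 3)⁻¹ + 2 * (z * (1 + z)) * ((z + ((t : ℂ) + 1)) ^ 3)⁻¹)
    (B := B)
    (fun t ht => (((hd1 1 t ht).const_mul _).add ((hd2 1 t ht).const_mul _)).congr_deriv (by
      push_cast; ring))
    (fun t ht => (((hd1 2 t ht).const_mul _).add ((hd2 2 t ht).const_mul _)).congr_deriv (by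
      push_cast; ring))
    (((continuousOn_inv_ofReal_add_one_pow 3).const_mul _).add
      ((continuousOn_kernel hc h 3).const_mul _))
    (fun t ht => by
      refine (hb 1 _ _ t ht).trans ?_
      rw [pow_one (t + 1)]
      gcongr
      exact (le_max_left _ _).trans (le_max_left _ _))
    (fun t ht => by
      refine (hb 2 _ _ t ht).trans ?_
      gcongr
      exact (le_max_right _ _).trans (le_max_left _ _))
    (fun t ht => by
      refine (hb 3 _ _ t ht).trans ?_
      gcongr
      exact le_max_right _ _)
  have hz1 : z + 1 ≠ 0 := by simpa using kernel_ne_zero hc le_rfl (h 0 le_rfl)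
  have hf0 : -z * ((((0 : ℝ) : ℂ) + 1) ^ 1)⁻¹ +
      z * (1 + z) * ((z + (((0 : ℝ) : ℂ) + 1)) ^ 1)⁻¹ = 0 := by
    simp only [Complex.ofReal_zero, zero_add, inv_one, pow_one]
    field_simp
    ring
  have h1 := P.integrableOn_kernel hz (m := 2) (n := 1) (by omega)
  have h3 := P.integrableOn_kernel hz (m := 0) (n := 3) (by omega)
  have h2 : IntegrableOn (fun t : ℝ => ((ψ t • ((t + 1) ^ (0 + 3))⁻¹ : ℝ) : ℂ)) (Ioi 0) :=
    (P.integrableOn_moment 0).ofReal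
  have h12 : IntegrableOn (fun t : ℝ =>
    κ * z ^ 2 * ψ t • ((((t : ℂ) + 1) ^ 2)⁻¹ * ((z + (t + 1)) ^ 1)⁻¹) -
    2 * z * ((ψ t • ((t + 1) ^ (0 + 3))⁻¹ : ℝ) : ℂ)) (Ioi 0) :=
    (h1.const_mul _).sub (h2.const_mul _)
  rw [moment, ← integral_complex_ofReal, cauchy, ← mul_assoc, ← integral_const_mul,
    ← integral_const_mul, ← integral_const_mul, ← integral_sub (h1.const_mul _) (h2.const_mul _),
    ← integral_add h12 (h3.const_mul _)]
  refine Eq.trans ?_ (hP.trans hf0)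
  refine setIntegral_congr_fun measurableSet_Ioi fun t ht => ?_
  have ht0 : (0 : ℝ) < t := ht
  have htc : (t : ℂ) ≠ 0 := Complex.ofReal_ne_zero.2 ht0.ne'
  have hn1 := kernel_ne_zero hc ht0.le (h t ht0.le)
  have hn2 := ofReal_add_one_ne_zero ht0.le
  simp only [Complex.real_smul, smul_eq_mul]
  push_cast
  field_simp
  ring

/-- The differential equation on the cut plane. -/
theorem Profile.ext_ode (P : Profile κ C ψ ψ') {lam : ℝ} (hm : 2 * lam * moment ψ 0 = κ) {z : ℂ}
    (hz : z ∈ region) : z * (z + 1) * (-(2 * lam) *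
      ∫ t in Ioi (0 : ℝ), ψ t • ((((t : ℂ) + 1) ^ 0)⁻¹ * ((z + (t + 1)) ^ 3)⁻¹)) =
      -κ * ext lam ψ z := by
  have h := P.integral_cube hz
  have hm' : 2 * (lam : ℂ) * moment ψ 0 = κ := by exact_mod_cast hm
  rw [ext]
  -- The moment term 2λzM_0 becomes κz, the contribution of the leading z in `ext`.
  linear_combination (-(lam : ℂ)) * h - z * hm'

end

/-! ### Restriction to the real axis and the Fredholm equation -/

theorem HasDerivAt.re_comp {f : ℝ → ℂ} {f' : ℂ} {t : ℝ} (h : HasDerivAt f f' t) :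
    HasDerivAt (fun t => (f t).re) f'.re t :=
  Complex.reCLM.hasFDerivAt.comp_hasDerivAt t h

theorem HasDerivAt.im_comp {f : ℝ → ℂ} {f' : ℂ} {t : ℝ} (h : HasDerivAt f f' t) :
    HasDerivAt (fun t => (f t).im) f'.im t :=
  Complex.imCLM.hasFDerivAt.comp_hasDerivAt t h

theorem SecondOrder.sub {q y y' u u' : ℝ → ℝ} (S : SecondOrder q y y') (R : SecondOrder q u u') :
    SecondOrder q (fun t => y t - u t) (fun t => y' t - u' t) where
  deriv t ht := (S.deriv t ht).sub (R.deriv t ht)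
  deriv2 t ht := ((S.deriv2 t ht).sub (R.deriv2 t ht)).congr_deriv (by ring)
  cont := S.cont.sub R.cont

theorem cauchy_ofReal (ψ : ℝ → ℝ) (n : ℕ) (x : ℝ) : cauchy ψ n (x : ℂ) =
    ((∫ t in Ioi (0 : ℝ), ψ t • (((t + 1) ^ 2)⁻¹ * ((x + (t + 1)) ^ n)⁻¹) : ℝ) : ℂ) := by
  rw [cauchy, ← integral_complex_ofReal]
  refine setIntegral_congr_fun measurableSet_Ioi fun t _ => ?_
  simp only [Complex.real_smul, smul_eq_mul]
  push_cast
  rfl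

theorem ext_ofReal_im (lam : ℝ) (ψ : ℝ → ℝ) (x : ℝ) : (ext lam ψ x).im = 0 := by
  rw [ext, cauchy_ofReal]
  norm_cast

section

variable {κ C lam : ℝ} {ψ ψ' : ℝ → ℝ}

theorem Profile.ext_secondOrder (P : Profile κ C ψ ψ') (hm : 2 * lam * moment ψ 0 = κ) :
    SecondOrder (fun t => κ / (t * (t + 1))) (fun x => (ext lam ψ (x : ℂ)).re)
      (fun x => (extDeriv lam ψ (x : ℂ)).re) where
  deriv t ht := (P.hasDerivAt_ext lam (ofReal_mem_region (by linarith))).real_of_complex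
  deriv2 t ht := by
    have hz := ofReal_mem_region (x := t) (by linarith)
    refine (P.hasDerivAt_extDeriv lam hz).real_of_complex.congr_deriv ?_
    have h := P.ext_ode hm hz
    have e : (t : ℂ) * (t + 1) = ((t * (t + 1) : ℝ) : ℂ) := by push_cast; rfl
    rw [e] at h
    have h2 := congrArg Complex.re h
    rw [Complex.re_ofReal_mul, ← Complex.ofReal_neg, Complex.re_ofReal_mul] at h2
    have ht' : t * (t + 1) ≠ 0 := by positivity
    refine mul_left_cancel₀ ht' (h2.trans ?_)
    field_simp
  cont := (P.hasDerivAt_extDeriv lam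
    (ofReal_mem_region (x := 0) (by norm_num))).real_of_complex.continuousAt

/-- The Fredholm equation for `μ = 1`. -/
theorem Profile.ext_eq (P : Profile κ C ψ ψ') (hm : 2 * lam * moment ψ 0 = κ) {x : ℝ}
    (hx : 0 ≤ x) : ext lam ψ x = ψ x := by
  -- Both functions have value 0 and slope 1 at the origin, so their difference has zero initial
  -- data.
  have h := ((P.ext_secondOrder hm).sub P.sol).eq_zero (A := |κ|) (by simp [ext, P.zero])
    (by simp [extDeriv, P.deriv_zero]) (fun t ht => by
      rw [abs_div, abs_of_pos (by positivity : 0 < t * (t + 1))]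
      refine div_le_div_of_nonneg_left (abs_nonneg _) ht ?_
      nlinarith) hx
  apply Complex.ext
  · simpa using sub_eq_zero.1 h
  · rw [ext_ofReal_im, Complex.ofReal_im]

/-! ### Identification with the hypergeometric function -/

/-- Expand 1/(t+1-z) geometrically in z/(t+1). The zeroth absolute moment times |z|^n dominates
every term, which justifies the interchange. -/
theorem Profile.hasSum_cauchy (P : Profile κ C ψ ψ') {z : ℂ} (hz : ‖z‖ < 1) :
    HasSum (fun n : ℕ => z ^ n * (moment ψ n : ℂ)) (cauchy ψ 1 (-z)) := by
  have hF : ∀ n : ℕ, IntegrableOn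
      (fun t : ℝ => z ^ n * ((ψ t • ((t + 1) ^ (n + 3))⁻¹ : ℝ) : ℂ)) (Ioi 0) := fun n =>
    (P.integrableOn_moment n).ofReal.const_mul _
  have hb : ∀ n : ℕ, ∫ t in Ioi (0 : ℝ), ‖z ^ n * ((ψ t • ((t + 1) ^ (n + 3))⁻¹ : ℝ) : ℂ)‖ ≤
      (∫ t in Ioi (0 : ℝ), ‖ψ t • ((t + 1) ^ (0 + 3))⁻¹‖) * ‖z‖ ^ n := fun n => by
    rw [mul_comm, ← integral_const_mul]
    refine setIntegral_mono_on (hF n).norm ((P.integrableOn_moment 0).norm.const_mul _)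
      measurableSet_Ioi fun t ht => ?_
    have ht0 : (0 : ℝ) < t := ht
    rw [norm_mul, norm_pow, Complex.norm_real, norm_smul, norm_smul,
      Real.norm_of_nonneg (by positivity : 0 ≤ ((t + 1) ^ (n + 3))⁻¹),
      Real.norm_of_nonneg (by positivity : 0 ≤ ((t + 1) ^ (0 + 3))⁻¹)]
    gcongr ?_ * (?_ * ?_)
    exact inv_pow_le_inv_pow ht0 (by omega)
  have h := hasSum_integral_of_summable_integral_norm hF
    (Summable.of_nonneg_of_le (fun n => integral_nonneg fun t => norm_nonneg _) hb
      ((summable_geometric_of_lt_one (norm_nonneg z) hz).mul_left _))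
  have e1 : (fun n : ℕ => z ^ n * (moment ψ n : ℂ)) = fun n : ℕ =>
      ∫ t in Ioi (0 : ℝ), z ^ n * ((ψ t • ((t + 1) ^ (n + 3))⁻¹ : ℝ) : ℂ) := by
    funext n
    rw [integral_const_mul, integral_complex_ofReal]
    rfl
  have e2 : cauchy ψ 1 (-z) = ∫ t in Ioi (0 : ℝ), ∑' n : ℕ,
      z ^ n * ((ψ t • ((t + 1) ^ (n + 3))⁻¹ : ℝ) : ℂ) := by
    rw [cauchy]
    refine setIntegral_congr_fun measurableSet_Ioi fun t ht => ?_
    have ht0 : (0 : ℝ) < t := ht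
    have hn := ofReal_add_one_ne_zero ht0.le
    have hn2 : ‖z / ((t : ℂ) + 1)‖ < 1 := by
      rw [norm_div, ← Complex.ofReal_one, ← Complex.ofReal_add,
        Complex.norm_of_nonneg (by positivity), div_lt_one (by positivity)]
      linarith
    have hn3 : -z + ((t : ℂ) + 1) ≠ 0 := by
      intro h0
      have : z / ((t : ℂ) + 1) = 1 := by
        field_simp
        linear_combination -h0
      rw [this, norm_one] at hn2
      exact lt_irrefl _ hn2
    have hg := (hasSum_geometric_of_norm_lt_one hn2).mul_left ((ψ t : ℂ) * (((t : ℂ) + 1) ^ 3)⁻¹)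
    have e : ∀ n : ℕ, z ^ n * ((ψ t • ((t + 1) ^ (n + 3))⁻¹ : ℝ) : ℂ) =
        (ψ t : ℂ) * (((t : ℂ) + 1) ^ 3)⁻¹ * (z / ((t : ℂ) + 1)) ^ n := fun n => by
      simp only [smul_eq_mul]
      push_cast
      rw [div_pow]
      field_simp
      ring
    simp only [e, hg.tsum_eq, Complex.real_smul]
    have hn4 : 1 - z / ((t : ℂ) + 1) ≠ 0 := by
      intro h0
      apply hn3
      field_simp at h0
      linear_combination h0
    rw [pow_one]
    have e2 : 1 - z / ((t : ℂ) + 1) = (-z + (t + 1)) / (t + 1) := by field_simp; ring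
    rw [e2]
    field_simp
  rw [e1, e2]
  exact h

/-- The moment recursion is Gauss's recursion, with an offset: the coefficient of z^(n+1) is λM_n.
The induction starts from λM_0 = κ/2 = a(1-a)/2, and the constant term is the explicit 1. -/
theorem Profile.isHyp2F1 (P : Profile κ C ψ ψ') (hm : 2 * lam * moment ψ 0 = κ) {a : ℂ}
    (ha : (κ : ℂ) = a * (1 - a)) :
    IsHyp2F1 a (1 - a) 2 (fun z => 1 + lam * z * cauchy ψ 1 (-z)) := by
  refine ⟨fun z hz => ?_, fun z hz => ?_⟩
  · have hz' : -z ∈ region := by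
      change 1 + -z ∈ Complex.slitPlane
      rw [← sub_eq_add_neg]
      exact hz
    have h := (P.hasDerivAt_cauchy hz' le_rfl).differentiableAt
    have h2 : DifferentiableAt ℂ (fun z => cauchy ψ 1 (-z)) z :=
      DifferentiableAt.comp (g := cauchy ψ 1) (f := fun z => -z) z h differentiableAt_id.neg
    exact (((differentiableAt_id.const_mul (lam : ℂ)).mul h2).const_add 1).differentiableWithinAt
  · have hcoef : ∀ n : ℕ, ((((n + 1).factorial : ℂ))⁻¹ *
        (ascPochhammer ℂ (n + 1)).eval a * (ascPochhammer ℂ (n + 1)).eval (1 - a) *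
        ((ascPochhammer ℂ (n + 1)).eval 2)⁻¹) = lam * moment ψ n := by
      intro n
      induction n with
      | zero =>
        have hm' : 2 * (lam : ℂ) * moment ψ 0 = κ := by exact_mod_cast hm
        simp
        linear_combination (-1 / 2 : ℂ) * hm' - (1 / 2 : ℂ) * ha
      | succ n ih =>
        have h1 := congrArg (fun x : ℝ => (x : ℂ)) (P.moment_succ n)
        push_cast at h1
        have h2 : (n : ℂ) + 2 ≠ 0 := by exact_mod_cast (by positivity : (n : ℝ) + 2 ≠ 0)
        have h3 : (n : ℂ) + 3 ≠ 0 := by exact_mod_cast (by positivity : (n : ℝ) + 3 ≠ 0)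
        rw [ascPochhammer_succ_eval (n + 1) a, ascPochhammer_succ_eval (n + 1) (1 - a),
          ascPochhammer_succ_eval (n + 1) (2 : ℂ), Nat.factorial_succ (n + 1)]
        have h5 : (κ : ℂ) + (n + 1) * (n + 2) = (a + (n + 1)) * (1 - a + (n + 1)) := by
          rw [ha]; ring
        have h6 : (lam : ℂ) * moment ψ (n + 1) = lam * moment ψ n *
            ((a + (n + 1)) * (1 - a + (n + 1)) / ((n + 2) * (n + 3))) := by
          rw [← h5]
          field_simp
          linear_combination (lam : ℂ) * h1
        rw [h6, ← ih]
        push_cast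
        have h7 : (n : ℂ) + 1 + 1 = n + 2 := by ring
        have h8 : (2 : ℂ) + (n + 1) = n + 3 := by ring
        rw [h7, h8, mul_inv, mul_inv, div_eq_mul_inv, mul_inv]
        ring
    rw [ordinaryHypergeometric_eq_tsum]
    have hs := ((P.hasSum_cauchy hz).mul_left (lam * z))
    have hs' : HasSum (fun n : ℕ => (((n + 1).factorial : ℂ))⁻¹ *
        (ascPochhammer ℂ (n + 1)).eval a * (ascPochhammer ℂ (n + 1)).eval (1 - a) *
        ((ascPochhammer ℂ (n + 1)).eval 2)⁻¹ * z ^ (n + 1)) (lam * z * cauchy ψ 1 (-z)) := by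
      refine hs.congr_fun fun n => ?_
      rw [hcoef]
      ring
    simp only [smul_eq_mul]
    have hs2 := (hasSum_nat_add_iff (f := fun n : ℕ => ((n.factorial : ℂ))⁻¹ *
        (ascPochhammer ℂ n).eval a * (ascPochhammer ℂ n).eval (1 - a) *
        ((ascPochhammer ℂ n).eval 2)⁻¹ * z ^ n) 1).1 hs'
    rw [hs2.tsum_eq]
    simp
    ring

end

/-- The density is the rescaled solution. -/
theorem Profile.hypDensity_eq {lam μ C : ℝ} {ψ ψ' : ℝ → ℝ} (P : Profile (kappa lam) C ψ ψ')
    (hlam : -(1 / Real.pi) ≤ lam) (hμ : 0 < μ) {x : ℝ} (hx : 0 ≤ x) :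
    hypDensity lam μ x = ((μ ^ 2 * ψ (x / μ ^ 2) : ℝ) : ℂ) := by
  have hm := P.moment_zero hlam
  have hx' : 0 ≤ x / μ ^ 2 := by positivity
  have e : -(x : ℂ) / (μ : ℂ) ^ 2 = -((x / μ ^ 2 : ℝ) : ℂ) := by push_cast; ring
  have hmem : -((x / μ ^ 2 : ℝ) : ℂ) ∈ cutPlane := by
    change 1 - -((x / μ ^ 2 : ℝ) : ℂ) ∈ Complex.slitPlane
    rw [sub_neg_eq_add]
    exact ofReal_mem_region (by linarith)
  have hμ' : (μ : ℂ) ≠ 0 := Complex.ofReal_ne_zero.2 hμ.ne'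
  rw [hypDensity, e, hyp2F1_eq (P.isHyp2F1 hm (kappa_eq lam)) hmem, neg_neg, Complex.ofReal_mul,
    ← P.ext_eq hm hx', ext]
  push_cast
  field_simp
  ring

theorem Profile.rho_eq {lam μ C : ℝ} {ψ ψ' : ℝ → ℝ} (P : Profile (kappa lam) C ψ ψ')
    (hlam : -(1 / Real.pi) ≤ lam) (hμ : 0 < μ) {x : ℝ} (hx : 0 ≤ x) :
    rho lam μ x = μ ^ 2 * ψ (x / μ ^ 2) := by
  rw [rho, P.hypDensity_eq hlam hμ hx, Complex.ofReal_re]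

/-! ### Scaling -/

section

variable {E : Type*} [NormedAddCommGroup E] [NormedSpace ℝ E] {f g : ℝ → E} {m : ℝ}

theorem integrableOn_Ioi_scale (hm : 0 < m) (h : ∀ t, 0 < t → f t = (m ^ 2)⁻¹ • g (m⁻¹ * t))
    (hg : IntegrableOn g (Ioi 0)) : IntegrableOn f (Ioi 0) := by
  have h1 : IntegrableOn (fun t => g (m⁻¹ * t)) (Ioi 0) := by
    rw [integrableOn_Ioi_comp_mul_left_iff g 0 (inv_pos.2 hm), mul_zero]
    exact hg
  exact IntegrableOn.congr_fun (f := fun t => (m ^ 2)⁻¹ • g (m⁻¹ * t))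
    (h1.smul ((m ^ 2)⁻¹)) (fun t ht => (h t ht).symm) measurableSet_Ioi

/-- With m = μ² the density contributes a factor m and the cubic kernel m^(-3), hence the weight
m^(-2); the substitution gives back one m. -/
theorem integral_Ioi_scale (hm : 0 < m) (h : ∀ t, 0 < t → f t = (m ^ 2)⁻¹ • g (m⁻¹ * t)) :
    ∫ t in Ioi (0 : ℝ), f t = m⁻¹ • ∫ t in Ioi (0 : ℝ), g t := by
  rw [setIntegral_congr_fun measurableSet_Ioi (fun t ht => h t ht), integral_smul,
    integral_comp_mul_left_Ioi g 0 (inv_pos.2 hm), mul_zero, smul_smul]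
  congr 1
  field_simp

end

section

variable {lam μ C : ℝ} {ψ ψ' : ℝ → ℝ}

theorem Profile.rho_eq' (P : Profile (kappa lam) C ψ ψ') (hlam : -(1 / Real.pi) ≤ lam)
    (hμ : 0 < μ) {t : ℝ} (ht : 0 < t) : rho lam μ t = μ ^ 2 * ψ ((μ ^ 2)⁻¹ * t) := by
  rw [P.rho_eq hlam hμ ht.le, div_eq_inv_mul]

/-- The mass enters only through the homothety z = μ²w. No condition on w is needed, since the
change of variables holds regardless of convergence. -/
theorem Profile.R4_eq (P : Profile (kappa lam) C ψ ψ') (hlam : -(1 / Real.pi) ≤ lam)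
    (hμ : 0 < μ) (w : ℂ) :
    R4 lam μ (rho lam μ) ((μ : ℂ) ^ 2 * w) = (μ : ℂ) ^ 2 * ext lam ψ w := by
  have hμ' : (μ : ℂ) ≠ 0 := Complex.ofReal_ne_zero.2 hμ.ne'
  have hm : 0 < μ ^ 2 := by positivity
  have h : ∫ t in Ioi (0 : ℝ), (rho lam μ t : ℂ) /
      (((t : ℂ) + (μ : ℂ) ^ 2) ^ 2 * ((t : ℂ) + (μ : ℂ) ^ 2 + (μ : ℂ) ^ 2 * w)) =
      (μ ^ 2)⁻¹ • cauchy ψ 1 w := by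
    refine integral_Ioi_scale hm fun t ht => ?_
    rw [P.rho_eq' hlam hμ ht, pow_one]
    have h1 : (t : ℂ) + (μ : ℂ) ^ 2 = (μ : ℂ) ^ 2 * ((((μ ^ 2)⁻¹ * t : ℝ) : ℂ) + 1) := by
      push_cast; field_simp
    rw [h1, ← mul_add, add_comm _ w]
    simp only [Complex.real_smul, Complex.ofReal_mul, Complex.ofReal_inv, Complex.ofReal_pow,
      div_eq_mul_inv, mul_inv, mul_pow]
    field_simp
  rw [R4, h, ext, Complex.real_smul]
  push_cast
  field_simp

theorem Profile.solvesFredholm (P : Profile (kappa lam) C ψ ψ') (hlam : -(1 / Real.pi) ≤ lam)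
    (hμ : 0 < μ) : SolvesFredholm lam μ (rho lam μ) := by
  intro x hx
  have hm : 0 < μ ^ 2 := by positivity
  have hx' : 0 ≤ x / μ ^ 2 := by positivity
  have hsc : ∀ t, 0 < t → rho lam μ t / ((t + μ ^ 2) ^ 2 * (t + μ ^ 2 + x)) = ((μ ^ 2) ^ 2)⁻¹ •
      (fun τ => ψ τ • (((τ + 1) ^ 2)⁻¹ * ((x / μ ^ 2 + (τ + 1)) ^ 1)⁻¹)) ((μ ^ 2)⁻¹ * t) := by
    intro t ht
    rw [P.rho_eq' hlam hμ ht]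
    simp only [smul_eq_mul, pow_one]
    have h1 : t + μ ^ 2 = μ ^ 2 * ((μ ^ 2)⁻¹ * t + 1) := by field_simp
    have h2 : t + μ ^ 2 + x = μ ^ 2 * (x / μ ^ 2 + ((μ ^ 2)⁻¹ * t + 1)) := by field_simp; ring
    rw [h2, h1]
    have h3 : 0 < (μ ^ 2)⁻¹ * t + 1 := by positivity
    have h4 : 0 < x / μ ^ 2 + ((μ ^ 2)⁻¹ * t + 1) := by positivity
    simp only [div_eq_mul_inv, mul_inv, mul_pow]
    field_simp
  refine ⟨integrableOn_Ioi_scale (g := fun τ => ψ τ • (((τ + 1) ^ 2)⁻¹ *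
    ((x / μ ^ 2 + (τ + 1)) ^ 1)⁻¹)) hm hsc ?_, ?_⟩
  · refine P.integrableOn_smul_of_cube (B := 1) ((continuousOn_inv_pow 2).mul
      (ContinuousOn.inv₀ (by fun_prop) fun t ht => ?_)) fun t ht => ?_
    · have := mem_Ioi.1 ht
      positivity
    · rw [Real.norm_of_nonneg (by positivity), ← mul_inv, one_div]
      refine inv_anti₀ (by positivity) ?_
      rw [pow_succ]
      gcongr
      rw [pow_one]
      linarith
  · rw [integral_Ioi_scale (g := fun τ => ψ τ • (((τ + 1) ^ 2)⁻¹ *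
      ((x / μ ^ 2 + (τ + 1)) ^ 1)⁻¹)) hm hsc]
    have h := P.ext_eq (P.moment_zero hlam) hx'
    rw [ext, cauchy_ofReal] at h
    have h2 : x / μ ^ 2 - lam * (x / μ ^ 2) ^ 2 * ∫ t in Ioi (0 : ℝ),
        ψ t • (((t + 1) ^ 2)⁻¹ * ((x / μ ^ 2 + (t + 1)) ^ 1)⁻¹) = ψ (x / μ ^ 2) := by
      exact_mod_cast h
    rw [P.rho_eq hlam hμ hx, ← h2, smul_eq_mul]
    field_simp

/-! ### The natural mass and the two equivalent boundary conditions -/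

theorem isNaturalMass_iff : IsNaturalMass lam μ ↔ μ ^ 2 = kappa lam / lam := by
  rw [IsNaturalMass, ← kappa_eq]
  norm_cast

theorem kappa_div_pos (h0 : lam ≠ 0) : 0 < kappa lam / lam := by
  rcases lt_or_gt_of_ne h0 with h | h
  · exact div_pos_of_neg_of_neg (kappa_neg h) h
  · exact div_pos (kappa_pos h) h

theorem exists_naturalMass (h0 : lam ≠ 0) : ∃ μ : ℝ, 0 < μ ∧ IsNaturalMass lam μ := by
  have h := kappa_div_pos h0
  exact ⟨√(kappa lam / lam), Real.sqrt_pos.2 h, isNaturalMass_iff.2 (Real.sq_sqrt h.le)⟩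

/-- At the tip of the cut the kernel 1/(t+1+z) becomes 1/t, still integrable against ψ, and the
integral is the one evaluated by `moment_eq` for k = 0. With 2λM_0 = κ all but the term -λ/κ
cancels. -/
theorem Profile.ext_neg_one (P : Profile (kappa lam) C ψ ψ') (hlam : -(1 / Real.pi) ≤ lam)
    (h0 : lam ≠ 0) : ext lam ψ (-1) = ((-(lam / kappa lam) : ℝ) : ℂ) := by
  have hκ : kappa lam ≠ 0 := fun h => by
    have := kappa_div_pos h0
    simp [h] at this
  have h1 := P.moment_eq 0
  have h2 := P.moment_zero hlam
  have e : ((-1 : ℂ)) = ((-1 : ℝ) : ℂ) := by push_cast; rfl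
  have h3 : ∫ t in Ioi (0 : ℝ), ψ t • (((t + 1) ^ 2)⁻¹ * ((-1 + (t + 1)) ^ 1)⁻¹) =
      ∫ t in Ioi (0 : ℝ), ψ t • (t * (t + 1) ^ (0 + 2))⁻¹ := by
    refine setIntegral_congr_fun measurableSet_Ioi fun t _ => ?_
    have : (-1 + (t + 1)) = t := by ring
    simp only [this, pow_one, mul_inv, zero_add]
    ring
  rw [ext, e, cauchy_ofReal, h3]
  rw [← Complex.ofReal_pow, ← Complex.ofReal_mul, ← Complex.ofReal_mul, ← Complex.ofReal_sub]
  congr 1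
  simp only [CharP.cast_eq_zero, zero_add, one_mul] at h1
  rw [eq_neg_iff_add_eq_zero]
  field_simp
  simp only [zero_add, smul_eq_mul, one_div] at h1 ⊢
  linear_combination -lam * h1 + h2

theorem Profile.R4_neg_iff (P : Profile (kappa lam) C ψ ψ') (hlam : -(1 / Real.pi) ≤ lam)
    (h0 : lam ≠ 0) (hμ : 0 < μ) :
    R4 lam μ (rho lam μ) (-(μ : ℂ) ^ 2) = -1 ↔ IsNaturalMass lam μ := by
  have h := P.R4_eq hlam hμ (-1)
  have hκ : kappa lam ≠ 0 := fun h => by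
    have := kappa_div_pos h0
    simp [h] at this
  rw [mul_neg_one, P.ext_neg_one hlam h0] at h
  have e : ((μ : ℂ) ^ 2 * ((-(lam / kappa lam) : ℝ) : ℂ) = -1) ↔
      μ ^ 2 * (-(lam / kappa lam)) = -1 := by
    rw [← Complex.ofReal_inj]
    push_cast
    rfl
  rw [h, e, isNaturalMass_iff]
  constructor
  · intro h
    field_simp at h ⊢
    linarith
  · intro h
    rw [h]
    field_simp

theorem Profile.integrableOn_rho_div (P : Profile (kappa lam) C ψ ψ')
    (hlam : -(1 / Real.pi) ≤ lam) (hμ : 0 < μ) :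
    IntegrableOn (fun t : ℝ => rho lam μ t / ((t + μ ^ 2) ^ 2 * t)) (Ioi 0) := by
  have hm : 0 < μ ^ 2 := by positivity
  refine integrableOn_Ioi_scale hm (fun t ht => ?_) (P.integrableOn_div_moment 0)
  rw [P.rho_eq' hlam hμ ht]
  obtain ⟨τ, rfl⟩ : ∃ τ, t = μ ^ 2 * τ := ⟨(μ ^ 2)⁻¹ * t, by field_simp⟩
  have hτ : 0 < τ := pos_of_mul_pos_right ht hm.le
  rw [inv_mul_cancel_left₀ hm.ne']
  simp only [smul_eq_mul]
  field_simp

theorem Profile.rho_div_cube (P : Profile (kappa lam) C ψ ψ') (hlam : -(1 / Real.pi) ≤ lam)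
    (hμ : 0 < μ) {t : ℝ} (ht : 0 < t) : rho lam μ t / (t + μ ^ 2) ^ 3 = ((μ ^ 2) ^ 2)⁻¹ •
      (fun τ => ψ τ • ((τ + 1) ^ (0 + 3))⁻¹) ((μ ^ 2)⁻¹ * t) := by
  have hm : 0 < μ ^ 2 := by positivity
  rw [P.rho_eq' hlam hμ ht]
  obtain ⟨τ, rfl⟩ : ∃ τ, t = μ ^ 2 * τ := ⟨(μ ^ 2)⁻¹ * t, by field_simp⟩
  have hτ : 0 < τ := pos_of_mul_pos_right ht hm.le
  rw [inv_mul_cancel_left₀ hm.ne']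
  simp only [smul_eq_mul, zero_add]
  field_simp

theorem Profile.integrableOn_rho_cube (P : Profile (kappa lam) C ψ ψ')
    (hlam : -(1 / Real.pi) ≤ lam) (hμ : 0 < μ) :
    IntegrableOn (fun t : ℝ => rho lam μ t / (t + μ ^ 2) ^ 3) (Ioi 0) :=
  integrableOn_Ioi_scale (g := fun τ => ψ τ • ((τ + 1) ^ (0 + 3))⁻¹) (by positivity)
    (fun _ ht => P.rho_div_cube hlam hμ ht)
    (P.integrableOn_moment 0)

theorem Profile.integral_rho_cube_iff (P : Profile (kappa lam) C ψ ψ')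
    (hlam : -(1 / Real.pi) ≤ lam) (h0 : lam ≠ 0) (hμ : 0 < μ) :
    (∫ t in Ioi (0 : ℝ), rho lam μ t / (t + μ ^ 2) ^ 3) = 1 / 2 ↔ IsNaturalMass lam μ := by
  have hm : 0 < μ ^ 2 := by positivity
  rw [integral_Ioi_scale (g := fun τ => ψ τ • ((τ + 1) ^ (0 + 3))⁻¹) hm
    (fun _ ht => P.rho_div_cube hlam hμ ht), isNaturalMass_iff,
    ← P.moment_zero hlam, smul_eq_mul]
  change (μ ^ 2)⁻¹ * moment ψ 0 = 1 / 2 ↔ _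
  constructor
  · intro h
    field_simp at h ⊢
    linarith
  · intro h
    rw [h]
    have : moment ψ 0 ≠ 0 := by
      rintro h1
      rw [h1] at h
      simp at h
      exact hμ.ne' h
    field_simp

end

namespace SecondOrder

/-! ### Solutions along the critical line -/

section

variable {κ : ℝ} {y y' : ℝ → ℝ}

theorem line_mul_sq_le {b : ℝ} (hb : 0 ≤ b) (hκ : κ ≤ b) {t : ℝ} (_ : 0 < t) :
    κ / (t ^ 2 + 1 / 4) * t ^ 2 ≤ b := by
  rw [div_mul_eq_mul_div, div_le_iff₀ (by positivity)]
  nlinarith [sq_nonneg t]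

/-- The coefficient k is kept free: k = κ makes the energy decrease when κ ≥ 0, while k = |κ| keeps
it nonnegative for either sign. -/
theorem hasDerivAt_energy (S : SecondOrder (fun t => κ / (t ^ 2 + 1 / 4)) y y') (k : ℝ) {t : ℝ}
    (ht : 0 < t) : HasDerivAt (fun t => y' t ^ 2 + k * (y t ^ 2 / (t ^ 2 + 1 / 4)))
      (2 * (k - κ) * (y t * y' t) / (t ^ 2 + 1 / 4) - 2 * k * t * y t ^ 2 / (t ^ 2 + 1 / 4) ^ 2)
      t := by
  have hr : t ^ 2 + 1 / 4 ≠ 0 := by positivity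
  have h := (S.hasDerivAt_deriv_sq ht).add (((S.hasDerivAt_sq ht.le).div
    (((hasDerivAt_id t).pow 2).add_const (1 / 4)) (by simpa using hr)).const_mul k)
  refine h.congr_deriv ?_
  simp only [id, Pi.pow_apply]
  push_cast
  field_simp
  ring

theorem tendsto_energy (S : SecondOrder (fun t => κ / (t ^ 2 + 1 / 4)) y y') (k : ℝ) :
    Tendsto (fun t => y' t ^ 2 + k * (y t ^ 2 / (t ^ 2 + 1 / 4))) (𝓝[>] 0)
      (𝓝 (y' 0 ^ 2 + k * (y 0 ^ 2 / (0 ^ 2 + 1 / 4)))) := by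
  have h1 : Tendsto (fun t : ℝ => t ^ 2 + 1 / 4) (𝓝[>] 0) (𝓝 (0 ^ 2 + 1 / 4)) :=
    (Continuous.tendsto (by fun_prop) 0).mono_left nhdsWithin_le_nhds
  exact (S.tendsto_deriv_zero.pow 2).add
    (((S.tendsto_zero.pow 2).div h1 (by norm_num)).const_mul k)

theorem energy_le (S : SecondOrder (fun t => κ / (t ^ 2 + 1 / 4)) y y') (hκ : 0 ≤ κ) {t : ℝ}
    (ht : 0 < t) : y' t ^ 2 ≤ y' 0 ^ 2 + 4 * κ * y 0 ^ 2 := by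
  have hm := antitoneOn_Ioi_of_hasDerivAt (fun t ht => S.hasDerivAt_energy κ ht) fun t ht => by
    have : 0 ≤ 2 * κ * t * y t ^ 2 / (t ^ 2 + 1 / 4) ^ 2 := by positivity
    rw [sub_self, mul_zero, zero_mul, zero_div, zero_sub]
    linarith
  have h := ge_of_antitoneOn_Ioi hm (S.tendsto_energy κ) ht
  have h2 : 0 ≤ κ * (y t ^ 2 / (t ^ 2 + 1 / 4)) := by positivity
  norm_num at h
  linarith

/-- Solutions have derivatives of order at most `t ^ (1/4)`. -/
theorem pow_four_deriv_le (S : SecondOrder (fun t => κ / (t ^ 2 + 1 / 4)) y y')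
    (hκ : |κ| ≤ 1 / 32) {t : ℝ} (ht : 0 ≤ t) :
    y' t ^ 4 ≤ 2 * (y' 0 ^ 2 + 4 * |κ| * y 0 ^ 2) ^ 2 * (t + 1 / 2) := by
  rcases ht.eq_or_lt with rfl | ht
  · have h1 : y' 0 ^ 2 ≤ y' 0 ^ 2 + 4 * |κ| * y 0 ^ 2 := by
      have : 0 ≤ 4 * |κ| * y 0 ^ 2 := by positivity
      linarith
    have h2 := pow_le_pow_left₀ (sq_nonneg _) h1 2
    rw [← pow_mul] at h2
    norm_num at h2 ⊢
    linarith
  set k := |κ| with hk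
  have hk0 : 0 ≤ k := abs_nonneg κ
  set A : ℝ → ℝ := fun t => y' t ^ 2 + k * (y t ^ 2 / (t ^ 2 + 1 / 4)) with hA
  -- The aim is 2(t+1/2)A' ≤ A, so that A grows at most like √t and y' like t^(1/4).
  have hd : ∀ t, 0 < t → HasDerivAt (fun t => A t ^ 2 / (t + 1 / 2))
      ((((2 : ℕ) : ℝ) * A t ^ 1 * (2 * (k - κ) * (y t * y' t) / (t ^ 2 + 1 / 4) -
        2 * k * t * y t ^ 2 / (t ^ 2 + 1 / 4) ^ 2) * (t + 1 / 2) - A t ^ 2 * 1) / (t + 1 / 2) ^ 2)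
      t := fun t ht =>
    ((S.hasDerivAt_energy k ht).pow 2).div ((hasDerivAt_id t).add_const (1 / 2))
      (by change t + 1 / 2 ≠ 0; positivity)
  have hm := antitoneOn_Ioi_of_hasDerivAt hd fun t ht => by
    have hr : 0 < t ^ 2 + 1 / 4 := by positivity
    have hA0 : 0 ≤ A t := by positivity
    refine div_nonpos_of_nonpos_of_nonneg ?_ (sq_nonneg _)
    have h1 : 0 ≤ 2 * k * t * y t ^ 2 / (t ^ 2 + 1 / 4) ^ 2 := by positivity
    have h2 : 2 * (k - κ) * (y t * y' t) / (t ^ 2 + 1 / 4) ≤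
        4 * k * |y t| * |y' t| / (t ^ 2 + 1 / 4) := by
      refine div_le_div_of_nonneg_right ?_ hr.le
      have h3 := le_abs_self ((k - κ) * (y t * y' t))
      rw [abs_mul, abs_mul] at h3
      have h4 : |k - κ| ≤ 2 * k := by
        calc |k - κ| ≤ |k| + |κ| := abs_sub _ _
          _ = 2 * k := by rw [abs_of_nonneg hk0]; ring
      have h5 : |k - κ| * (|y t| * |y' t|) ≤ 2 * k * (|y t| * |y' t|) := by gcongr
      linarith
    have h3 : 4 * k * |y t| * |y' t| / (t ^ 2 + 1 / 4) * (2 * (t + 1 / 2)) ≤ A t := by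
      simp only [hA]
      rw [← sq_abs (y' t), ← sq_abs (y t)]
      set u := |y t|
      set v := |y' t|
      have hu : 0 ≤ u := abs_nonneg _
      have hv : 0 ≤ v := abs_nonneg _
      -- Completing the square leaves t² + 1/4 - 16k(t+1/2)², nonnegative because k ≤ 1/32 and
      -- (t+1/2)² ≤ 2(t²+1/4).
      have e : v ^ 2 + k * (u ^ 2 / (t ^ 2 + 1 / 4)) - 4 * k * u * v / (t ^ 2 + 1 / 4) *
          (2 * (t + 1 / 2)) = ((v - 4 * k * u * (t + 1 / 2) / (t ^ 2 + 1 / 4)) ^ 2) +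
          k * u ^ 2 / (t ^ 2 + 1 / 4) ^ 2 * (t ^ 2 + 1 / 4 - 16 * k * (t + 1 / 2) ^ 2) := by
        field_simp
        ring
      have h6 : 0 ≤ t ^ 2 + 1 / 4 - 16 * k * (t + 1 / 2) ^ 2 := by
        have : 16 * k * (t + 1 / 2) ^ 2 ≤ 1 / 2 * (t + 1 / 2) ^ 2 := by
          gcongr
          linarith
        nlinarith [sq_nonneg (t - 1 / 2)]
      have h7 : 0 ≤ k * u ^ 2 / (t ^ 2 + 1 / 4) ^ 2 *
        (t ^ 2 + 1 / 4 - 16 * k * (t + 1 / 2) ^ 2) := mul_nonneg (by positivity) h6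
      have h8 := sq_nonneg (v - 4 * k * u * (t + 1 / 2) / (t ^ 2 + 1 / 4))
      linarith
    have h4 : (2 * (k - κ) * (y t * y' t) / (t ^ 2 + 1 / 4) -
        2 * k * t * y t ^ 2 / (t ^ 2 + 1 / 4) ^ 2) * (2 * (t + 1 / 2)) ≤ A t := by
      refine le_trans (mul_le_mul_of_nonneg_right ?_ (by positivity)) h3
      linarith
    have h5 := mul_le_mul_of_nonneg_left h4 hA0
    push_cast
    rw [pow_one]
    linarith
  have hl : Tendsto (fun t => A t ^ 2 / (t + 1 / 2)) (𝓝[>] 0)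
      (𝓝 ((y' 0 ^ 2 + k * (y 0 ^ 2 / (0 ^ 2 + 1 / 4))) ^ 2 / (0 + 1 / 2))) := by
    have h1 : Tendsto (fun t : ℝ => t + 1 / 2) (𝓝[>] 0) (𝓝 (0 + 1 / 2)) :=
      (Continuous.tendsto (by fun_prop) 0).mono_left nhdsWithin_le_nhds
    exact ((S.tendsto_energy k).pow 2).div h1 (by norm_num)
  have h := ge_of_antitoneOn_Ioi hm hl ht
  rw [div_le_iff₀ (by positivity)] at h
  have h1 : y' t ^ 2 ≤ A t := by
    have : 0 ≤ k * (y t ^ 2 / (t ^ 2 + 1 / 4)) := by positivity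
    simp only [hA]
    linarith
  have h2 := pow_le_pow_left₀ (sq_nonneg _) h1 2
  rw [← pow_mul] at h2
  norm_num at h h2 ⊢
  refine h2.trans (h.trans_eq ?_)
  ring

theorem exists_growth (S : SecondOrder (fun t => κ / (t ^ 2 + 1 / 4)) y y')
    (hκ : |κ| ≤ 1 / 32) : ∃ B, 0 ≤ B ∧ ∀ t, 0 ≤ t → |y' t| ≤ B * (1 + t) ^ (1 / 4 : ℝ) := by
  set M := 2 * (y' 0 ^ 2 + 4 * |κ| * y 0 ^ 2) ^ 2 with hM
  have hM0 : 0 ≤ M := by positivity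
  refine ⟨M ^ (1 / 4 : ℝ), by positivity, fun t ht => ?_⟩
  have h := S.pow_four_deriv_le hκ ht
  have h1 : y' t ^ 4 ≤ M * (1 + t) := h.trans (mul_le_mul_of_nonneg_left (by linarith) hM0)
  rw [← Real.mul_rpow hM0 (by positivity)]
  have h2 : |y' t| = (|y' t| ^ 4) ^ (1 / 4 : ℝ) := by
    rw [← Real.rpow_natCast, ← Real.rpow_mul (abs_nonneg _)]
    norm_num
  rw [h2]
  refine Real.rpow_le_rpow (by positivity) ?_ (by norm_num)
  have : |y' t| ^ 4 = y' t ^ 4 := by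
    rw [← abs_pow, abs_of_nonneg (by positivity)]
  rw [this]
  exact h1

end

/-! ### Comparison of the two components -/

section

variable {κ : ℝ} {X X' Y Y' : ℝ → ℝ}

/-- For κ ≤ 0 the function X² is convex on (0,∞) and starts with slope 0. -/
theorem sq_le_sq_of_neg (S : SecondOrder (fun t => κ / (t ^ 2 + 1 / 4)) X X') (hκ : κ ≤ 0)
    (h1 : X' 0 = 0) {t : ℝ} (ht : 0 < t) : X 0 ^ 2 ≤ X t ^ 2 := by
  have hm : MonotoneOn (fun t => X t * X' t) (Ioi 0) :=
    monotoneOn_Ioi_of_hasDerivAt (fun t ht => (S.deriv t ht.le).mul (S.deriv2 t ht)) fun t ht => by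
      have e : X' t * X' t + X t * (-(κ / (t ^ 2 + 1 / 4)) * X t) =
          X' t ^ 2 + -κ * (X t ^ 2 / (t ^ 2 + 1 / 4)) := by ring
      rw [e]
      have : 0 ≤ -κ := by linarith
      positivity
  have hl : Tendsto (fun t => X t * X' t) (𝓝[>] 0) (𝓝 0) := by
    have h := S.tendsto_zero.mul S.tendsto_deriv_zero
    rwa [h1, mul_zero] at h
  have hm2 : MonotoneOn (fun t => X t ^ 2) (Ioi 0) :=
    monotoneOn_Ioi_of_hasDerivAt (fun t ht => S.hasDerivAt_sq ht.le) fun t ht => by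
      have := le_of_monotoneOn_Ioi hm hl ht
      linarith
  exact le_of_monotoneOn_Ioi hm2 (S.tendsto_zero.pow 2) ht

theorem abs_sub_zero_le (S : SecondOrder (fun t => κ / (t ^ 2 + 1 / 4)) X X') (hκ : 0 ≤ κ)
    (h0 : X 0 ≤ 0) (h1 : X' 0 = 0) {t : ℝ} (ht : 0 ≤ t) : |X t - X 0| ≤ 2 * √κ * -X 0 * t := by
  refine abs_sub_le_of_hasDerivAt ht (fun s hs => S.continuousAt hs)
    (fun s hs => S.deriv s hs.le) fun s hs _ => ?_
  have h := S.energy_le hκ hs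
  rw [h1] at h
  refine abs_le_of_sq_le_sq ?_ (by have := Real.sqrt_nonneg κ; nlinarith)
  have : (2 * √κ * -X 0) ^ 2 = 4 * κ * X 0 ^ 2 := by
    rw [mul_pow, mul_pow, Real.sq_sqrt hκ]; ring
  rw [this]
  linarith

/-- The speed bound 2√κ|X(0)| prevents X from crossing zero before time 1/(2√κ). Until then X'' ≥ 0,
so X rises from X(0) towards zero. -/
theorem sq_le_sq_of_small (S : SecondOrder (fun t => κ / (t ^ 2 + 1 / 4)) X X') (hκ : 0 ≤ κ)
    (h0 : X 0 ≤ 0) (h1 : X' 0 = 0) {t : ℝ} (ht : 0 < t) (hts : 2 * √κ * t ≤ 1) :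
    X t ^ 2 ≤ X 0 ^ 2 := by
  have hneg : ∀ s, 0 ≤ s → s ≤ t → X s ≤ 0 := fun s hs hst => by
    have h := (abs_le.1 (S.abs_sub_zero_le hκ h0 h1 hs)).2
    have h2 : 2 * √κ * s ≤ 1 := le_trans (by gcongr) hts
    nlinarith
  have hm : MonotoneOn X' (Icc 0 t) := by
    refine monotoneOn_of_deriv_nonneg (convex_Icc 0 t)
      (fun s hs => (S.continuousAt_deriv hs.1).continuousWithinAt) ?_ ?_
    · intro s hs
      rw [interior_Icc] at hs
      exact (S.deriv2 s hs.1).differentiableAt.differentiableWithinAt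
    · intro s hs
      rw [interior_Icc] at hs
      rw [(S.deriv2 s hs.1).deriv]
      have h2 := hneg s hs.1.le hs.2.le
      have h3 : 0 ≤ κ / (s ^ 2 + 1 / 4) := by positivity
      nlinarith
  have hm2 : MonotoneOn X (Icc 0 t) := by
    refine monotoneOn_of_deriv_nonneg (convex_Icc 0 t)
      (fun s hs => (S.continuousAt hs.1).continuousWithinAt) ?_ ?_
    · intro s hs
      rw [interior_Icc] at hs
      exact (S.deriv s hs.1.le).differentiableAt.differentiableWithinAt
    · intro s hs
      rw [interior_Icc] at hs
      rw [(S.deriv s hs.1.le).deriv, ← h1]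
      exact hm ⟨le_rfl, ht.le⟩ ⟨hs.1.le, hs.2.le⟩ hs.1.le
  have h2 := hm2 ⟨le_rfl, ht.le⟩ ⟨ht.le, le_rfl⟩ ht.le
  have h3 := hneg t ht.le le_rfl
  nlinarith

theorem sq_sub_sq_le (S : SecondOrder (fun t => κ / (t ^ 2 + 1 / 4)) X X') (hκ : 0 ≤ κ)
    (h0 : X 0 ≤ 0) (h1 : X' 0 = 0) {t : ℝ} (ht : 0 < t) :
    X t ^ 2 - X 0 ^ 2 ≤ 12 * κ * X 0 ^ 2 * t ^ 2 := by
  rcases le_total (2 * √κ * t) 1 with hts | hts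
  · have := S.sq_le_sq_of_small hκ h0 h1 ht hts
    have : 0 ≤ 12 * κ * X 0 ^ 2 * t ^ 2 := by positivity
    linarith
  · have h := S.abs_sub_zero_le hκ h0 h1 ht.le
    have h2 : |X t| ≤ -X 0 * (1 + 2 * √κ * t) := by
      have h3 : |X t| ≤ |X t - X 0| + |X 0| := by
        calc |X t| = |(X t - X 0) + X 0| := by ring_nf
          _ ≤ _ := abs_add_le _ _
      rw [abs_of_nonpos h0] at h3
      linarith
    have h4 := pow_le_pow_left₀ (abs_nonneg _) h2 2
    rw [sq_abs] at h4
    have h5 : (-X 0 * (1 + 2 * √κ * t)) ^ 2 =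
        X 0 ^ 2 + X 0 ^ 2 * (2 * (2 * √κ * t) + (2 * √κ * t) ^ 2) := by ring
    -- With s = 2√κt ≥ 1, (1+s)² - 1 ≤ 3s² = 12κt².
    have h6 : 2 * (2 * √κ * t) + (2 * √κ * t) ^ 2 ≤ 3 * (2 * √κ * t) ^ 2 := by nlinarith
    have h7 : (2 * √κ * t) ^ 2 = 4 * κ * t ^ 2 := by
      rw [mul_pow, mul_pow, Real.sq_sqrt hκ]; ring
    rw [h7] at h6 h5
    have h8 := mul_le_mul_of_nonneg_left h6 (sq_nonneg (X 0))
    linarith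

theorem deriv_le_zero (S : SecondOrder (fun t => κ / (t ^ 2 + 1 / 4)) Y Y') (hκ : 0 ≤ κ)
    (h0 : Y 0 = 0) (h1 : 0 < Y' 0) {t : ℝ} (ht : 0 < t) : |Y' t| ≤ Y' 0 := by
  have h := S.energy_le hκ ht
  rw [h0] at h
  refine abs_le_of_sq_le_sq ?_ h1.le
  linarith

/-- On [0,1] the second derivative is at most 4κY'(0), hence Y(1) ≥ (1-4κ)Y'(0). -/
theorem half_le_one (S : SecondOrder (fun t => κ / (t ^ 2 + 1 / 4)) Y Y') (hκ : 0 ≤ κ)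
    (hκ' : κ ≤ 1 / 8) (h0 : Y 0 = 0) (h1 : 0 < Y' 0) : Y' 0 / 2 ≤ Y 1 := by
  have hY : ∀ t, 0 ≤ t → |Y t| ≤ Y' 0 * t := fun t ht => by
    have h := abs_sub_le_of_hasDerivAt ht (fun s hs => S.continuousAt hs)
      (fun s hs => S.deriv s hs.le) fun s hs _ => S.deriv_le_zero hκ h0 h1 hs
    rwa [h0, sub_zero] at h
  have hY' : ∀ t, 0 ≤ t → t ≤ 1 → |Y' t - Y' 0| ≤ 4 * κ * Y' 0 := fun t ht ht1 => by
    have h := abs_sub_le_of_hasDerivAt (B := 4 * κ * Y' 0) ht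
      (fun s hs => S.continuousAt_deriv hs) (fun s hs => S.deriv2 s hs) fun s hs hst => by
        have h2 := hY s hs.le
        rw [abs_mul, abs_neg, abs_of_nonneg (by positivity : 0 ≤ κ / (s ^ 2 + 1 / 4))]
        calc κ / (s ^ 2 + 1 / 4) * |Y s| ≤ κ / (1 / 4) * (Y' 0 * 1) := by
              gcongr
              · linarith [sq_nonneg s]
              · exact h2.trans (by gcongr; linarith)
          _ = _ := by ring
    refine h.trans ?_
    have : 0 ≤ 4 * κ * Y' 0 := by positivity
    nlinarith
  have h := abs_sub_le_of_hasDerivAt (f := fun t => Y t - Y' 0 * t)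
    (f' := fun t => Y' t - Y' 0) (B := 4 * κ * Y' 0) zero_le_one
    (fun s hs => (S.continuousAt hs).sub (by fun_prop))
    (fun s hs => ((S.deriv s hs.le).sub ((hasDerivAt_id s).const_mul _)).congr_deriv (by ring))
    fun s hs hs1 => hY' s hs.le hs1.le
  simp only [h0, mul_zero, sub_zero, mul_one] at h
  have h2 := (abs_le.1 h).1
  nlinarith

end

end SecondOrder

/-! ### Paths along which the logarithms in the two-point function are controlled -/

/-- A path `Z` with derivative `W` such that `s - conj Z` avoids the branch cut of the logarithm
for `s > -ε`, with growth bounds that make the exponent of the two-point function converge. -/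
structure GoodPath (Z W : ℝ → ℂ) (B c ε : ℝ) : Prop where
  deriv : ∀ t, HasDerivAt Z (W t) t
  cont : Continuous W
  B_nonneg : 0 ≤ B
  c_pos : 0 < c
  ε_pos : 0 < ε
  upper : ∀ t, ‖W t‖ ≤ B * (1 + |t|) ^ (1 / 4 : ℝ)
  slit : ∀ t s : ℝ, -ε < s → (s : ℂ) - conj (Z t) ∈ Complex.slitPlane
  lower : ∀ t s : ℝ, -ε < s → c * (1 + |t|) ^ (7 / 8 : ℝ) ≤ ‖(s : ℂ) - conj (Z t)‖

/-- The contribution of a path to the exponent of the two-point function. -/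
noncomputable def pathTerm (Z W : ℝ → ℂ) (a t : ℝ) : ℂ :=
  (Complex.log ((a : ℂ) - conj (Z t)) - Complex.log (((0 : ℝ) : ℂ) - conj (Z t))) * (W t / Z t)

theorem integrable_decay : Integrable fun t : ℝ => (1 + |t|) ^ (-(3 / 2) : ℝ) := by
  have h := integrable_one_add_norm (E := ℝ) (μ := volume) (r := 3 / 2) (by norm_num)
  simpa using h

theorem one_le_rpow_abs (t : ℝ) {r : ℝ} (hr : 0 ≤ r) : 1 ≤ (1 + |t|) ^ r :=
  Real.one_le_rpow (by linarith [abs_nonneg t]) hr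

namespace GoodPath

variable {Z W : ℝ → ℂ} {B c ε : ℝ}

theorem continuous (G : GoodPath Z W B c ε) : Continuous Z :=
  continuous_iff_continuousAt.2 fun t => (G.deriv t).continuousAt

theorem norm_ge (G : GoodPath Z W B c ε) (t : ℝ) : c * (1 + |t|) ^ (7 / 8 : ℝ) ≤ ‖Z t‖ := by
  have h := G.lower t 0 (by linarith [G.ε_pos])
  rwa [Complex.ofReal_zero, zero_sub, norm_neg, RCLike.norm_conj] at h

theorem bound_pos (G : GoodPath Z W B c ε) (t : ℝ) : 0 < c * (1 + |t|) ^ (7 / 8 : ℝ) := by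
  have := G.c_pos
  have := abs_nonneg t
  positivity

theorem ne_zero (G : GoodPath Z W B c ε) (t : ℝ) : Z t ≠ 0 :=
  norm_pos_iff.1 ((G.bound_pos t).trans_le (G.norm_ge t))

theorem neg_mem_slitPlane (G : GoodPath Z W B c ε) (t : ℝ) :
    ((0 : ℝ) : ℂ) - Z t ∈ Complex.slitPlane := by
  have h := G.slit t 0 (by linarith [G.ε_pos])
  rcases h with h | h
  · left
    simpa using h
  · right
    simpa using h

/-- The growth exponents of `GoodPath` are made for this: 1/4 - 7/8 - 7/8 = -3/2, integrable. -/
theorem norm_quot_le (G : GoodPath Z W B c ε) {t s : ℝ} (hs : -ε < s) :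
    ‖((s : ℂ) - conj (Z t))⁻¹‖ * ‖W t / Z t‖ ≤ B / c ^ 2 * (1 + |t|) ^ (-(3 / 2) : ℝ) := by
  have hp := G.bound_pos t
  have h1 : (0 : ℝ) < 1 + |t| := by have := abs_nonneg t; positivity
  have hB := G.B_nonneg
  have hc := G.c_pos
  rw [norm_inv, norm_div]
  calc _ ≤ (c * (1 + |t|) ^ (7 / 8 : ℝ))⁻¹ *
        (B * (1 + |t|) ^ (1 / 4 : ℝ) / (c * (1 + |t|) ^ (7 / 8 : ℝ))) := by
        gcongr
        · exact G.lower t s hs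
        · exact G.upper t
        · exact G.norm_ge t
    _ = B / c ^ 2 * ((1 + |t|) ^ (1 / 4 : ℝ) /
          ((1 + |t|) ^ (7 / 8 : ℝ) * (1 + |t|) ^ (7 / 8 : ℝ))) := by
        field_simp
    _ = _ := by
        rw [← Real.rpow_add h1, ← Real.rpow_sub h1]
        norm_num

theorem hasDerivAt_log (G : GoodPath Z W B c ε) {t s : ℝ} (hs : -ε < s) :
    HasDerivAt (fun s : ℝ => Complex.log ((s : ℂ) - conj (Z t))) ((s : ℂ) - conj (Z t))⁻¹ s := by
  have h : HasDerivAt (fun s : ℝ => (s : ℂ) - conj (Z t)) 1 s :=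
    Complex.ofRealCLM.hasDerivAt.sub_const _
  have h2 := h.clog_real (G.slit t s hs)
  rwa [one_div] at h2

theorem hasDerivAt_pathTerm (G : GoodPath Z W B c ε) {t s : ℝ} (hs : -ε < s) :
    HasDerivAt (fun s : ℝ => pathTerm Z W s t)
      (((s : ℂ) - conj (Z t))⁻¹ * (W t / Z t)) s :=
  ((G.hasDerivAt_log hs).sub_const _).mul_const _

theorem continuous_pathTerm (G : GoodPath Z W B c ε) {a : ℝ} (ha : -ε < a) :
    Continuous (pathTerm Z W a) := by
  have hlog : ∀ s : ℝ, -ε < s → Continuous fun t => Complex.log ((s : ℂ) - conj (Z t)) :=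
    fun s hs => Continuous.clog
      (continuous_const.sub (Complex.continuous_conj.comp G.continuous)) fun t => G.slit t s hs
  exact ((hlog a ha).sub (hlog 0 (by linarith [G.ε_pos]))).mul
    (G.cont.div G.continuous G.ne_zero)

theorem integrable_bound (B c : ℝ) :
    Integrable fun t : ℝ => B / c ^ 2 * (1 + |t|) ^ (-(3 / 2) : ℝ) :=
  integrable_decay.const_mul _

/-- The term vanishes at a = 0, so the mean value inequality in a reduces it to the integrable bound
on its a-derivative. -/
theorem integrable_pathTerm (G : GoodPath Z W B c ε) {a : ℝ} (ha : 0 ≤ a) :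
    Integrable (pathTerm Z W a) := by
  refine Integrable.mono' ((integrable_bound B c).mul_const a)
    (G.continuous_pathTerm (by linarith [G.ε_pos])).aestronglyMeasurable
    (Eventually.of_forall fun t => ?_)
  have h := Convex.norm_image_sub_le_of_norm_hasDerivWithin_le (s := Icc 0 a)
    (f := fun s : ℝ => pathTerm Z W s t) (x := 0) (y := a)
    (C := B / c ^ 2 * (1 + |t|) ^ (-(3 / 2) : ℝ))
    (fun s hs => (G.hasDerivAt_pathTerm (by linarith [G.ε_pos, hs.1])).hasDerivWithinAt)
    (fun s hs => by
      rw [norm_mul]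
      exact G.norm_quot_le (by linarith [G.ε_pos, hs.1])) (convex_Icc 0 a) ⟨le_rfl, ha⟩ ⟨ha, le_rfl⟩
  have h0 : pathTerm Z W 0 t = 0 := by simp [pathTerm]
  rwa [h0, sub_zero, sub_zero, Real.norm_of_nonneg ha] at h

theorem neg_inv_conj_mul (G : GoodPath Z W B c ε) (t : ℝ) :
    (((0 : ℝ) : ℂ) - conj (Z t))⁻¹ * (W t / Z t) = -(W t / ((Complex.normSq (Z t) : ℝ) : ℂ)) := by
  have h := G.ne_zero t
  have h2 : conj (Z t) ≠ 0 := (map_ne_zero _).2 h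
  rw [Complex.normSq_eq_conj_mul_self, Complex.ofReal_zero, zero_sub]
  field_simp

theorem hasDerivAt_integral (G : GoodPath Z W B c ε) :
    Integrable (fun t => W t / ((Complex.normSq (Z t) : ℝ) : ℂ)) ∧
    HasDerivAt (fun a : ℝ => ∫ t, pathTerm Z W a t)
      (-∫ t, W t / ((Complex.normSq (Z t) : ℝ) : ℂ)) 0 := by
  have hε := G.ε_pos
  have hcont : Continuous fun t => W t / ((Complex.normSq (Z t) : ℝ) : ℂ) :=
    G.cont.div (Complex.continuous_ofReal.comp (Complex.continuous_normSq.comp G.continuous))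
      fun t => Complex.ofReal_ne_zero.2 ((Complex.normSq_pos.2 (G.ne_zero t)).ne')
  have key := hasDerivAt_integral_of_dominated_loc_of_deriv_le (μ := volume)
    (F := fun (a : ℝ) (t : ℝ) => pathTerm Z W a t)
    (F' := fun (s : ℝ) (t : ℝ) => ((s : ℂ) - conj (Z t))⁻¹ * (W t / Z t)) (x₀ := (0 : ℝ))
    (bound := fun t => B / c ^ 2 * (1 + |t|) ^ (-(3 / 2) : ℝ)) (s := Ioi (-ε))
    (Ioi_mem_nhds (by linarith))
    (by
      filter_upwards [Ioi_mem_nhds (show -ε < 0 by linarith)] with a ha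
      exact (G.continuous_pathTerm ha).aestronglyMeasurable)
    (G.integrable_pathTerm le_rfl)
    (by
      simp only [G.neg_inv_conj_mul]
      exact hcont.neg.aestronglyMeasurable)
    (Eventually.of_forall fun t s hs => by
      rw [norm_mul]
      exact G.norm_quot_le hs)
    (integrable_bound B c)
    (Eventually.of_forall fun t s hs => G.hasDerivAt_pathTerm hs)
  simp only [G.neg_inv_conj_mul, integral_neg] at key
  refine ⟨?_, key.2⟩
  have h := key.1.neg
  refine h.congr (Eventually.of_forall fun t => ?_)
  simp

/-- The numbers k and l compare 1 + |t/m| with 1 + |t| from above and below. -/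
theorem scale (G : GoodPath Z W B c ε) {m : ℝ} (hm : 0 < m) :
    ∃ B' c' ε', GoodPath (fun t => m * Z (t / m)) (fun t => W (t / m)) B' c' ε' := by
  have hmc : (m : ℂ) ≠ 0 := Complex.ofReal_ne_zero.2 hm.ne'
  set k : ℝ := max 1 m⁻¹ with hk
  set l : ℝ := min 1 m⁻¹ with hl
  have hm' : 0 < m⁻¹ := inv_pos.2 hm
  have hk0 : 0 < k := lt_of_lt_of_le one_pos (le_max_left _ _)
  have hl0 : 0 < l := lt_min one_pos hm'
  have hup : ∀ t : ℝ, 1 + |t / m| ≤ k * (1 + |t|) := fun t => by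
    rw [abs_div, abs_of_pos hm, div_eq_inv_mul, mul_add, mul_one]
    have := abs_nonneg t
    exact add_le_add (le_max_left _ _) (by gcongr; exact le_max_right _ _)
  have hlo : ∀ t : ℝ, l * (1 + |t|) ≤ 1 + |t / m| := fun t => by
    rw [abs_div, abs_of_pos hm, div_eq_inv_mul, mul_add, mul_one]
    have := abs_nonneg t
    exact add_le_add (min_le_left _ _) (by gcongr; exact min_le_right _ _)
  have hB := G.B_nonneg
  have hc := G.c_pos
  have hε := G.ε_pos
  have he : ∀ t s : ℝ, (s : ℂ) - conj ((m : ℂ) * Z (t / m)) =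
      (m : ℂ) * (((s / m : ℝ) : ℂ) - conj (Z (t / m))) := fun t s => by
    rw [map_mul, Complex.conj_ofReal]
    push_cast
    field_simp
  have hs' : ∀ s : ℝ, -(m * ε) < s → -ε < s / m := fun s hs => by
    rw [lt_div_iff₀ hm]; linarith
  refine ⟨B * k ^ (1 / 4 : ℝ), m * (c * l ^ (7 / 8 : ℝ)), m * ε, ?_, ?_, by positivity,
    by positivity, by positivity, ?_, ?_, ?_⟩
  · intro t
    have h := ((G.deriv (t / m)).scomp t ((hasDerivAt_id t).div_const m)).const_mul (m : ℂ)
    refine h.congr_deriv ?_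
    simp only [one_div, Complex.real_smul, Complex.ofReal_inv]
    field_simp
  · exact G.cont.comp (continuous_id.div_const m)
  · intro t
    have h0 := abs_nonneg (t / m)
    have h1 := abs_nonneg t
    calc _ ≤ B * (1 + |t / m|) ^ (1 / 4 : ℝ) := G.upper _
      _ ≤ B * (k * (1 + |t|)) ^ (1 / 4 : ℝ) := by gcongr; exact hup t
      _ = _ := by rw [Real.mul_rpow hk0.le (by positivity)]; ring
  · intro t s hs
    rw [he]
    have h := G.slit (t / m) (s / m) (hs' s hs)
    rw [Complex.mem_slitPlane_iff] at h ⊢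
    rw [Complex.re_ofReal_mul, Complex.im_ofReal_mul]
    rcases h with h | h
    · exact Or.inl (mul_pos hm h)
    · exact Or.inr (mul_ne_zero hm.ne' h)
  · intro t s hs
    have h1 := abs_nonneg t
    rw [he, norm_mul, Complex.norm_of_nonneg hm.le, mul_assoc]
    refine mul_le_mul_of_nonneg_left (le_trans ?_ (G.lower _ _ (hs' s hs))) hm.le
    rw [mul_assoc, ← Real.mul_rpow hl0.le (by positivity)]
    gcongr
    exact hlo t

end GoodPath

/-- A path whose imaginary part is an odd solution of a suitable second order equation is good. -/
theorem goodPath_of_secondOrder {Z W : ℝ → ℂ} {q : ℝ → ℝ} {B : ℝ}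
    (hd : ∀ t, HasDerivAt Z (W t) t) (hc : Continuous W) (hB : 0 ≤ B)
    (hup : ∀ t, ‖W t‖ ≤ B * (1 + |t|) ^ (1 / 4 : ℝ))
    (S : SecondOrder q (fun t => (Z t).im) (fun t => (W t).im))
    (hq : ∀ t, 0 < t → q t * t ^ 2 ≤ 7 / 8 * (1 - 7 / 8)) (hodd : ∀ t, (Z (-t)).im = -(Z t).im)
    (h0 : (Z 0).re < 0) (h1 : 0 < (W 0).im) :
    ∃ c ε, GoodPath Z W B c ε := by
  have him0 : (Z 0).im = 0 := by
    have h := hodd 0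
    rw [neg_zero] at h
    linarith
  have hpos : ∀ t, 0 < t → 0 < (Z t).im := fun t ht => S.pos him0 h1 (by norm_num) hq ht
  have hmono := S.monotoneOn_mul_rpow him0 h1 (by norm_num) hq
  have habs : ∀ t, |(Z t).im| = |(Z |t|).im| := fun t => by
    rcases abs_choice t with h | h
    · rw [h]
    · rw [h, hodd, abs_neg]
  obtain ⟨t₁, ht₁, hnear⟩ : ∃ t₁, 0 < t₁ ∧ ∀ t, |t| ≤ t₁ → (Z t).re < (Z 0).re / 2 := by
    have hcr : ContinuousAt (fun t => (Z t).re) 0 :=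
      Complex.continuous_re.continuousAt.comp (hd 0).continuousAt
    have hev := hcr.eventually (gt_mem_nhds (show (Z 0).re < (Z 0).re / 2 by linarith))
    obtain ⟨δ, hδ, hball⟩ := Metric.eventually_nhds_iff.1 hev
    exact ⟨δ / 2, by positivity, fun t ht => hball (by
      rw [Real.dist_eq, sub_zero]; linarith)⟩
  set r := min t₁ 1 with hr
  have hr0 : 0 < r := lt_min ht₁ one_pos
  have hr1 : r ≤ 1 := min_le_right _ _
  -- The factor r/2 is chosen because (r/2)(1+|t|) ≤ |t| whenever |t| ≥ r and r ≤ 1.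
  set c₂ := (Z r).im * r ^ (-(7 / 8) : ℝ) * (r / 2) ^ (7 / 8 : ℝ) with hc₂
  have hc₂0 : 0 < c₂ := by have := hpos r hr0; positivity
  have hfar : ∀ t : ℝ, r ≤ |t| → c₂ * (1 + |t|) ^ (7 / 8 : ℝ) ≤ |(Z t).im| := fun t ht => by
    have ht0 : 0 < |t| := hr0.trans_le ht
    have h := hmono (mem_Ioi.2 hr0) (mem_Ioi.2 ht0) ht
    simp only at h
    have hpr := hpos r hr0
    rw [habs, abs_of_pos (hpos _ ht0), hc₂, mul_assoc,
      ← Real.mul_rpow (by positivity) (by positivity)]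
    calc _ ≤ (Z r).im * r ^ (-(7 / 8) : ℝ) * |t| ^ (7 / 8 : ℝ) := by
          gcongr
          nlinarith
      _ ≤ (Z |t|).im * |t| ^ (-(7 / 8) : ℝ) * |t| ^ (7 / 8 : ℝ) := by gcongr
      _ = _ := by
          rw [mul_assoc, ← Real.rpow_add ht0]
          norm_num
  have hre : ∀ (t s : ℝ), |t| ≤ r → (Z 0).re / 4 < s →
      -(Z 0).re / 4 < ((s : ℂ) - conj (Z t)).re := fun t s ht hs => by
    have h := hnear t (ht.trans (min_le_left _ _))
    simp only [Complex.sub_re, Complex.ofReal_re, Complex.conj_re]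
    linarith
  have him : ∀ (t s : ℝ), ((s : ℂ) - conj (Z t)).im = (Z t).im := fun t s => by simp
  -- For |t| ≤ r, Re Z < Re Z(0)/2, so with ε = -Re Z(0)/4 a real part of at least -Re Z(0)/4
  -- survives; the 8 pays for (1+|t|)^(7/8) ≤ 2.
  refine ⟨min c₂ (-(Z 0).re / 8), -(Z 0).re / 4, hd, hc, hB, lt_min hc₂0 (by linarith),
    by linarith, hup, fun t s hs => ?_, fun t s hs => ?_⟩
  · rcases le_total |t| r with ht | ht
    · exact Or.inl (lt_trans (by linarith) (hre t s ht (by linarith)))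
    · right
      rw [him]
      have ht0 : 0 < |t| := hr0.trans_le ht
      exact abs_pos.1 (by rw [habs]; exact abs_pos.2 (hpos _ ht0).ne')
  · have h1t : 0 ≤ |t| := abs_nonneg t
    rcases le_total |t| r with ht | ht
    · refine le_trans ?_ (Complex.abs_re_le_norm _)
      refine le_trans ?_ (le_abs_self _)
      refine le_trans ?_ (hre t s ht (by linarith)).le
      have h2 : (1 + |t|) ^ (7 / 8 : ℝ) ≤ 2 := by
        calc (1 + |t|) ^ (7 / 8 : ℝ) ≤ (1 + |t|) ^ (1 : ℝ) :=
              Real.rpow_le_rpow_of_exponent_le (by linarith) (by norm_num)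
          _ ≤ 2 := by rw [Real.rpow_one]; linarith
      calc _ ≤ -(Z 0).re / 8 * 2 := by
            gcongr
            · linarith
            · exact min_le_right _ _
        _ = _ := by ring
    · refine le_trans ?_ (Complex.abs_im_le_norm _)
      rw [him]
      refine le_trans ?_ (hfar t ht)
      gcongr
      exact min_le_left _ _

/-! ### The continuation along the critical line -/

/-- The point `-1/2 + i t`. -/
noncomputable def critPoint (t : ℝ) : ℂ := -1 / 2 + Complex.I * t

/-- The continuation of the solution along the critical line. -/
noncomputable def critPath (lam : ℝ) (ψ : ℝ → ℝ) (t : ℝ) : ℂ := ext lam ψ (critPoint t)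

/-- The derivative of `critPath`. -/
noncomputable def critDeriv (lam : ℝ) (ψ : ℝ → ℝ) (t : ℝ) : ℂ :=
  Complex.I * extDeriv lam ψ (critPoint t)

theorem critPoint_mem (t : ℝ) : critPoint t ∈ region := by
  refine Or.inl ?_
  simp only [critPoint, Complex.add_re, Complex.one_re, Complex.mul_re, Complex.I_re, zero_mul,
    Complex.I_im, Complex.ofReal_im, mul_zero, sub_zero, add_zero]
  norm_num

theorem critPoint_neg (t : ℝ) : critPoint (-t) = conj (critPoint t) := by
  simp [critPoint, Complex.conj_ofNat]

theorem hasDerivAt_critPoint (w : ℂ) :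
    HasDerivAt (fun w : ℂ => -1 / 2 + Complex.I * w) Complex.I w := by
  refine (((hasDerivAt_id w).const_mul Complex.I).const_add (-1 / 2)).congr_deriv (by simp)

theorem cauchy_conj (ψ : ℝ → ℝ) (n : ℕ) (z : ℂ) : cauchy ψ n (conj z) = conj (cauchy ψ n z) := by
  rw [cauchy, cauchy, ← integral_conj]
  refine setIntegral_congr_fun measurableSet_Ioi fun t _ => ?_
  simp

theorem ext_conj (lam : ℝ) (ψ : ℝ → ℝ) (z : ℂ) : ext lam ψ (conj z) = conj (ext lam ψ z) := by
  simp [ext, cauchy_conj]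

theorem extDeriv_conj (lam : ℝ) (ψ : ℝ → ℝ) (z : ℂ) :
    extDeriv lam ψ (conj z) = conj (extDeriv lam ψ z) := by
  simp [extDeriv, cauchy_conj, Complex.conj_ofNat]

theorem critPath_neg (lam : ℝ) (ψ : ℝ → ℝ) (t : ℝ) :
    critPath lam ψ (-t) = conj (critPath lam ψ t) := by
  rw [critPath, critPoint_neg, ext_conj, critPath]

theorem critDeriv_neg (lam : ℝ) (ψ : ℝ → ℝ) (t : ℝ) :
    critDeriv lam ψ (-t) = -conj (critDeriv lam ψ t) := by
  rw [critDeriv, critPoint_neg, extDeriv_conj, critDeriv, map_mul, Complex.conj_I]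
  ring

section

variable {κ C lam : ℝ} {ψ ψ' : ℝ → ℝ}

theorem Profile.hasDerivAt_critPath (P : Profile κ C ψ ψ') (lam t : ℝ) :
    HasDerivAt (critPath lam ψ) (critDeriv lam ψ t) t := by
  have h := HasDerivAt.comp (h₂ := ext lam ψ) (h := fun w : ℂ => -1 / 2 + Complex.I * w) (t : ℂ)
    (P.hasDerivAt_ext lam (critPoint_mem t)) (hasDerivAt_critPoint t)
  refine h.comp_ofReal.congr_deriv ?_
  rw [critDeriv, mul_comm]
  rfl

/-- On this line z(z+1) = -(t²+1/4) is real, and d²/dt² contributes I² = -1. The resulting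
coefficient is real, so real and imaginary parts decouple. -/
theorem Profile.hasDerivAt_critDeriv (P : Profile κ C ψ ψ') (hm : 2 * lam * moment ψ 0 = κ)
    (t : ℝ) : HasDerivAt (critDeriv lam ψ)
      (((-(κ / (t ^ 2 + 1 / 4)) : ℝ) : ℂ) * critPath lam ψ t) t := by
  have h := (HasDerivAt.comp (h₂ := extDeriv lam ψ) (h := fun w : ℂ => -1 / 2 + Complex.I * w)
    (t : ℂ) (P.hasDerivAt_extDeriv lam (critPoint_mem t)) (hasDerivAt_critPoint t)).const_mul
    Complex.I
  refine h.comp_ofReal.congr_deriv ?_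
  have ho := P.ext_ode hm (critPoint_mem t)
  have e : critPoint t * (critPoint t + 1) = ((-(t ^ 2 + 1 / 4) : ℝ) : ℂ) := by
    simp only [critPoint]
    push_cast
    linear_combination (t : ℂ) ^ 2 * Complex.I_sq
  rw [e] at ho
  have hne : ((-(t ^ 2 + 1 / 4) : ℝ) : ℂ) ≠ 0 := by
    refine Complex.ofReal_ne_zero.2 (neg_ne_zero.2 ?_)
    positivity
  refine mul_left_cancel₀ hne ?_
  change _ * (Complex.I * (-(2 * (lam : ℂ)) * (∫ s in Ioi (0 : ℝ), ψ s • ((((s : ℂ) + 1) ^ 0)⁻¹ *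
    ((critPoint t + (s + 1)) ^ 3)⁻¹)) * Complex.I)) = _ * (_ * ext lam ψ (critPoint t))
  rw [← mul_assoc _ _ (ext lam ψ (critPoint t)), ← Complex.ofReal_mul]
  have e2 : -(t ^ 2 + 1 / 4) * -(κ / (t ^ 2 + 1 / 4)) = κ := by
    have : t ^ 2 + 1 / 4 ≠ 0 := by positivity
    field_simp
  rw [e2]
  linear_combination Complex.I ^ 2 * ho - κ * ext lam ψ (critPoint t) * Complex.I_sq

theorem Profile.continuous_critDeriv (P : Profile κ C ψ ψ') (hm : 2 * lam * moment ψ 0 = κ) :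
    Continuous (critDeriv lam ψ) :=
  continuous_iff_continuousAt.2 fun t => (P.hasDerivAt_critDeriv hm t).continuousAt

theorem Profile.crit_re (P : Profile κ C ψ ψ') (hm : 2 * lam * moment ψ 0 = κ) :
    SecondOrder (fun t => κ / (t ^ 2 + 1 / 4)) (fun t => (critPath lam ψ t).re)
      (fun t => (critDeriv lam ψ t).re) where
  deriv t _ := HasDerivAt.re_comp (P.hasDerivAt_critPath lam t)
  deriv2 t _ := (HasDerivAt.re_comp (P.hasDerivAt_critDeriv hm t)).congr_deriv
    (Complex.re_ofReal_mul _ _)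
  cont := Complex.continuous_re.continuousAt.comp (P.continuous_critDeriv hm).continuousAt

theorem Profile.crit_im (P : Profile κ C ψ ψ') (hm : 2 * lam * moment ψ 0 = κ) :
    SecondOrder (fun t => κ / (t ^ 2 + 1 / 4)) (fun t => (critPath lam ψ t).im)
      (fun t => (critDeriv lam ψ t).im) where
  deriv t _ := HasDerivAt.im_comp (P.hasDerivAt_critPath lam t)
  deriv2 t _ := (HasDerivAt.im_comp (P.hasDerivAt_critDeriv hm t)).congr_deriv
    (Complex.im_ofReal_mul _ _)
  cont := Complex.continuous_im.continuousAt.comp (P.continuous_critDeriv hm).continuousAt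

/-! ### Values at the centre of the critical line -/

/-- `∫₀^∞ ψ(t) (t + 1)^{-2} (t + 1/2)^{-n} dt`. -/
noncomputable def halfMoment (ψ : ℝ → ℝ) (n : ℕ) : ℝ :=
  ∫ t in Ioi (0 : ℝ), ψ t • (((t + 1) ^ 2)⁻¹ * ((-1 / 2 + (t + 1)) ^ n)⁻¹)

theorem critPoint_zero : critPoint 0 = ((-1 / 2 : ℝ) : ℂ) := by
  simp [critPoint]

theorem critPath_zero (lam : ℝ) (ψ : ℝ → ℝ) :
    critPath lam ψ 0 = ((-(1 / 2 + lam / 4 * halfMoment ψ 1) : ℝ) : ℂ) := by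
  rw [critPath, critPoint_zero, ext, cauchy_ofReal, ← halfMoment]
  push_cast
  ring

theorem critDeriv_zero (lam : ℝ) (ψ : ℝ → ℝ) : critDeriv lam ψ 0 =
    Complex.I * ((1 + lam * (halfMoment ψ 1 + halfMoment ψ 2 / 4) : ℝ) : ℂ) := by
  rw [critDeriv, critPoint_zero, extDeriv, cauchy_ofReal, cauchy_ofReal, ← halfMoment,
    ← halfMoment]
  push_cast
  ring

theorem Profile.integrableOn_halfMoment (P : Profile κ C ψ ψ') {n : ℕ} (hn : 1 ≤ n) :
    IntegrableOn (fun t => ψ t • (((t + 1) ^ 2)⁻¹ * ((-1 / 2 + (t + 1)) ^ n)⁻¹)) (Ioi 0) := by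
  refine P.integrableOn_smul_of_cube (B := 2 ^ n) ((continuousOn_inv_pow 2).mul
    (ContinuousOn.inv₀ (by fun_prop) fun t ht => ?_)) fun t ht => ?_
  · have := mem_Ioi.1 ht
    have : 0 < -1 / 2 + (t + 1) := by linarith
    positivity
  · have h1 : 0 < -1 / 2 + (t + 1) := by linarith
    rw [Real.norm_of_nonneg (by positivity)]
    calc _ ≤ ((t + 1) ^ 2)⁻¹ * (((t + 1) / 2) ^ n)⁻¹ := by gcongr; linarith
      _ = 2 ^ n * ((t + 1) ^ (2 + n))⁻¹ := by rw [div_pow, pow_add]; field_simp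
      _ ≤ 2 ^ n * ((t + 1) ^ 3)⁻¹ := by
        gcongr ?_ * ?_
        exact inv_pow_le_inv_pow ht (by omega)
      _ = _ := by rw [div_eq_mul_inv]

theorem Profile.integral_mono (hψ : ∀ t, 0 < t → 0 < ψ t) {f g : ℝ → ℝ}
    (hf : IntegrableOn (fun t => ψ t • f t) (Ioi 0))
    (hg : IntegrableOn (fun t => ψ t • g t) (Ioi 0)) (h : ∀ t, 0 < t → f t ≤ g t) :
    ∫ t in Ioi (0 : ℝ), ψ t • f t ≤ ∫ t in Ioi (0 : ℝ), ψ t • g t :=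
  setIntegral_mono_on hf hg measurableSet_Ioi fun t ht =>
    mul_le_mul_of_nonneg_left (h t ht) (hψ t ht).le

theorem moment_pos (P : Profile κ C ψ ψ') (hψ : ∀ t, 0 < t → 0 < ψ t) : 0 < moment ψ 0 := by
  rw [moment, setIntegral_pos_iff_support_of_nonneg_ae _ (P.integrableOn_moment 0)]
  · have : Ioi (0 : ℝ) ⊆ Function.support (fun t => ψ t • ((t + 1) ^ (0 + 3))⁻¹) ∩ Ioi 0 :=
      fun t ht => by
        have ht0 : (0 : ℝ) < t := ht
        have := hψ t ht0
        refine ⟨?_, ht⟩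
        rw [Function.mem_support, smul_eq_mul]
        positivity
    refine lt_of_lt_of_le ?_ (measure_mono this)
    simp
  · filter_upwards [ae_restrict_mem measurableSet_Ioi] with t ht
    have ht0 : (0 : ℝ) < t := ht
    have := hψ t ht0
    simp only [Pi.zero_apply, smul_eq_mul]
    positivity

theorem Profile.halfMoment_one_ge (P : Profile κ C ψ ψ') (hψ : ∀ t, 0 < t → 0 < ψ t) :
    moment ψ 0 ≤ halfMoment ψ 1 := by
  refine Profile.integral_mono hψ (P.integrableOn_moment 0) (P.integrableOn_halfMoment le_rfl)
    fun t ht => ?_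
  have h1 : 0 < -1 / 2 + (t + 1) := by linarith
  rw [← mul_inv]
  refine inv_anti₀ (by positivity) ?_
  nlinarith [sq_nonneg (t + 1)]

theorem Profile.halfMoment_one_le (P : Profile κ C ψ ψ') (hψ : ∀ t, 0 < t → 0 < ψ t) :
    halfMoment ψ 1 ≤ 2 * moment ψ 0 := by
  rw [moment, ← integral_const_mul]
  refine (Profile.integral_mono (g := fun t => 2 * ((t + 1) ^ (0 + 3))⁻¹) hψ
    (P.integrableOn_halfMoment le_rfl) ?_ fun t ht => ?_).trans_eq ?_
  · refine IntegrableOn.congr_fun (f := fun t => 2 * ψ t • ((t + 1) ^ (0 + 3))⁻¹)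
      ((P.integrableOn_moment 0).const_mul 2) (fun t _ => ?_) measurableSet_Ioi
    simp only [smul_eq_mul]
    ring
  · have h1 : 0 < -1 / 2 + (t + 1) := by linarith
    rw [← mul_inv, ← div_eq_mul_inv, inv_eq_one_div,
      div_le_div_iff₀ (by positivity) (by positivity)]
    nlinarith [sq_nonneg (t + 1)]
  · refine setIntegral_congr_fun measurableSet_Ioi fun t _ => ?_
    simp only [smul_eq_mul]
    ring

theorem Profile.halfMoment_two_bounds (P : Profile κ C ψ ψ') (hψ : ∀ t, 0 < t → 0 < ψ t) :
    0 ≤ halfMoment ψ 2 ∧ halfMoment ψ 2 ≤ 4 * moment ψ 0 := by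
  constructor
  · refine setIntegral_nonneg measurableSet_Ioi fun t ht => ?_
    have ht0 : (0 : ℝ) < t := ht
    have := hψ t ht0
    have h1 : 0 < -1 / 2 + (t + 1) := by linarith
    rw [smul_eq_mul]
    positivity
  · rw [moment, ← integral_const_mul]
    refine (Profile.integral_mono (g := fun t => 4 * ((t + 1) ^ (0 + 3))⁻¹) hψ
      (P.integrableOn_halfMoment one_le_two) ?_ fun t ht => ?_).trans_eq ?_
    · refine IntegrableOn.congr_fun (f := fun t => 4 * ψ t • ((t + 1) ^ (0 + 3))⁻¹)
        ((P.integrableOn_moment 0).const_mul 4) (fun t _ => ?_) measurableSet_Ioi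
      simp only [smul_eq_mul]
      ring
    · have h1 : 0 < -1 / 2 + (t + 1) := by linarith
      rw [← mul_inv, ← div_eq_mul_inv, inv_eq_one_div,
        div_le_div_iff₀ (by positivity) (by positivity)]
      have : 0 ≤ (t + 1) ^ 2 * (4 * (-1 / 2 + (t + 1)) ^ 2 - (t + 1)) := by
        refine mul_nonneg (sq_nonneg _) ?_
        nlinarith
      nlinarith
    · refine setIntegral_congr_fun measurableSet_Ioi fun t _ => ?_
      simp only [smul_eq_mul]
      ring

/-- The quantity that decides on which side of the boundary condition one is. -/
theorem Profile.two_mul_center (P : Profile κ C ψ ψ') (hm : 2 * lam * moment ψ 0 = κ)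
    (hψ : ∀ t, 0 < t → 0 < ψ t) : ∃ δ, moment ψ 0 / 2 ≤ δ ∧
      2 * (1 / 2 + lam / 4 * halfMoment ψ 1) * (2 * moment ψ 0) = 1 - κ * δ := by
  have h1 := P.moment_eq 0
  simp only [CharP.cast_eq_zero, zero_add, one_mul] at h1
  have hB := P.integrableOn_div_moment 0
  have hH := P.integrableOn_halfMoment le_rfl
  -- This δ is forced: expanding the product and inserting `moment_eq` for k = 0 and 2λM_0 = κ
  -- leaves 1 - κδ. Its lower bound holds pointwise under the integral.
  refine ⟨(∫ t in Ioi (0 : ℝ), ψ t • (t * (t + 1) ^ 2)⁻¹) - halfMoment ψ 1 / 2, ?_, ?_⟩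
  · rw [le_sub_iff_add_le, halfMoment, moment, ← integral_div, ← integral_div,
      ← integral_add ((P.integrableOn_moment 0).div_const 2) (hH.div_const 2)]
    refine (Eq.le ?_).trans (Profile.integral_mono
      (f := fun t => ((t + 1) ^ 3)⁻¹ / 2 + ((t + 1) ^ 2)⁻¹ * ((-1 / 2 + (t + 1)) ^ 1)⁻¹ / 2)
      hψ ?_ hB fun t ht => ?_)
    · refine setIntegral_congr_fun measurableSet_Ioi fun t _ => ?_
      simp only [smul_eq_mul]
      ring
    · refine IntegrableOn.congr_fun (f := (fun t => ψ t • ((t + 1) ^ (0 + 3))⁻¹ / 2) +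
        fun t => ψ t • (((t + 1) ^ 2)⁻¹ * ((-1 / 2 + (t + 1)) ^ 1)⁻¹) / 2)
        (((P.integrableOn_moment 0).div_const 2).add (hH.div_const 2))
        (fun t _ => ?_) measurableSet_Ioi
      simp only [Pi.add_apply, smul_eq_mul]
      ring
    · have h2 : 0 < -1 / 2 + (t + 1) := by linarith
      have e : (t * (t + 1) ^ (0 + 2))⁻¹ - (((t + 1) ^ 3)⁻¹ / 2 +
          ((t + 1) ^ 2)⁻¹ * ((-1 / 2 + (t + 1)) ^ 1)⁻¹ / 2) =
          (3 * t + 2) / (4 * t * (t + 1) ^ 3 * (-1 / 2 + (t + 1))) := by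
        rw [show -1 / 2 + (t + 1) = (2 * t + 1) / 2 by ring]
        field_simp
        ring
      have : 0 ≤ (3 * t + 2) / (4 * t * (t + 1) ^ 3 * (-1 / 2 + (t + 1))) := by positivity
      linarith
  · linear_combination h1 + halfMoment ψ 1 / 2 * hm

end

/-! ### Comparison of the critical path with a straight one -/

theorem GoodPath.integrable_im {Z W : ℝ → ℂ} {B c ε : ℝ} (G : GoodPath Z W B c ε) :
    Integrable fun t => (W t).im / Complex.normSq (Z t) := by
  refine G.hasDerivAt_integral.1.im.congr (Eventually.of_forall fun t => ?_)
  exact Complex.div_ofReal_im _ _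

/-- The path with the same real part as at the centre and a given imaginary part. -/
noncomputable def straighten (x : ℝ) (Z : ℝ → ℂ) (t : ℝ) : ℂ := x + Complex.I * ((Z t).im : ℝ)

theorem straighten_re (x : ℝ) (Z : ℝ → ℂ) (t : ℝ) : (straighten x Z t).re = x := by
  simp [straighten]

theorem straighten_im (x : ℝ) (Z : ℝ → ℂ) (t : ℝ) : (straighten x Z t).im = (Z t).im := by
  simp [straighten]

theorem I_mul_ofReal_im (x : ℝ) : (Complex.I * (x : ℂ)).im = x := by
  simp

/-- The arctangent integral. -/
theorem integral_arctan {Y Y' : ℝ → ℝ} {x : ℝ} (hx : 0 < x)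
    (hd : ∀ t, 0 ≤ t → HasDerivAt Y (Y' t) t) (h0 : Y 0 = 0) (hY : Tendsto Y atTop atTop)
    (hi : IntegrableOn (fun t => Y' t / (x ^ 2 + Y t ^ 2)) (Ioi 0)) :
    ∫ t in Ioi (0 : ℝ), Y' t / (x ^ 2 + Y t ^ 2) = Real.pi / (2 * x) := by
  have hder : ∀ t, 0 ≤ t → HasDerivAt (fun t => Real.arctan (Y t / x) / x)
      (Y' t / (x ^ 2 + Y t ^ 2)) t := fun t ht => by
    refine ((((hd t ht).div_const x).arctan).div_const x).congr_deriv ?_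
    have : 0 < x ^ 2 + Y t ^ 2 := by positivity
    have h2 : 0 < 1 + (Y t / x) ^ 2 := by positivity
    field_simp
  have hlim : Tendsto (fun t => Real.arctan (Y t / x) / x) atTop (𝓝 (Real.pi / 2 / x)) :=
    (((Real.tendsto_arctan_atTop.mono_right nhdsWithin_le_nhds).comp
      (hY.atTop_div_const hx))).div_const x
  rw [integral_Ioi_of_hasDerivAt_of_tendsto (hder 0 le_rfl).continuousAt.continuousWithinAt
    (fun t ht => hder t (le_of_lt ht)) hi hlim, h0]
  simp only [zero_div, Real.arctan_zero, sub_zero]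
  rw [div_div]

theorem SecondOrder.ge_mul_rpow {q y y' : ℝ → ℝ} (S : SecondOrder q y y') (h0 : y 0 = 0)
    (h1 : 0 < y' 0) {β : ℝ} (hβ : 0 ≤ β) (hq : ∀ t, 0 < t → q t * t ^ 2 ≤ β * (1 - β)) {t : ℝ}
    (ht : 1 ≤ t) : y 1 * t ^ β ≤ y t := by
  have ht0 : 0 < t := by linarith
  have h := S.monotoneOn_mul_rpow h0 h1 hβ hq (mem_Ioi.2 one_pos) (mem_Ioi.2 ht0) ht
  simp only [Real.one_rpow, mul_one] at h
  calc _ ≤ y t * t ^ (-β) * t ^ β := by gcongr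
    _ = _ := by rw [mul_assoc, ← Real.rpow_add ht0]; simp

theorem SecondOrder.tendsto_atTop {q y y' : ℝ → ℝ} (S : SecondOrder q y y') (h0 : y 0 = 0)
    (h1 : 0 < y' 0) {β : ℝ} (hβ : 0 < β) (hq : ∀ t, 0 < t → q t * t ^ 2 ≤ β * (1 - β)) :
    Tendsto y atTop atTop :=
  tendsto_atTop_mono' atTop (eventually_atTop.2 ⟨1, fun _ ht => S.ge_mul_rpow h0 h1 hβ.le hq ht⟩)
    ((tendsto_rpow_atTop hβ).const_mul_atTop (S.pos h0 h1 hβ.le hq one_pos))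

section

variable {κ C lam : ℝ} {ψ ψ' : ℝ → ℝ}

/-- `-Re` of the critical path at the centre. -/
noncomputable def centre (lam : ℝ) (ψ : ℝ → ℝ) : ℝ := 1 / 2 + lam / 4 * halfMoment ψ 1

/-- The speed of the critical path at the centre. -/
noncomputable def centreSpeed (lam : ℝ) (ψ : ℝ → ℝ) : ℝ :=
  1 + lam * (halfMoment ψ 1 + halfMoment ψ 2 / 4)

theorem critPath_zero_re : (critPath lam ψ 0).re = -centre lam ψ := by
  rw [critPath_zero, Complex.ofReal_re, centre]

theorem critPath_zero_im : (critPath lam ψ 0).im = 0 := by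
  rw [critPath_zero, Complex.ofReal_im]

theorem critDeriv_zero_re : (critDeriv lam ψ 0).re = 0 := by
  rw [critDeriv_zero]; simp

theorem critDeriv_zero_im : (critDeriv lam ψ 0).im = centreSpeed lam ψ := by
  rw [critDeriv_zero, I_mul_ofReal_im, centreSpeed]

theorem Profile.pos (P : Profile κ C ψ ψ') (hκ : |κ| ≤ 1 / 32) (t : ℝ) (ht : 0 < t) : 0 < ψ t :=
  solution_pos (by linarith [(abs_le.1 hκ).2]) P.sol P.zero P.deriv_zero ht

/-- The half moments lie between 0 and 4M_0, so all corrections are controlled by 2|λ|M_0 = |κ| ≤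
1/32. -/
theorem Profile.centre_bounds (P : Profile κ C ψ ψ') (hm : 2 * lam * moment ψ 0 = κ)
    (hκ : |κ| ≤ 1 / 32) : 1 / 4 ≤ centre lam ψ ∧ centre lam ψ ≤ 1 ∧ 1 / 2 ≤ centreSpeed lam ψ ∧
      centreSpeed lam ψ ≤ 2 ∧ (0 < lam → 1 ≤ centreSpeed lam ψ) := by
  have hψ := P.pos hκ
  have h0 := moment_pos P hψ
  have h1 := P.halfMoment_one_ge hψ
  have h2 := P.halfMoment_one_le hψ
  obtain ⟨h3, h4⟩ := P.halfMoment_two_bounds hψ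
  have hl : |lam| * (2 * moment ψ 0) ≤ 1 / 32 := by
    refine le_trans (le_of_eq ?_) hκ
    rw [← hm, mul_right_comm, abs_mul, abs_mul, abs_of_pos h0, abs_two]
    ring
  have ha : |lam * halfMoment ψ 1| ≤ 1 / 32 := by
    rw [abs_mul, abs_of_pos (h0.trans_le h1)]
    exact (mul_le_mul_of_nonneg_left h2 (abs_nonneg _)).trans hl
  have hb : |lam * halfMoment ψ 2| ≤ 1 / 16 := by
    rw [abs_mul, abs_of_nonneg h3]
    exact (mul_le_mul_of_nonneg_left h4 (abs_nonneg _)).trans (by linarith)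
  obtain ⟨a1, a2⟩ := abs_le.1 ha
  obtain ⟨b1, b2⟩ := abs_le.1 hb
  refine ⟨?_, ?_, ?_, ?_, fun hlam => ?_⟩ <;> simp only [centre, centreSpeed]
  · linarith
  · linarith
  · linarith
  · linarith
  · have : 0 ≤ lam * (halfMoment ψ 1 + halfMoment ψ 2 / 4) := by
      have := h0.trans_le h1
      positivity
    linarith

theorem line_le {κ : ℝ} (hκ : |κ| ≤ 1 / 32) (t : ℝ) (ht : 0 < t) :
    κ / (t ^ 2 + 1 / 4) * t ^ 2 ≤ 7 / 8 * (1 - 7 / 8) :=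
  SecondOrder.line_mul_sq_le (by norm_num) (by linarith [(abs_le.1 hκ).2]) ht

theorem norm_critDeriv_abs (t : ℝ) : ‖critDeriv lam ψ |t|‖ = ‖critDeriv lam ψ t‖ := by
  rcases abs_choice t with h | h
  · rw [h]
  · rw [h, critDeriv_neg, norm_neg, RCLike.norm_conj]

theorem Profile.exists_norm_critDeriv_le (P : Profile κ C ψ ψ') (hm : 2 * lam * moment ψ 0 = κ)
    (hκ : |κ| ≤ 1 / 32) :
    ∃ B, 0 ≤ B ∧ ∀ t, ‖critDeriv lam ψ t‖ ≤ B * (1 + |t|) ^ (1 / 4 : ℝ) := by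
  obtain ⟨B₁, hB₁, h1⟩ := (P.crit_re hm).exists_growth hκ
  obtain ⟨B₂, hB₂, h2⟩ := (P.crit_im hm).exists_growth hκ
  refine ⟨B₁ + B₂, by positivity, fun t => ?_⟩
  rw [← norm_critDeriv_abs, add_mul]
  exact (Complex.norm_le_abs_re_add_abs_im _).trans
    (add_le_add (h1 _ (abs_nonneg t)) (h2 _ (abs_nonneg t)))

theorem Profile.goodPath (P : Profile κ C ψ ψ') (hm : 2 * lam * moment ψ 0 = κ)
    (hκ : |κ| ≤ 1 / 32) : ∃ B c ε, GoodPath (critPath lam ψ) (critDeriv lam ψ) B c ε := by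
  obtain ⟨B, hB, hup⟩ := P.exists_norm_critDeriv_le hm hκ
  obtain ⟨h1, -, h2, -, -⟩ := P.centre_bounds hm hκ
  refine ⟨B, goodPath_of_secondOrder (P.hasDerivAt_critPath lam) (P.continuous_critDeriv hm) hB hup
    (P.crit_im hm) (line_le hκ) (fun t => ?_) ?_ ?_⟩
  · rw [critPath_neg, Complex.conj_im]
  · rw [critPath_zero_re]; linarith
  · rw [critDeriv_zero_im]; linarith

theorem Profile.goodPath_straighten (P : Profile κ C ψ ψ') (hm : 2 * lam * moment ψ 0 = κ)
    (hκ : |κ| ≤ 1 / 32) : ∃ B c ε, GoodPath (straighten (-centre lam ψ) (critPath lam ψ))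
      (fun t => Complex.I * ((critDeriv lam ψ t).im : ℝ)) B c ε := by
  obtain ⟨B, hB, hup⟩ := P.exists_norm_critDeriv_le hm hκ
  obtain ⟨h1, -, h2, -, -⟩ := P.centre_bounds hm hκ
  refine ⟨B, goodPath_of_secondOrder (q := fun t => κ / (t ^ 2 + 1 / 4)) (fun t => ?_) ?_ hB
    (fun t => ?_) ?_ (line_le hκ) (fun t => ?_) ?_ ?_⟩
  · exact ((HasDerivAt.ofReal_comp (HasDerivAt.im_comp
      (P.hasDerivAt_critPath lam t))).const_mul Complex.I).const_add _
  · exact continuous_const.mul (Complex.continuous_ofReal.comp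
      (Complex.continuous_im.comp (P.continuous_critDeriv hm)))
  · refine le_trans ?_ (hup t)
    rw [norm_mul, Complex.norm_I, one_mul, Complex.norm_real]
    exact Complex.abs_im_le_norm _
  · simp only [straighten_im, I_mul_ofReal_im]
    exact P.crit_im hm
  · rw [straighten_im, straighten_im, critPath_neg, Complex.conj_im]
  · rw [straighten_re]; linarith
  · rw [I_mul_ofReal_im, critDeriv_zero_im]; linarith

theorem normSq_eq_sq (z : ℂ) : Complex.normSq z = z.re ^ 2 + z.im ^ 2 := by
  rw [Complex.normSq_apply]; ring

theorem Profile.integrable_straight (P : Profile κ C ψ ψ') (hm : 2 * lam * moment ψ 0 = κ)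
    (hκ : |κ| ≤ 1 / 32) : IntegrableOn (fun t => (critDeriv lam ψ t).im /
      (centre lam ψ ^ 2 + (critPath lam ψ t).im ^ 2)) (Ioi 0) := by
  obtain ⟨B, c, ε, G⟩ := P.goodPath_straighten hm hκ
  have h := G.integrable_im.integrableOn (s := Ioi 0)
  simpa only [normSq_eq_sq, straighten_re, straighten_im, I_mul_ofReal_im, neg_sq] using h

theorem Profile.integral_straight (P : Profile κ C ψ ψ') (hm : 2 * lam * moment ψ 0 = κ)
    (hκ : |κ| ≤ 1 / 32) : ∫ t in Ioi (0 : ℝ), (critDeriv lam ψ t).im /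
      (centre lam ψ ^ 2 + (critPath lam ψ t).im ^ 2) = Real.pi / (2 * centre lam ψ) := by
  obtain ⟨h1, -, h2, -, -⟩ := P.centre_bounds hm hκ
  exact integral_arctan (by linarith) (P.crit_im hm).deriv critPath_zero_im
    ((P.crit_im hm).tendsto_atTop critPath_zero_im (by rw [critDeriv_zero_im]; linarith)
      (by norm_num) (line_le hκ)) (P.integrable_straight hm hκ)

/-- Half of the line integral that gives the derivative of the two-point function. -/
noncomputable def lineIntegral (lam : ℝ) (ψ : ℝ → ℝ) : ℝ :=
  ∫ t in Ioi (0 : ℝ), (critDeriv lam ψ t).im / Complex.normSq (critPath lam ψ t)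

theorem Profile.integrableOn_line (P : Profile κ C ψ ψ') (hm : 2 * lam * moment ψ 0 = κ)
    (hκ : |κ| ≤ 1 / 32) : IntegrableOn (fun t => (critDeriv lam ψ t).im /
      Complex.normSq (critPath lam ψ t)) (Ioi 0) := by
  obtain ⟨B, c, ε, G⟩ := P.goodPath hm hκ
  exact G.integrable_im.integrableOn

/-- For κ < 0 the path bends away from the imaginary axis, so freezing X at its centre value x can
only increase the integral; the frozen value π/(2x) is below 2πM_0 because 4xM_0 = 1 - κδ > 1. -/
theorem Profile.lineIntegral_lt (P : Profile κ C ψ ψ') (hm : 2 * lam * moment ψ 0 = κ)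
    (hκ : |κ| ≤ 1 / 32) (hneg : κ < 0) :
    lineIntegral lam ψ < Real.pi * (2 * moment ψ 0) := by
  obtain ⟨h1, -, h2, -, -⟩ := P.centre_bounds hm hκ
  have hc : 0 < centre lam ψ := by linarith
  have hle : lineIntegral lam ψ ≤ Real.pi / (2 * centre lam ψ) := by
    rw [← P.integral_straight hm hκ]
    refine setIntegral_mono_on (P.integrableOn_line hm hκ) (P.integrable_straight hm hκ)
      measurableSet_Ioi fun t ht => ?_
    have ht0 : (0 : ℝ) < t := ht
    have hW : 0 ≤ (critDeriv lam ψ t).im := by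
      have h := (P.crit_im hm).mul_div_le critPath_zero_im
        (by rw [critDeriv_zero_im]; linarith) (β := 0) le_rfl (fun s hs => by
          rw [zero_mul]
          exact SecondOrder.line_mul_sq_le le_rfl hneg.le hs) ht0
      simpa using h
    have hX := (P.crit_re hm).sq_le_sq_of_neg hneg.le critDeriv_zero_re ht0
    rw [critPath_zero_re, neg_sq] at hX
    rw [normSq_eq_sq]
    gcongr
  refine hle.trans_lt ?_
  obtain ⟨δ, hδ, he⟩ := P.two_mul_center hm (P.pos hκ)
  have h0 := moment_pos P (P.pos hκ)
  rw [div_lt_iff₀ (by positivity)]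
  have : 0 < -κ * δ := mul_pos (by linarith) (by linarith)
  have h3 : 2 * moment ψ 0 * (2 * centre lam ψ) = 1 - κ * δ := by rw [← he, centre]; ring
  rw [mul_assoc, h3]
  nlinarith [Real.pi_pos]

/-- Up to T the straight path lies farther from the origin and needs no correction. Beyond T the
discrepancy is W(X²-x²)/((x²+Y²)(X²+Y²)), with W ≤ 2, X²-x² ≤ 12κt² and denominator at least
t^(7/2)/16; hence 384 = 2·12·16. -/
theorem Profile.sub_le_line (P : Profile κ C ψ ψ') (hm : 2 * lam * moment ψ 0 = κ)
    (hlam : 0 < lam) (hpos : 0 < κ) (hκ : κ ≤ 1 / 32) {T : ℝ} (hT : 1 ≤ T)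
    (hκT : 2 * √κ * T ≤ 1) {t : ℝ} (ht : 0 < t) :
    (critDeriv lam ψ t).im / (centre lam ψ ^ 2 + (critPath lam ψ t).im ^ 2) -
      (Ioi T).indicator (fun t => 384 * κ * t ^ (-(3 / 2) : ℝ)) t ≤
      (critDeriv lam ψ t).im / Complex.normSq (critPath lam ψ t) := by
  have hκ' : |κ| ≤ 1 / 32 := by rwa [abs_of_pos hpos]
  obtain ⟨h1, h1', h2, h3, h4⟩ := P.centre_bounds hm hκ'
  have h4 := h4 hlam
  have S := P.crit_im hm
  have hv : 0 < (critDeriv lam ψ 0).im := by rw [critDeriv_zero_im]; linarith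
  have hYpos := S.pos critPath_zero_im hv (by norm_num) (line_le hκ') ht
  have hW : 0 ≤ (critDeriv lam ψ t).im := by
    refine le_trans ?_ (S.mul_div_le critPath_zero_im hv (by norm_num) (line_le hκ') ht)
    positivity
  have hx0 : (critPath lam ψ 0).re ≤ 0 := by rw [critPath_zero_re]; linarith
  rw [normSq_eq_sq]
  by_cases htT : t ∈ Ioi T
  · rw [indicator_of_mem htT]
    have ht1 : 1 ≤ t := hT.trans (le_of_lt htT)
    have hW2 : (critDeriv lam ψ t).im ≤ 2 := by
      have h := S.deriv_le_zero hpos.le critPath_zero_im hv ht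
      rw [critDeriv_zero_im] at h
      exact (le_abs_self _).trans (h.trans h3)
    have hY : 1 / 2 * t ^ (7 / 8 : ℝ) ≤ (critPath lam ψ t).im := by
      refine le_trans ?_ (S.ge_mul_rpow critPath_zero_im hv (by norm_num) (line_le hκ') ht1)
      have h := S.half_le_one hpos.le (by linarith) critPath_zero_im hv
      rw [critDeriv_zero_im] at h
      gcongr
      linarith
    have hX := (P.crit_re hm).sq_sub_sq_le hpos.le hx0 critDeriv_zero_re ht
    rw [critPath_zero_re, neg_sq] at hX
    set x := centre lam ψ
    set X := (critPath lam ψ t).re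
    set Y := (critPath lam ψ t).im
    set W := (critDeriv lam ψ t).im
    have hX2 : X ^ 2 - x ^ 2 ≤ 12 * κ * t ^ 2 := by
      refine hX.trans ?_
      have hx2 : x ^ 2 ≤ 1 := pow_le_one₀ (by linarith) h1'
      have : 0 ≤ 12 * κ * t ^ 2 := by positivity
      nlinarith
    have hA : 0 < x ^ 2 + Y ^ 2 := by positivity
    have hB : 0 < X ^ 2 + Y ^ 2 := by positivity
    have hY4 : (1 / 16) * t ^ (7 / 2 : ℝ) ≤ (x ^ 2 + Y ^ 2) * (X ^ 2 + Y ^ 2) := by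
      have hp : ((1 / 2) * t ^ (7 / 8 : ℝ)) ^ 4 = (1 / 16) * t ^ (7 / 2 : ℝ) := by
        rw [mul_pow, ← Real.rpow_natCast (t ^ (7 / 8 : ℝ)), ← Real.rpow_mul ht.le]
        norm_num
      rw [← hp]
      calc _ ≤ Y ^ 4 := by gcongr
        _ = Y ^ 2 * Y ^ 2 := by ring
        _ ≤ _ := by
          gcongr
          · nlinarith [sq_nonneg x]
          · nlinarith [sq_nonneg X]
    have e : W / (x ^ 2 + Y ^ 2) - W / (X ^ 2 + Y ^ 2) =
        W * (X ^ 2 - x ^ 2) / ((x ^ 2 + Y ^ 2) * (X ^ 2 + Y ^ 2)) := by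
      field_simp
      ring
    have hfin : W * (X ^ 2 - x ^ 2) / ((x ^ 2 + Y ^ 2) * (X ^ 2 + Y ^ 2)) ≤
        384 * κ * t ^ (-(3 / 2) : ℝ) := by
      rw [div_le_iff₀ (by positivity)]
      have e2 : t ^ (-(3 / 2) : ℝ) * t ^ (7 / 2 : ℝ) = t ^ 2 := by
        rw [← Real.rpow_add ht, ← Real.rpow_natCast t 2]
        norm_num
      have hk : 0 ≤ 384 * κ * t ^ (-(3 / 2) : ℝ) := by positivity
      calc W * (X ^ 2 - x ^ 2) ≤ W * (12 * κ * t ^ 2) := by gcongr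
        _ ≤ 2 * (12 * κ * t ^ 2) := by gcongr
        _ = 384 * κ * t ^ (-(3 / 2) : ℝ) * ((1 / 16) * t ^ (7 / 2 : ℝ)) := by
          rw [← e2]; ring
        _ ≤ _ := mul_le_mul_of_nonneg_left hY4 hk
    linarith
  · rw [indicator_of_notMem htT, sub_zero]
    have htT' : t ≤ T := not_lt.1 htT
    have hX := (P.crit_re hm).sq_le_sq_of_small hpos.le hx0 critDeriv_zero_re ht
      (le_trans (by gcongr) hκT)
    rw [critPath_zero_re, neg_sq] at hX
    gcongr

/-- The excess of π/(2x) over 2πM_0 is πκδ/(2x) ≥ 3κ/16, while the tail beyond T = 10^8 costs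
768κ/√T < 0.08κ. The size of κ keeps 2√κT ≤ 1. -/
theorem Profile.lt_lineIntegral (P : Profile κ C ψ ψ') (hm : 2 * lam * moment ψ 0 = κ)
    (hlam : 0 < lam) (hpos : 0 < κ) (hκ : κ ≤ 1 / 10 ^ 17) (hmom : 1 / 4 ≤ moment ψ 0) :
    Real.pi * (2 * moment ψ 0) < lineIntegral lam ψ := by
  have hκ0 : κ ≤ 1 / 32 := hκ.trans (by norm_num)
  have hκ' : |κ| ≤ 1 / 32 := by rwa [abs_of_pos hpos]
  obtain ⟨h1, h1', -, -, -⟩ := P.centre_bounds hm hκ'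
  have hT0 : (0 : ℝ) < 10 ^ 8 := by norm_num
  have hκT : 2 * √κ * (10 ^ 8 : ℝ) ≤ 1 := by
    have : √κ ≤ 1 / (2 * 10 ^ 8) := by
      rw [Real.sqrt_le_left (by norm_num)]
      exact hκ.trans (by norm_num)
    linarith
  have hTi : IntegrableOn (fun t : ℝ => 384 * κ * t ^ (-(3 / 2) : ℝ)) (Ioi (10 ^ 8)) :=
    (integrableOn_Ioi_rpow_of_lt (by norm_num) hT0).const_mul _
  have hval : ∫ t in Ioi (10 ^ 8 : ℝ), 384 * κ * t ^ (-(3 / 2) : ℝ) = 768 / 10 ^ 4 * κ := by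
    rw [integral_const_mul, integral_Ioi_rpow_of_lt (by norm_num) hT0]
    have : (10 ^ 8 : ℝ) ^ (-(3 / 2) + 1 : ℝ) = 1 / 10 ^ 4 := by
      rw [← Real.rpow_natCast (10 : ℝ) 8, ← Real.rpow_mul (by norm_num)]
      rw [show ((8 : ℕ) : ℝ) * (-(3 / 2) + 1) = -((4 : ℕ) : ℝ) by norm_num,
        Real.rpow_neg (by norm_num), Real.rpow_natCast, one_div]
    rw [this]
    ring
  have hind : IntegrableOn ((Ioi (10 ^ 8 : ℝ)).indicator
      (fun t : ℝ => 384 * κ * t ^ (-(3 / 2) : ℝ))) (Ioi 0) :=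
    (integrable_indicator_iff measurableSet_Ioi).2 hTi |>.integrableOn
  have hle := setIntegral_mono_on ((P.integrable_straight hm hκ').sub hind)
    (P.integrableOn_line hm hκ') measurableSet_Ioi
    fun t ht => P.sub_le_line hm hlam hpos hκ0 (by norm_num) hκT ht
  rw [← lineIntegral] at hle
  simp only [Pi.sub_apply] at hle
  rw [integral_sub (P.integrable_straight hm hκ') hind, P.integral_straight hm hκ',
    setIntegral_indicator measurableSet_Ioi,
    inter_eq_right.2 (Ioi_subset_Ioi hT0.le), hval] at hle
  refine lt_of_lt_of_le ?_ hle
  obtain ⟨δ, hδ, he⟩ := P.two_mul_center hm (P.pos hκ')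
  have hc : 0 < centre lam ψ := by linarith
  have h3 : Real.pi / (2 * centre lam ψ) =
      Real.pi * (2 * moment ψ 0) + Real.pi * κ * δ / (2 * centre lam ψ) := by
    have : 2 * moment ψ 0 * (2 * centre lam ψ) = 1 - κ * δ := by rw [← he, centre]; ring
    field_simp
    linear_combination -this
  have h4 : 3 * κ / 16 ≤ Real.pi * κ * δ / (2 * centre lam ψ) := by
    have hpi := Real.pi_gt_three
    have hδ8 : 1 / 8 ≤ δ := by linarith
    calc 3 * κ / 16 = 3 * κ * (1 / 8) / (2 * 1) := by ring
      _ ≤ _ := by gcongr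
  linarith

end

/-! ### The two-point function for good paths -/

section

variable {μ lam B c ε B' c' ε' : ℝ} {Z W z w : ℝ → ℂ}

/-- At b = 0 the second logarithm has derivative W/Z, and Z(-t) = conj Z(t) rewrites the first. -/
theorem logTerm_eq (G : GoodPath Z W B c ε) (hs : ∀ t, Z (-t) = conj (Z t)) {f : ℂ → ℂ}
    (hf : ∀ t, f (linePoint μ t) = Z t) (a t : ℝ) :
    logTerm μ f a 0 t = Complex.log ((a : ℂ) - conj (Z t)) * (W t / Z t) := by
  have h : HasDerivAt (fun s : ℝ => Complex.log (((0 : ℝ) : ℂ) - f (linePoint μ s)))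
      (W t / Z t) t := by
    simp only [hf]
    refine (((G.deriv t).const_sub _).clog_real (G.neg_mem_slitPlane t)).congr_deriv ?_
    rw [Complex.ofReal_zero, zero_sub, neg_div_neg_eq]
  rw [logTerm, h.deriv, hf, hs]

theorem exponentIntegrand_eq {ρ : ℝ → ℝ} (G : GoodPath Z W B c ε)
    (hs : ∀ t, Z (-t) = conj (Z t)) (hZ : ∀ t, R4 lam μ ρ (linePoint μ t) = Z t)
    (g : GoodPath z w B' c' ε') (hs' : ∀ t, z (-t) = conj (z t)) (hz : ∀ t, linePoint μ t = z t)
    (a : ℝ) : exponentIntegrand lam μ ρ a 0 = fun t => pathTerm Z W a t - pathTerm z w a t := by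
  funext t
  rw [exponentIntegrand, logTerm_eq G hs hZ, logTerm_eq G hs hZ,
    logTerm_eq g hs' (f := id) hz, logTerm_eq g hs' (f := id) hz, pathTerm, pathTerm]
  ring

/-- The exponent vanishes at a = 0, so the derivative is that of the exponent minus 1/μ². The real
part alone suffices to exclude -1. The derivative is one-sided because the integral is split into
two path terms only for a ≥ 0. -/
theorem hasDerivAt_twoPoint {ρ : ℝ → ℝ} (hμ : 0 < μ) (G : GoodPath Z W B c ε)
    (hs : ∀ t, Z (-t) = conj (Z t)) (hZ : ∀ t, R4 lam μ ρ (linePoint μ t) = Z t)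
    (g : GoodPath z w B' c' ε') (hs' : ∀ t, z (-t) = conj (z t)) (hz : ∀ t, linePoint μ t = z t) :
    ∃ d : ℂ, HasDerivWithinAt (fun a : ℝ => twoPoint lam μ ρ a 0) d (Ici 0) 0 ∧
      d.re = (1 / (2 * Real.pi)) * ((∫ t, (w t).im / Complex.normSq (z t)) -
        ∫ t, (W t).im / Complex.normSq (Z t)) - 1 / μ ^ 2 := by
  obtain ⟨i1, h1⟩ := G.hasDerivAt_integral
  obtain ⟨i2, h2⟩ := g.hasDerivAt_integral
  have him : ∀ {Z W : ℝ → ℂ}, Integrable (fun t => W t / ((Complex.normSq (Z t) : ℝ) : ℂ)) →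
      (∫ t, W t / ((Complex.normSq (Z t) : ℝ) : ℂ)).im = ∫ t, (W t).im / Complex.normSq (Z t) :=
    fun {Z W} hi => by
      rw [← Complex.imCLM_apply, ← Complex.imCLM.integral_comp_comm hi]
      refine integral_congr_ae (Eventually.of_forall fun t => ?_)
      exact Complex.div_ofReal_im _ _
  have hm : 0 < μ ^ 2 := by positivity
  have hmc : (μ : ℂ) ^ 2 ≠ 0 := by
    rw [← Complex.ofReal_pow]; exact Complex.ofReal_ne_zero.2 hm.ne'
  have hp : ∀ (Z W : ℝ → ℂ) t, pathTerm Z W 0 t = 0 := fun Z W t => by simp [pathTerm]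
  set k : ℂ := 1 / (2 * (Real.pi : ℂ) * Complex.I) with hk
  have hd := ((((h1.sub h2).const_mul k).cexp).const_mul ((μ : ℂ) ^ 2)).div
    ((((Complex.ofRealCLM.hasDerivAt (x := (0 : ℝ)))).const_add ((μ : ℂ) ^ 2)).add_const
      (((0 : ℝ) : ℂ))) (by simpa using hmc)
  have he : EqOn (fun a : ℝ => twoPoint lam μ ρ a 0) (fun a : ℝ => (μ : ℂ) ^ 2 * Complex.exp (k *
      ((∫ t, pathTerm Z W a t) - ∫ t, pathTerm z w a t)) / ((μ : ℂ) ^ 2 + (a : ℂ) +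
      ((0 : ℝ) : ℂ))) (Ici 0) := fun a ha => by
    simp only [twoPoint]
    rw [exponentIntegrand_eq G hs hZ g hs' hz,
      integral_sub (G.integrable_pathTerm ha) (g.integrable_pathTerm ha)]
  refine ⟨_, hd.hasDerivWithinAt.congr he (he (mem_Ici.2 le_rfl)), ?_⟩
  have hk' : k = -Complex.I * ((1 / (2 * Real.pi) : ℝ) : ℂ) := by
    rw [hk]
    have : (Real.pi : ℂ) ≠ 0 := Complex.ofReal_ne_zero.2 Real.pi_ne_zero
    push_cast
    field_simp
    rw [Complex.I_sq, neg_neg]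
  rw [← him i1, ← him i2]
  set K₁ := ∫ t, W t / ((Complex.normSq (Z t) : ℝ) : ℂ)
  set K₂ := ∫ t, w t / ((Complex.normSq (z t) : ℝ) : ℂ)
  simp only [Pi.sub_apply, hp, integral_zero, sub_zero, mul_zero, Complex.exp_zero, mul_one,
    one_mul, Complex.ofRealCLM_apply, Complex.ofReal_zero, add_zero, Complex.ofReal_one]
  have e : ((μ : ℂ) ^ 2 * (k * (-K₁ - -K₂)) * (μ : ℂ) ^ 2 - (μ : ℂ) ^ 2) / ((μ : ℂ) ^ 2) ^ 2 =
      ((1 / (2 * Real.pi) : ℝ) : ℂ) * (-Complex.I * (K₂ - K₁)) - ((1 / μ ^ 2 : ℝ) : ℂ) := by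
    have : (Real.pi : ℂ) ≠ 0 := Complex.ofReal_ne_zero.2 Real.pi_ne_zero
    have hμc : (μ : ℂ) ≠ 0 := Complex.ofReal_ne_zero.2 hμ.ne'
    rw [hk']
    push_cast
    field_simp
    ring
  rw [e, Complex.sub_re, Complex.re_ofReal_mul, Complex.ofReal_re]
  simp

end

theorem integral_eq_two_mul_of_even {f : ℝ → ℝ} (hf : ∀ t, f (-t) = f t) :
    ∫ t, f t = 2 * ∫ t in Ioi (0 : ℝ), f t := by
  rw [← integral_comp_abs]
  congr 1
  funext t
  rcases abs_choice t with h | h <;> rw [h]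
  rw [hf]

/-! ### The straight path -/

theorem linePoint_re (μ t : ℝ) : (linePoint μ t).re = -(μ ^ 2 / 2) := by
  simp [linePoint, ← Complex.ofReal_pow, neg_div]

theorem linePoint_im (μ t : ℝ) : (linePoint μ t).im = t := by
  simp [linePoint, ← Complex.ofReal_pow]

theorem linePoint_neg (μ t : ℝ) : linePoint μ (-t) = conj (linePoint μ t) := by
  apply Complex.ext <;> simp only [linePoint_re, linePoint_im, Complex.conj_re, Complex.conj_im]

theorem goodPath_linePoint {μ : ℝ} (hμ : 0 < μ) :
    ∃ B c ε, GoodPath (linePoint μ) (fun _ => Complex.I) B c ε := by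
  have hd : ∀ t : ℝ, HasDerivAt (linePoint μ) Complex.I t := fun t => by
    refine ((Complex.ofRealCLM.hasDerivAt (x := t)).const_mul Complex.I).const_add _
      |>.congr_deriv ?_
    simp
  refine ⟨1, goodPath_of_secondOrder (q := fun _ => 0) hd continuous_const zero_le_one
    (fun t => ?_) ⟨fun t _ => ?_, fun t _ => ?_, continuousAt_const⟩ (fun t _ => ?_) (fun t => ?_)
    ?_ ?_⟩
  · rw [Complex.norm_I, one_mul]
    exact one_le_rpow_abs t (by norm_num)
  · exact HasDerivAt.im_comp (hd t)
  · simpa using hasDerivAt_const t (1 : ℝ)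
  · norm_num
  · rw [linePoint_im, linePoint_im]
  · rw [linePoint_re]
    have : 0 < μ ^ 2 := by positivity
    linarith
  · rw [Complex.I_im]; exact one_pos

theorem integral_linePoint {μ : ℝ} (hμ : 0 < μ) :
    ∫ t, (Complex.I).im / Complex.normSq (linePoint μ t) = 2 * Real.pi / μ ^ 2 := by
  obtain ⟨B, c, ε, G⟩ := goodPath_linePoint hμ
  have hi := G.integrable_im.integrableOn (s := Ioi 0)
  have hm : 0 < μ ^ 2 := by positivity
  simp only [normSq_eq_sq, linePoint_re, linePoint_im, Complex.I_im, neg_sq] at hi ⊢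
  rw [integral_eq_two_mul_of_even (fun t => by rw [neg_sq]),
    integral_arctan (x := μ ^ 2 / 2) (Y := fun t => t) (by positivity)
      (fun t _ => hasDerivAt_id t) rfl tendsto_id hi]
  field_simp

/-! ### The boundary condition of the two-point function -/

section

variable {κ C lam μ : ℝ} {ψ ψ' : ℝ → ℝ}

theorem linePoint_eq (hμ : 0 < μ) (t : ℝ) :
    linePoint μ t = (μ : ℂ) ^ 2 * critPoint (t / μ ^ 2) := by
  have : (μ : ℂ) ≠ 0 := Complex.ofReal_ne_zero.2 hμ.ne'
  rw [linePoint, critPoint]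
  push_cast
  field_simp

theorem integral_scaled (hμ : 0 < μ) :
    ∫ t, (critDeriv lam ψ (t / μ ^ 2)).im /
      Complex.normSq (((μ ^ 2 : ℝ) : ℂ) * critPath lam ψ (t / μ ^ 2)) =
      2 * lineIntegral lam ψ / μ ^ 2 := by
  have hm : 0 < μ ^ 2 := by positivity
  rw [integral_eq_two_mul_of_even (fun t => ?_)]
  · rw [integral_Ioi_scale (g := fun t => (critDeriv lam ψ t).im /
      Complex.normSq (critPath lam ψ t)) hm fun t _ => ?_, lineIntegral, smul_eq_mul]
    · ring
    · rw [Complex.normSq_mul, Complex.normSq_ofReal, smul_eq_mul, div_eq_inv_mul t, ← sq,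
        div_mul_eq_div_div_swap, div_eq_inv_mul]
  · rw [neg_div, critPath_neg, critDeriv_neg, Complex.neg_im, Complex.conj_im, neg_neg,
      Complex.normSq_mul, Complex.normSq_mul, Complex.normSq_conj]

theorem Profile.twoPoint_boundary (P : Profile (kappa lam) C ψ ψ') (hlam : -(1 / Real.pi) ≤ lam)
    (hκ : |kappa lam| ≤ 1 / 32) (hμ : 0 < μ) (hm : μ ^ 2 = 2 * moment ψ 0)
    (hne : lineIntegral lam ψ ≠ Real.pi * (2 * moment ψ 0)) :
    (∀ a : ℝ, 0 ≤ a →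
      Integrable (fun t : ℝ => exponentIntegrand lam μ (rho lam μ) a 0 t)) ∧
    ∃ d : ℂ, d ≠ -1 ∧
      HasDerivWithinAt (fun a : ℝ => twoPoint lam μ (rho lam μ) a 0) d (Ici 0) 0 := by
  have hm0 : 0 < μ ^ 2 := by positivity
  obtain ⟨_, _, _, G₀⟩ := P.goodPath (P.moment_zero hlam) hκ
  obtain ⟨_, _, _, G⟩ := G₀.scale hm0
  obtain ⟨_, _, _, g⟩ := goodPath_linePoint hμ
  have hs : ∀ t : ℝ, ((μ ^ 2 : ℝ) : ℂ) * critPath lam ψ (-t / μ ^ 2) =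
      conj (((μ ^ 2 : ℝ) : ℂ) * critPath lam ψ (t / μ ^ 2)) := fun t => by
    rw [neg_div, critPath_neg, map_mul, Complex.conj_ofReal]
  have hZ : ∀ t, R4 lam μ (rho lam μ) (linePoint μ t) =
      ((μ ^ 2 : ℝ) : ℂ) * critPath lam ψ (t / μ ^ 2) := fun t => by
    rw [linePoint_eq hμ, P.R4_eq hlam hμ, critPath, Complex.ofReal_pow]
  refine ⟨fun a ha => ?_, ?_⟩
  · rw [exponentIntegrand_eq G hs hZ g (linePoint_neg μ) fun _ => rfl]
    exact (G.integrable_pathTerm ha).sub (g.integrable_pathTerm ha)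
  · obtain ⟨d, hd, hre⟩ := hasDerivAt_twoPoint hμ G hs hZ g (linePoint_neg μ) fun _ => rfl
    refine ⟨d, fun hd1 => hne ?_, hd⟩
    -- The straight path contributes 1/μ², cancelling the -1/μ² of the prefactor; d = -1 would thus
    -- mean that the line integral equals πμ² = 2πM_0.
    rw [hd1, integral_linePoint hμ, integral_scaled hμ, Complex.neg_re, Complex.one_re] at hre
    have hpi := Real.pi_pos
    rw [← hm]
    field_simp at hre
    linarith

end

/-! ### Small coupling -/

theorem tendsto_kappa : Tendsto kappa (𝓝 0) (𝓝 0) := by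
  have h : ContinuousAt (fun lam : ℝ => (Real.arcsin (lam * Real.pi) / Real.pi) *
      (1 - Real.arcsin (lam * Real.pi) / Real.pi)) 0 := by
    have := Real.continuous_arcsin
    fun_prop
  have h0 : Tendsto (fun lam : ℝ => (Real.arcsin (lam * Real.pi) / Real.pi) *
      (1 - Real.arcsin (lam * Real.pi) / Real.pi)) (𝓝 0) (𝓝 0) := by
    simpa using h.tendsto
  refine h0.congr' ?_
  filter_upwards [Iio_mem_nhds (show (0 : ℝ) < 1 / Real.pi by have := Real.pi_pos; positivity)]
    with lam hlam
  rw [kappa, if_pos (le_of_lt hlam)]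

/-- From sin x ≤ x one gets α ≥ λ, and α ≤ 1/2 gives 1 - α ≥ 1/2. Through 2λM_0 = κ this supplies
M_0 ≥ 1/4 for positive λ. -/
theorem half_le_kappa {lam : ℝ} (h0 : 0 < lam) (h1 : lam ≤ 1 / Real.pi) :
    lam / 2 ≤ kappa lam := by
  have hpi := Real.pi_gt_three
  have hx : lam * Real.pi ≤ 1 := by rwa [← le_div_iff₀ (by linarith)]
  have hx0 : 0 < lam * Real.pi := by positivity
  have hs : lam ≤ Real.arcsin (lam * Real.pi) / Real.pi := by
    rw [le_div_iff₀ (by linarith), Real.le_arcsin_iff_sin_le ⟨by linarith, by linarith⟩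
      ⟨by linarith, hx⟩]
    exact Real.sin_le hx0.le
  have hb := (arcsin_div_pi_bounds (lam * Real.pi)).2
  rw [kappa, if_pos h1]
  nlinarith

theorem eventually_twoPoint_boundary : ∀ᶠ lam : ℝ in 𝓝[≠] 0, ∀ μ : ℝ, 0 < μ →
    IsNaturalMass lam μ →
    (∀ a : ℝ, 0 ≤ a → Integrable (fun t : ℝ => exponentIntegrand lam μ (rho lam μ) a 0 t)) ∧
    ∃ d : ℂ, d ≠ -1 ∧
      HasDerivWithinAt (fun a : ℝ => twoPoint lam μ (rho lam μ) a 0) d (Ici 0) 0 := by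
  have hpi : 0 < 1 / Real.pi := by have := Real.pi_pos; positivity
  have hk : ∀ᶠ lam in 𝓝 (0 : ℝ), |kappa lam| < 1 / 10 ^ 17 := by
    have h := tendsto_kappa.abs
    rw [abs_zero] at h
    exact h.eventually (gt_mem_nhds (by positivity))
  filter_upwards [nhdsWithin_le_nhds hk, nhdsWithin_le_nhds (Ioo_mem_nhds (neg_lt_zero.2 hpi) hpi),
    self_mem_nhdsWithin] with lam hκ hlam hne μ hμ hmass
  have h0 : lam ≠ 0 := hne
  obtain ⟨C, ψ, ψ', P⟩ := exists_profile (neg_three_quarters_le_kappa lam)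
  have hmom := P.moment_zero hlam.1.le
  have hm : μ ^ 2 = 2 * moment ψ 0 := by
    rw [isNaturalMass_iff.1 hmass, ← hmom]
    field_simp
  have hκ' : |kappa lam| ≤ 1 / 32 := hκ.le.trans (by norm_num)
  refine P.twoPoint_boundary hlam.1.le hκ' hμ hm ?_
  rcases lt_or_gt_of_ne h0 with h | h
  · exact (P.lineIntegral_lt hmom hκ' (kappa_neg h)).ne
  · refine (P.lt_lineIntegral hmom h (kappa_pos h) ((le_abs_self _).trans hκ.le) ?_).ne'
    have h1 := half_le_kappa h hlam.2.le
    rw [← hmom] at h1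
    nlinarith

end MoyalFour

theorem proposition4p5 :
    -- the hypergeometric function is real and solves the Fredholm equation
    (∀ lam μ : ℝ, -(1 / Real.pi) ≤ lam → 0 < μ →
      (∀ x : ℝ, 0 ≤ x → ((MoyalFour.rho lam μ x : ℝ) : ℂ) = MoyalFour.hypDensity lam μ x) ∧
      MoyalFour.SolvesFredholm lam μ (MoyalFour.rho lam μ)) ∧
    -- the particular choice of `μ²` is available
    (∀ lam : ℝ, -(1 / Real.pi) ≤ lam → lam ≠ 0 →
      ∃ μ : ℝ, 0 < μ ∧ MoyalFour.IsNaturalMass lam μ) ∧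
    -- it is the one for which the natural boundary conditions hold
    (∀ lam μ : ℝ, -(1 / Real.pi) ≤ lam → lam ≠ 0 → 0 < μ →
      IntegrableOn (fun t : ℝ => MoyalFour.rho lam μ t / ((t + μ ^ 2) ^ 2 * t)) (Ioi 0) ∧
      (MoyalFour.R4 lam μ (MoyalFour.rho lam μ) (-(μ : ℂ) ^ 2) = -1 ↔
        MoyalFour.IsNaturalMass lam μ) ∧
      IntegrableOn (fun t : ℝ => MoyalFour.rho lam μ t / (t + μ ^ 2) ^ 3) (Ioi 0) ∧
      ((∫ t in Ioi (0 : ℝ), MoyalFour.rho lam μ t / (t + μ ^ 2) ^ 3) = 1 / 2 ↔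
        MoyalFour.IsNaturalMass lam μ)) ∧
    -- it differs from the condition `∂G(a, 0)/∂a = -1` at `a = 0`
    (∀ᶠ lam : ℝ in 𝓝[≠] 0, ∀ μ : ℝ, 0 < μ → MoyalFour.IsNaturalMass lam μ →
      (∀ a : ℝ, 0 ≤ a → Integrable
        (fun t : ℝ => MoyalFour.exponentIntegrand lam μ (MoyalFour.rho lam μ) a 0 t)) ∧
      ∃ d : ℂ, d ≠ -1 ∧
        HasDerivWithinAt (fun a : ℝ => MoyalFour.twoPoint lam μ (MoyalFour.rho lam μ) a 0) d
          (Ici 0) 0) := by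
  open MoyalFour in
  refine ⟨fun lam μ hlam hμ => ?_, fun lam _ h0 => exists_naturalMass h0,
    fun lam μ hlam h0 hμ => ?_, eventually_twoPoint_boundary⟩
  · obtain ⟨C, ψ, ψ', P⟩ := exists_profile (neg_three_quarters_le_kappa lam)
    refine ⟨fun x hx => ?_, P.solvesFredholm hlam hμ⟩
    rw [rho, P.hypDensity_eq hlam hμ hx, Complex.ofReal_re]
  · obtain ⟨C, ψ, ψ', P⟩ := exists_profile (neg_three_quarters_le_kappa lam)
    exact ⟨P.integrableOn_rho_div hlam hμ, P.R4_neg_iff hlam h0 hμ,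
      P.integrableOn_rho_cube hlam hμ, P.integral_rho_cube_iff hlam h0 hμ⟩
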